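/- Let $\mathcal{G}$ be a class of finite, simple, undirected graphs of polynomial growth with growth rate $\delta \ge 0$ (a real number). That is, there is a constant $C$ such that for every $G \in \mathcal{G}$, every vertex $v \in V(G)$ and every non-negative integer $r$, $|B_G(v,r)| \le C\, r^{\delta}$, where $B_G(v,r) = \{w \in V(G) : \mathrm{dist}_G(v,w) < r\}$. Then there exist a randomized algorithm, a polynomial $p$ and constants $c_1, c_2$, all depending only on $\mathcal{G}$ and $\delta$, such that for every graph $G \in \mathcal{G}$ with $n$ vertices and every integer $k \ge 2$, the algorithm, given $G$ and $k$, stops after at most $p(n + \log k)$ steps, whatever its coin flips are, and outputs a set $A \subseteq V(G)$ with the following properties: 1. for every outcome of the coin flips, the treedepth of the induced subgraph $G[A]$ is at most $c_1\, k^{1-\frac{1}{1+\delta}} \log_2 k$; 2. for every set $X \subseteq V(G)$ of size at most $k$, the probability that $X \subseteq A$ is at least $2^{-c_2\, k^{1-\frac{1}{1+\delta}} \log_2^2 k}$. Here the treedepth of the empty graph is $0$; the treedepth of a connected graph $H$ with at least one vertex is $1 + \min_{v \in V(H)} \mathrm{treedepth}(H - v)$; and the treedepth of a disconnected graph is the maximum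 of the treedepths of its connected components. Algorithms are programs for a random access machine with addition, subtraction, indirect addressing and fair coin flips, each executed statement being one step; the graph is given by its adjacency matrix. -/

import Mathlib

/-! ### Graphs: balls, polynomial growth, treedepth -/

/-- The open ball `B_G(v, r)`: the vertices at distance less than `r` from `v`.
The distance is `edist`, which is infinite between different components. -/
def graphBall {V : Type} (G : SimpleGraph V) (v : V) (r : ℕ) : Set V :=
  {w | G.edist v w < (r : ℕ∞)}

/-- A class of finite graphs (graphs with vertex set `Fin n`, for all `n`) has polynomial growth
with growth rate `δ`: some constant `C` satisfies `|B_G(v, r)| ≤ C * r ^ δ` for every graph `G`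
of the class, every vertex `v` and every radius `r`. -/
def HasPolynomialGrowth (𝒢 : (n : ℕ) → Set (SimpleGraph (Fin n))) (δ : ℝ) : Prop :=
  ∃ C : ℝ, ∀ (n : ℕ), ∀ G ∈ 𝒢 n, ∀ (v : Fin n) (r : ℕ),
    ((graphBall G v r).ncard : ℝ) ≤ C * (r : ℝ) ^ δ

open Classical in
/-- The vertex set of the connected component of `G[S]` that contains `v`
(empty if `v ∉ S`). -/
noncomputable def componentIn {V : Type} (G : SimpleGraph V) (S : Finset V) (v : V) : Finset V :=
  S.filter fun w => ∃ (hv : v ∈ S) (hw : w ∈ S),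
    (G.induce (S : Set V)).Reachable ⟨v, hv⟩ ⟨w, hw⟩

theorem card_componentIn_lt {V : Type} (G : SimpleGraph V) (S : Finset V)
    (hS : ¬ (G.induce (S : Set V)).Connected) (v : V) (hv : v ∈ S) :
    (componentIn G S v).card < S.card := by
  classical
  apply Finset.card_lt_card
  refine ⟨Finset.filter_subset _ _, fun hsub => hS ?_⟩
  have key : ∀ w (hw : w ∈ S), (G.induce (S : Set V)).Reachable ⟨v, hv⟩ ⟨w, hw⟩ := by
    intro w hw
    obtain ⟨_, _, _, h⟩ := Finset.mem_filter.1 (hsub hw)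
    exact h
  have : Nonempty (S : Set V) := ⟨⟨v, hv⟩⟩
  exact ⟨fun a b => (key a.1 a.2).symm.trans (key b.1 b.2)⟩

open Classical in
/-- The treedepth of the induced subgraph `G[S]`: it is `0` if `S` is empty; otherwise it is
`1 + min {treedepth (G[S] - v) | v ∈ S}` if `G[S]` is connected, and the maximum of the treedepths
of the connected components of `G[S]` if it is not. -/
noncomputable def treedepth {V : Type} (G : SimpleGraph V) (S : Finset V) : ℕ :=
  if hS : S.Nonempty then
    if hc : (G.induce (S : Set V)).Connected then
      1 + S.attach.inf' (Finset.attach_nonempty_iff.2 hS) fun v => treedepth G (S.erase v.1)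
    else
      S.attach.sup fun v => treedepth G (componentIn G S v.1)
  else 0
termination_by S.card
decreasing_by
  · exact Finset.card_erase_lt_of_mem v.2
  · exact card_componentIn_lt G S hc v.1 v.2

/-! ### Randomized random access machines

Programs are while programs over finitely many unbounded arrays of natural numbers, with indirect
addressing, addition, truncated subtraction and fair coin flips; every executed statement costs
one step. There is no multiplication, so a step lengthens the numbers in memory by at most a
constant number of bits, and polynomial time in this model is the usual polynomial time. -/

/-- The memory: `m a i` is the content of cell `i` of array `a`. -/
abbrev Mem : Type := ℕ → ℕ → ℕ

/-- Write the value `x` to cell `i` of array `a`. -/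
def Mem.write (m : Mem) (a i x : ℕ) : Mem :=
  Function.update m a (Function.update (m a) i x)

/-- Expressions; `get a e` reads the cell of array `a` whose index is the value of `e`. -/
inductive Expr : Type where
  | lit (c : ℕ) : Expr
  | get (a : ℕ) (e : Expr) : Expr
  | add (e f : Expr) : Expr
  | sub (e f : Expr) : Expr

/-- The value of an expression (`sub` is truncated subtraction). -/
def Expr.eval (m : Mem) : Expr → ℕ
  | .lit c => c
  | .get a e => m a (e.eval m)
  | .add e f => e.eval m + f.eval m
  | .sub e f => e.eval m - f.eval m

/-- Programs. -/
inductive Prog : Type where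
  | skip : Prog
  /-- write the value of `e` to cell `i` of array `a` -/
  | assign (a : ℕ) (i e : Expr) : Prog
  /-- write a fair random bit to cell `i` of array `a` -/
  | coin (a : ℕ) (i : Expr) : Prog
  | seq (c d : Prog) : Prog
  /-- run `c` if the value of `e` is nonzero, and `d` otherwise -/
  | ite (e : Expr) (c d : Prog) : Prog
  /-- run `c` as long as the value of `e` is nonzero -/
  | loop (e : Expr) (c : Prog) : Prog

/-- A configuration: the statements that are still to be executed, and the memory.
The machine has halted if no statement is left. -/
abbrev Config : Type := List Prog × Mem

/-- One step of the machine. -/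
noncomputable def step : Config → PMF Config
  | ([], m) => PMF.pure ([], m)
  | (.skip :: K, m) => PMF.pure (K, m)
  | (.assign a i e :: K, m) => PMF.pure (K, m.write a (i.eval m) (e.eval m))
  | (.coin a i :: K, m) =>
      (PMF.uniformOfFintype Bool).map fun b => (K, m.write a (i.eval m) b.toNat)
  | (.seq c d :: K, m) => PMF.pure (c :: d :: K, m)
  | (.ite e c d :: K, m) => PMF.pure ((if e.eval m ≠ 0 then c else d) :: K, m)
  | (.loop e c :: K, m) => PMF.pure (if e.eval m ≠ 0 then c :: .loop e c :: K else K, m)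

/-- The distribution of the configuration after `t` steps. -/
noncomputable def run : ℕ → Config → PMF Config
  | 0, x => PMF.pure x
  | t + 1, x => (step x).bind (run t)

open Classical in
/-- The initial memory on input `(G, k)`: array `0` holds the number `n` of vertices, array `1`
holds `k`, array `2` holds the adjacency matrix row by row; all other cells are `0`. -/
noncomputable def inputMem {n : ℕ} (G : SimpleGraph (Fin n)) (k : ℕ) : Mem
  | 0, 0 => n
  | 1, 0 => k
  | 2, i => if ∃ u v : Fin n, G.Adj u v ∧ i = (u : ℕ) * n + v then 1 else 0
  | _, _ => 0

/-- The vertex set that a memory encodes: the vertices whose cell in array `3` is nonzero. -/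
def outputSet (n : ℕ) (m : Mem) : Finset (Fin n) :=
  Finset.univ.filter fun v => m 3 (v : ℕ) ≠ 0

/-- On input `(G, k)` the program halts within `T` steps, whatever the coin flips are. -/
def HaltsWithin (P : Prog) {n : ℕ} (G : SimpleGraph (Fin n)) (k T : ℕ) : Prop :=
  ∀ x ∈ (run T ([P], inputMem G k)).support, x.1 = []

/-- The distribution of the vertex set that the memory encodes after `T` steps; if the program
halts within `T` steps, this is the distribution of its output. -/
noncomputable def outputDist (P : Prog) {n : ℕ} (G : SimpleGraph (Fin n)) (k T : ℕ) :
    PMF (Finset (Fin n)) :=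
  (run T ([P], inputMem G k)).map fun x => outputSet n x.2

/-- The length of the input `(G, k)`, up to a polynomial: the number of vertices plus the number
of binary digits of `k`. -/
def inputSize (n k : ℕ) : ℕ := n + Nat.size k

/-! ### Program logic -/

/-! Write `L` for the number of binary digits of `k` and `σ = k ^ (1 / (1 + δ))`. This scale
balances two costs: a ball of radius about `σ` has `O(σ ^ δ) = O(k / σ)` vertices, and a boundary
that contains about one in `σ` of the vertices of `X` meets `X` in about `k / σ` vertices. Since `δ`
is a real number, the program does not compute `σ`. It searches for the first `d` such that some
ball of radius `K (d + 1)` has more than `C k / (d + 1)` vertices. Polynomial growth forces `σ < d +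
1` (`scale_lt`), and the last passed test bounds all balls of radius `M = K d` by `C k / d = O(k /
σ)` (`mul_card_reach_le`). If no test fails, all components are that small and the whole vertex set
is output (`treedepth_univ_le`).

Otherwise the graph is carved. The vertices take turns as centers; a center that is still present
draws a truncated geometric radius with hazard `2 ^ (-s)`, where `2 ^ s` is about `M / (3 L)`. Its
ball in the remaining graph is removed, and the outermost sphere of the ball joins the boundary.
Connected sets that avoid the boundary lie in balls of radius `M` (`exists_center`). Each boundary
vertex is selected with probability `2 ^ (-B L)`, the others are deleted, and components with more
than `k / 2 ^ s` boundary vertices are discarded. For every outcome the treedepth is at most `k / 2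
^ s` plus the size of a ball (`treedepth_pruned_le`).

The set `X` survives if at most `k / 2 ^ s` of its vertices are boundary vertices, all of these are
selected, and nothing else near `X` is (`subset_pruned`). The heart is the probability of the first
event. Around a given center, call a radius light if its sphere has at most a `2 ^ (-s)` fraction of
the vertices of `X` in the earlier spheres, and heavy otherwise. If all balls meeting `X` stop at
light radii, the boundary is small enough. A heavy radius multiplies one plus the number of vertices
of `X` seen so far by at least `1 + 2 ^ (-s)`, so there are at most `2 ^ s * L` of them, hence at
least `2 * 2 ^ s * L` light ones below `M`; all light ones are missed with probability at most `4 ^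
(-L)`. Not stopping at a heavy radius costs a factor `1 - 2 ^ (-s)`, but its sphere contains a
vertex of `X` that the ball removes, so in total at most `|X|` such factors are paid.
`light_expectation` is this computation for one ball, and `carvePotential_step` turns it into a
potential that does not decrease in expectation.

The dominant loss is the selection of the boundary vertices, `2 ^ (-B L k / 2 ^ s)`;
`sample_prob_ge` collects all factors. On the side of the machine, the random phase is described by
Markov chains on small state spaces, and `mainProg_spec` identifies the output law with `sample`,
after which no program occurs any more. -/

/-- Started in memory `m`, the program `c` takes exactly `t` steps, and the memory at its end is
distributed according to `μ`. -/
def Sem (c : Prog) (m : Mem) (t : ℕ) (μ : PMF Mem) : Prop :=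
  ∀ (K : List Prog) (s : ℕ), run (s + t) (c :: K, m) = μ.bind fun x => run s (K, x)

/-- Started in memory `m`, the program `c` deterministically ends within `T` steps in a memory
that satisfies `Q`. -/
def Does (c : Prog) (m : Mem) (T : ℕ) (Q : Mem → Prop) : Prop :=
  ∃ t ≤ T, ∃ m', Sem c m t (PMF.pure m') ∧ Q m'

theorem Sem.assign (a : ℕ) (i e : Expr) (m : Mem) :
    Sem (.assign a i e) m 1 (PMF.pure (m.write a (i.eval m) (e.eval m))) := by
  intro K s
  simp [run, step, PMF.pure_bind]

theorem Sem.coin (a : ℕ) (i : Expr) (m : Mem) :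
    Sem (.coin a i) m 1
      ((PMF.uniformOfFintype Bool).map fun b => m.write a (i.eval m) b.toNat) := by
  intro K s
  simp [run, step, PMF.bind_map, Function.comp_def]

theorem Sem.skip (m : Mem) : Sem .skip m 1 (PMF.pure m) := by
  intro K s
  simp [run, step, PMF.pure_bind]

/-- The law lives on a state space `α` that `f` embeds into memories, so distributions need not be
computed on memories. The time `t'` is the same for all outcomes; this is why the random phase is
written with a running time that does not depend on the coins. -/
theorem Sem.seq_bind {α : Type} {c d : Prog} {m : Mem} {t t' : ℕ} {μ : PMF α} {f : α → Mem}
    {ν : α → PMF Mem} (hc : Sem c m t (μ.map f)) (hd : ∀ x, Sem d (f x) t' (ν x)) :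
    Sem (.seq c d) m (t' + t + 1) (μ.bind ν) := by
  intro K s
  rw [← add_assoc, ← add_assoc]
  simp only [run, step, PMF.pure_bind]
  rw [hc, PMF.bind_map, PMF.bind_bind]
  refine congrArg _ (funext fun x => ?_)
  simp only [Function.comp]
  rw [hd]

theorem Sem.seq_map {α : Type} {c d : Prog} {m : Mem} {t t' : ℕ} {μ : PMF α} {f g : α → Mem}
    (hc : Sem c m t (μ.map f)) (hd : ∀ x, Sem d (f x) t' (PMF.pure (g x))) :
    Sem (.seq c d) m (t' + t + 1) (μ.map g) :=
  Sem.seq_bind hc hd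

theorem Sem.seq_pure {c d : Prog} {m m' : Mem} {t t' : ℕ} {ν : PMF Mem}
    (hc : Sem c m t (PMF.pure m')) (hd : Sem d m' t' ν) :
    Sem (.seq c d) m (t' + t + 1) ν := by
  intro K s
  rw [← add_assoc, ← add_assoc]
  simp only [run, step, PMF.pure_bind]
  rw [hc, PMF.pure_bind, hd]

theorem Sem.ite_true {e : Expr} {c d : Prog} {m : Mem} {t : ℕ} {μ : PMF Mem}
    (h : e.eval m ≠ 0) (hc : Sem c m t μ) : Sem (.ite e c d) m (t + 1) μ := by
  intro K s
  rw [← add_assoc]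
  simp only [run, step, PMF.pure_bind, h, ne_eq, not_false_eq_true, if_true]
  exact hc K s

theorem Sem.ite_false {e : Expr} {c d : Prog} {m : Mem} {t : ℕ} {μ : PMF Mem}
    (h : e.eval m = 0) (hd : Sem d m t μ) : Sem (.ite e c d) m (t + 1) μ := by
  intro K s
  rw [← add_assoc]
  simp only [run, step, PMF.pure_bind, h, ne_eq, not_true_eq_false, if_false]
  exact hd K s

theorem Sem.loop_done {e : Expr} {c : Prog} {m : Mem} (h : e.eval m = 0) :
    Sem (.loop e c) m 1 (PMF.pure m) := by
  intro K s
  simp [run, step, PMF.pure_bind, h]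

theorem Sem.loop_pure {e : Expr} {c : Prog} {m m' : Mem} {t t' : ℕ} {ν : PMF Mem}
    (h : e.eval m ≠ 0) (hc : Sem c m t (PMF.pure m')) (hl : Sem (.loop e c) m' t' ν) :
    Sem (.loop e c) m (t' + t + 1) ν := by
  intro K s
  rw [← add_assoc, ← add_assoc]
  simp only [run, step, PMF.pure_bind, h, ne_eq, not_false_eq_true, if_true]
  rw [hc, PMF.pure_bind, hl]

theorem Sem.loop_map {α : Type} {e : Expr} {c : Prog} {m : Mem} {t t' : ℕ} {μ : PMF α}
    {f : α → Mem} {ν : α → PMF Mem}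
    (h : e.eval m ≠ 0) (hc : Sem c m t (μ.map f)) (hl : ∀ x, Sem (.loop e c) (f x) t' (ν x)) :
    Sem (.loop e c) m (t' + t + 1) (μ.bind ν) := by
  intro K s
  rw [← add_assoc, ← add_assoc]
  simp only [run, step, PMF.pure_bind, h, ne_eq, not_false_eq_true, if_true]
  rw [hc, PMF.bind_map, PMF.bind_bind]
  refine congrArg _ (funext fun x => ?_)
  simp only [Function.comp]
  rw [hl]

namespace Does

variable {c d : Prog} {m : Mem} {T T' : ℕ} {Q Q' : Mem → Prop}

theorem mono (h : Does c m T Q) (hT : T ≤ T') (hQ : ∀ m', Q m' → Q' m') : Does c m T' Q' := by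
  obtain ⟨t, ht, m', hs, hq⟩ := h
  exact ⟨t, ht.trans hT, m', hs, hQ _ hq⟩

theorem assign {a : ℕ} {i e : Expr} (h : Q (m.write a (i.eval m) (e.eval m))) :
    Does (.assign a i e) m 1 Q :=
  ⟨1, le_rfl, _, Sem.assign a i e m, h⟩

theorem skip (h : Q m) : Does .skip m 1 Q := ⟨1, le_rfl, _, Sem.skip m, h⟩

theorem seq (h : Does c m T fun m' => Does d m' T' Q) : Does (.seq c d) m (T + T' + 1) Q := by
  obtain ⟨t, ht, m', hs, t', ht', m'', hs', hq⟩ := h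
  exact ⟨t' + t + 1, by omega, m'', Sem.seq_pure hs hs', hq⟩

theorem ite {e : Expr} (h₁ : e.eval m ≠ 0 → Does c m T Q) (h₂ : e.eval m = 0 → Does d m T Q) :
    Does (.ite e c d) m (T + 1) Q := by
  by_cases h : e.eval m = 0
  · obtain ⟨t, ht, m', hs, hq⟩ := h₂ h
    exact ⟨t + 1, by omega, m', Sem.ite_false h hs, hq⟩
  · obtain ⟨t, ht, m', hs, hq⟩ := h₁ h
    exact ⟨t + 1, by omega, m', Sem.ite_true h hs, hq⟩

/-- The rule for loops whose number of iterations is known in advance. -/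
theorem loop {e : Expr} {N : ℕ} (I : ℕ → Mem → Prop) (h0 : I 0 m)
    (hstep : ∀ i < N, ∀ m, I i m → e.eval m ≠ 0 ∧ Does c m T (I (i + 1)))
    (hend : ∀ m, I N m → e.eval m = 0 ∧ Q m) :
    Does (.loop e c) m (N * (T + 1) + 1) Q := by
  suffices H : ∀ j i, i + j = N → ∀ m, I i m → Does (.loop e c) m (j * (T + 1) + 1) Q from
    H N 0 (by omega) m h0
  intro j
  induction j with
  | zero =>
    intro i hi m hm
    obtain rfl : i = N := by omega
    exact ⟨1, by omega, m, Sem.loop_done (hend m hm).1, (hend m hm).2⟩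
  | succ j ih =>
    intro i hi m hm
    obtain ⟨he, t, ht, m', hs, hq⟩ := hstep i (by omega) m hm
    obtain ⟨t', ht', m'', hs', hq'⟩ := ih (i + 1) (by omega) m' hq
    refine ⟨t' + t + 1, ?_, m'', Sem.loop_pure he hs hs', hq'⟩
    rw [Nat.succ_mul]
    omega

end Does

/-! ### Counting loops -/

/-- `for x_c = 0, ..., b - 1 do body`, where `x_c` is cell `0` of array `c`. -/
def forLoop (c : ℕ) (b : Expr) (body : Prog) : Prog :=
  .seq (.assign c (.lit 0) (.lit 0))
    (.loop (.sub b (.get c (.lit 0)))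
      (.seq body (.assign c (.lit 0) (.add (.get c (.lit 0)) (.lit 1)))))

/-- The bound `b` is evaluated anew in every round, so the invariant has to fix its value. The time
is stated with an upper bound `N'` for the number of rounds, so that all running times become
functions of the input size. -/
theorem Does.forLoop {c : ℕ} {b : Expr} {body : Prog} {m : Mem} {N N' T : ℕ} {Q : Mem → Prop}
    (I : ℕ → Mem → Prop) (hN : N ≤ N') (h0 : I 0 (m.write c 0 0))
    (hI : ∀ i ≤ N, ∀ m, I i m → m c 0 = i ∧ b.eval m = N)
    (hstep : ∀ i < N, ∀ m, I i m →
      Does body m T fun m' => m' c 0 = i ∧ I (i + 1) (m'.write c 0 (i + 1)))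
    (hend : ∀ m, I N m → Q m) :
    Does (_root_.forLoop c b body) m (N' * (T + 3) + 3) Q := by
  unfold _root_.forLoop
  refine Does.mono (T := 1 + (N * ((T + 1 + 1) + 1) + 1) + 1) (Q := Q)
    (Does.seq (Does.assign ?_)) ?_ fun _ h => h
  · refine Does.loop I (by simpa [Expr.eval] using h0) ?_ ?_
    · intro i hi m hm
      obtain ⟨h1, h2⟩ := hI i hi.le m hm
      refine ⟨by simp only [Expr.eval]; omega, Does.seq ((hstep i hi m hm).mono le_rfl ?_)⟩
      rintro m' ⟨h3, h4⟩
      exact Does.assign (by simpa [Expr.eval, h3] using h4)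
    · intro m hm
      obtain ⟨h1, h2⟩ := hI N le_rfl m hm
      exact ⟨by simp only [Expr.eval]; omega, hend m hm⟩
  · have : N * (T + 3) ≤ N' * (T + 3) := Nat.mul_le_mul_right _ hN
    show 1 + (N * (T + 3) + 1) + 1 ≤ _
    omega

/-- The distribution after `N` steps of a time-dependent Markov chain, started at time `i`. -/
noncomputable def chain {σ : Type} (κ : ℕ → σ → PMF σ) : ℕ → ℕ → σ → PMF σ
  | _, 0, x => PMF.pure x
  | i, N + 1, x => (κ i x).bind (chain κ (i + 1) N)

/-- Here `g i x` is the memory at the start of round `i` in state `x`. The loop is thereby replaced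
by the abstract chain `κ`, on which the probabilities are computed later. -/
theorem Sem.forLoop {σ : Type} {c : ℕ} {b : Expr} {body : Prog} {m : Mem} {N t : ℕ}
    (κ : ℕ → σ → PMF σ) (g : ℕ → σ → Mem) (x₀ : σ) (h0 : m.write c 0 0 = g 0 x₀)
    (hg : ∀ i x, g i x c 0 = i ∧ b.eval (g i x) = N)
    (hstep : ∀ i < N, ∀ x, ∃ h : σ → Mem, Sem body (g i x) t ((κ i x).map h) ∧
      ∀ y, h y c 0 = i ∧ (h y).write c 0 (i + 1) = g (i + 1) y) :
    Sem (_root_.forLoop c b body) m (N * (t + 3) + 3) ((chain κ 0 N x₀).map (g N)) := by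
  have H : ∀ j i, i + j = N → ∀ x, Sem (.loop (.sub b (.get c (.lit 0)))
      (.seq body (.assign c (.lit 0) (.add (.get c (.lit 0)) (.lit 1))))) (g i x)
      (j * (t + 3) + 1) ((chain κ i j x).map (g N)) := by
    intro j
    induction j with
    | zero =>
      intro i hi x
      obtain rfl : i = N := by omega
      obtain ⟨h1, h2⟩ := hg i x
      simp only [chain, PMF.pure_map, zero_mul, zero_add]
      exact Sem.loop_done (by simp only [Expr.eval]; omega)
    | succ j ih =>
      intro i hi x
      obtain ⟨h1, h2⟩ := hg i x
      obtain ⟨h, hs, hh⟩ := hstep i (by omega) x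
      have hb : Sem (.seq body (.assign c (.lit 0) (.add (.get c (.lit 0)) (.lit 1)))) (g i x)
          (1 + t + 1) ((κ i x).map (g (i + 1))) := by
        refine Sem.seq_map hs fun y => ?_
        have := Sem.assign c (.lit 0) (.add (.get c (.lit 0)) (.lit 1)) (h y)
        simpa [Expr.eval, (hh y).1, (hh y).2] using this
      have := Sem.loop_map (by simp only [Expr.eval]; omega) hb fun y => ih (i + 1) (by omega) y
      rw [show (j + 1) * (t + 3) + 1 = j * (t + 3) + 1 + (1 + t + 1) + 1 by ring]
      simpa [chain, PMF.map_bind] using this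
  have h1 : Sem (.assign c (.lit 0) (.lit 0)) m 1 (PMF.pure (g 0 x₀)) := by
    have := Sem.assign c (.lit 0) (.lit 0) m
    simpa [Expr.eval, h0] using this
  have := Sem.seq_pure h1 (H N 0 (by omega) x₀)
  exact this

/-! ### Memory -/

theorem Mem.write_ne (m : Mem) {a b : ℕ} (i x : ℕ) (h : b ≠ a) : m.write a i x b = m b := by
  simp [Mem.write, h]

theorem Mem.write_apply (m : Mem) (a i x b j : ℕ) :
    m.write a i x b j = if b = a ∧ j = i then x else m b j := by
  by_cases h : b = a
  · subst h
    by_cases h' : j = i <;> simp [Mem.write, h']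
  · simp [Mem.write, h]

/-- Replace the first `N` cells of array `a`. -/
def Mem.fill (m : Mem) (a N : ℕ) (f : ℕ → ℕ) : Mem :=
  Function.update m a fun i => if i < N then f i else m a i

theorem Mem.fill_apply (m : Mem) (a N : ℕ) (f : ℕ → ℕ) (b j : ℕ) :
    m.fill a N f b j = if b = a ∧ j < N then f j else m b j := by
  by_cases h : b = a
  · subst h
    by_cases h' : j < N <;> simp [Mem.fill, h']
  · simp [Mem.fill, h]

theorem Mem.fill_ne (m : Mem) {a b : ℕ} (N : ℕ) (f : ℕ → ℕ) (h : b ≠ a) : m.fill a N f b = m b := by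
  simp [Mem.fill, h]

/-- `x_s := ∑ x_c < b, e` -/
def sumLoop (s c : ℕ) (b e : Expr) : Prog :=
  .seq (.assign s (.lit 0) (.lit 0))
    (forLoop c b (.assign s (.lit 0) (.add (.get s (.lit 0)) e)))

/-- The conditions on `b` and `e` quantify over the content `x` of the accumulator: neither value
may depend on it. -/
theorem Does.sumLoop {s c : ℕ} {b e : Expr} {m : Mem} {N N' : ℕ} {Q : Mem → Prop} (f : ℕ → ℕ)
    (hsc : s ≠ c) (hN : N ≤ N')
    (hb : ∀ i x, b.eval ((m.write s 0 x).write c 0 i) = N)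
    (he : ∀ i < N, ∀ x, e.eval ((m.write s 0 x).write c 0 i) = f i)
    (hQ : Q ((m.write s 0 (∑ i ∈ Finset.range N, f i)).write c 0 N)) :
    Does (sumLoop s c b e) m (N' * 4 + 5) Q := by
  unfold _root_.sumLoop
  refine Does.mono (T := 1 + (N' * (1 + 3) + 3) + 1) (Q := Q) (Does.seq (Does.assign ?_))
    (by omega) fun _ h => h
  simp only [Expr.eval]
  refine Does.forLoop
    (fun i m' => m' = (m.write s 0 (∑ i ∈ Finset.range i, f i)).write c 0 i) hN ?_ ?_ ?_ ?_
  · simp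
  · rintro i - m' rfl
    exact ⟨by simp [Mem.write_apply], hb _ _⟩
  · rintro i hi m' rfl
    refine Does.assign ⟨?_, ?_⟩
    · simp [Mem.write_apply, Expr.eval, hsc.symm]
    · simp only [Expr.eval, he i hi]
      funext a j
      simp only [Mem.write_apply, Finset.sum_range_succ]
      by_cases h1 : a = c
      · subst h1; by_cases h2 : j = 0 <;> simp [h2, hsc.symm]
      · by_cases h2 : a = s
        · subst h2; by_cases h3 : j = 0 <;> simp [h3, h1]
        · simp [h1, h2]
  · rintro m' rfl
    exact hQ

/-- `for x_c < b do a[x_c] := e` -/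
def fillLoop (a c : ℕ) (b e : Expr) : Prog :=
  forLoop c b (.assign a (.get c (.lit 0)) e)

/-- When `e` is evaluated, only the cells below `i` have been replaced. So `e` may read the old
content of cell `i` of `a` itself; the in-place updates of the carving rely on this. -/
theorem Does.fillLoop {a c : ℕ} {b e : Expr} {m : Mem} {N N' : ℕ} {Q : Mem → Prop} (f : ℕ → ℕ)
    (hac : a ≠ c) (hN : N ≤ N')
    (hb : ∀ i, b.eval ((m.fill a i f).write c 0 i) = N)
    (he : ∀ i < N, e.eval ((m.fill a i f).write c 0 i) = f i)
    (hQ : Q ((m.fill a N f).write c 0 N)) :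
    Does (fillLoop a c b e) m (N' * 4 + 3) Q := by
  unfold _root_.fillLoop
  refine Does.forLoop (fun i m' => m' = (m.fill a i f).write c 0 i) hN ?_ ?_ ?_ ?_
  · funext x y
    simp [Mem.write_apply, Mem.fill_apply]
  · rintro i - m' rfl
    exact ⟨by simp [Mem.write_apply], hb _⟩
  · rintro i hi m' rfl
    refine Does.assign ⟨?_, ?_⟩
    · simp [Mem.write_apply, hac.symm]
    · simp only [Expr.eval, he i hi]
      funext x y
      simp only [Mem.write_apply, Mem.fill_apply]
      by_cases h1 : x = c
      · subst h1; by_cases h2 : y = 0 <;> simp [h2, hac.symm]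
      · by_cases h2 : x = a
        · subst h2
          rcases lt_trichotomy y i with h3 | h3 | h3
          · simp [h1, h3, h3.ne, Nat.lt_succ_of_lt h3]
          · simp [h1, h3]
          · simp [h1, h3.not_gt, h3.ne', Nat.not_lt.2 (Nat.succ_le_of_lt h3)]
        · simp [h1, h2]
  · rintro m' rfl
    exact hQ

/-! ### Breadth-first search -/

open Classical in
/-- The vertices that can be reached from `v` by at most `i` steps within `S`. -/
noncomputable def reach {V : Type} (G : SimpleGraph V) (S : Finset V) (v : V) : ℕ → Finset V
  | 0 => {v}
  | i + 1 => reach G S v i ∪ S.filter fun w => ∃ u ∈ reach G S v i, G.Adj u w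

section Reach

variable {V : Type} {G : SimpleGraph V} {S S' : Finset V} {u v w : V} {i j : ℕ}

theorem mem_reach_succ :
    w ∈ reach G S v (i + 1) ↔ w ∈ reach G S v i ∨ w ∈ S ∧ ∃ u ∈ reach G S v i, G.Adj u w := by
  simp [reach]

theorem self_mem_reach : v ∈ reach G S v i := by
  induction i with
  | zero => simp [reach]
  | succ i ih => exact mem_reach_succ.2 (Or.inl ih)

theorem reach_mono (h : i ≤ j) : reach G S v i ⊆ reach G S v j := by
  induction h with
  | refl => exact subset_rfl
  | step _ ih => exact ih.trans fun w hw => mem_reach_succ.2 (Or.inl hw)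

theorem reach_subset_of_subset (h : S ⊆ S') : reach G S v i ⊆ reach G S' v i := by
  induction i with
  | zero => exact subset_rfl
  | succ i ih =>
    intro w hw
    rw [mem_reach_succ] at hw ⊢
    exact hw.imp (fun h' => ih h') fun ⟨h1, u, h2, h3⟩ => ⟨h h1, u, ih h2, h3⟩

theorem reach_subset (hv : v ∈ S) : reach G S v i ⊆ S := by
  induction i with
  | zero => simpa [reach] using hv
  | succ i ih =>
    intro w hw
    rw [mem_reach_succ] at hw
    exact hw.elim (fun h => ih h) fun h => h.1

theorem reach_stable (h : reach G S v (i + 1) = reach G S v i) (hij : i ≤ j) :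
    reach G S v j = reach G S v i := by
  induction hij with
  | refl => rfl
  | step _ ih =>
    ext w
    rw [← h, mem_reach_succ, mem_reach_succ, ih]

/-- The sets start with one vertex, and once a round adds nothing they are constant. If they were
still growing at round `card V`, they would have gained a vertex in each earlier round and
outnumbered the vertices. -/
theorem reach_card [Fintype V] (h : Fintype.card V ≤ i) :
    reach G S v i = reach G S v (Fintype.card V) := by
  by_contra hne
  have key : ∀ j ≤ Fintype.card V, reach G S v (j + 1) ≠ reach G S v j := fun j hj he =>
    hne ((reach_stable he (hj.trans h)).trans (reach_stable he hj).symm)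
  have hc : ∀ j ≤ Fintype.card V, j + 1 ≤ (reach G S v j).card := by
    intro j
    induction j with
    | zero => intro _; simp [reach]
    | succ j ih =>
      intro hj
      have := Finset.card_lt_card ((reach_mono (j := j + 1) (by omega)).ssubset_of_ne
        (key j (by omega)).symm)
      have := ih (by omega)
      omega
  have := hc _ le_rfl
  have := Finset.card_le_univ (reach G S v (Fintype.card V))
  omega

open Classical in
/-- The labels after `i` rounds of breadth-first search: `0` for a vertex that has not been reached,
and one more than the distance for the others. -/
noncomputable def bfsLabel (G : SimpleGraph V) (S : Finset V) (v : V) : ℕ → V → ℕ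
  | 0, u => if u = v then 1 else 0
  | i + 1, w =>
    if bfsLabel G S v i w = 0 ∧ w ∈ S ∧ ∃ u, bfsLabel G S v i u = i + 1 ∧ G.Adj u w then i + 2
    else bfsLabel G S v i w

/-- A label never changes once it is nonzero, so the labels after `i` rounds describe the balls of
all radii `j ≤ i` at once. The induction needs all these radii: it must be known that neighbours of
older vertices were reached before. -/
theorem bfsLabel_spec (i : ℕ) : (∀ u, bfsLabel G S v i u ≤ i + 1) ∧ ∀ j ≤ i, ∀ u,
    (u ∈ reach G S v j ↔ 0 < bfsLabel G S v i u ∧ bfsLabel G S v i u ≤ j + 1) := by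
  induction i with
  | zero =>
    refine ⟨fun u => by simp only [bfsLabel]; split_ifs <;> omega, fun j hj u => ?_⟩
    obtain rfl : j = 0 := by omega
    simp only [reach, Finset.mem_singleton, bfsLabel]
    split_ifs with h <;> simp [h]
  | succ i ih =>
    obtain ⟨ih1, ih2⟩ := ih
    refine ⟨fun u => ?_, fun j hj u => ?_⟩
    · have := ih1 u
      simp only [bfsLabel]
      split_ifs <;> omega
    · have h0 := ih2 i le_rfl u
      have h1 := ih1 u
      have key : (bfsLabel G S v i u = 0 ∧ u ∈ S ∧ ∃ u', bfsLabel G S v i u' = i + 1 ∧ G.Adj u' u) ↔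
          u ∈ reach G S v (i + 1) ∧ u ∉ reach G S v i := by
        rw [mem_reach_succ, h0]
        constructor
        · rintro ⟨h2, h3, u', h4, h5⟩
          exact ⟨Or.inr ⟨h3, u', (ih2 i le_rfl u').2 (by omega), h5⟩, by omega⟩
        · rintro ⟨h2 | ⟨h3, u', h4, h5⟩, h6⟩
          · exact absurd h2 h6
          · refine ⟨by omega, h3, u', ?_, h5⟩
            have h7 := (ih2 i le_rfl u').1 h4
            -- If `u'` had been reached before round `i`, its neighbour `u` would have been reached
            -- by round `i`. So it suffices to scan the newest label.
            by_contra h8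
            rcases Nat.eq_zero_or_pos i with rfl | hi
            · omega
            · have h9 := (ih2 (i - 1) (by omega) u').2 (by omega)
              refine h6 (h0.1 ?_)
              have : u ∈ reach G S v (i - 1 + 1) := mem_reach_succ.2 (Or.inr ⟨h3, u', h9, h5⟩)
              rwa [Nat.sub_add_cancel hi] at this
      rcases Nat.lt_or_ge j (i + 1) with hj' | hj'
      · rw [ih2 j (by omega) u]
        simp only [bfsLabel]
        split_ifs with h
        · have := h.1
          omega
        · rfl
      · obtain rfl : j = i + 1 := by omega
        simp only [bfsLabel]
        split_ifs with h
        · simpa using (key.1 h).1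
        · rw [key] at h
          constructor
          · intro h2
            have : u ∈ reach G S v i := by
              by_contra h3
              exact h ⟨h2, h3⟩
            have := h0.1 this
            omega
          · intro h2
            exact reach_mono (Nat.le_succ i) (h0.2 ⟨h2.1, h1⟩)

/-- The balls are stationary from radius `card V` on, so one run of the search serves all radii,
including those larger than the number of vertices. -/
theorem mem_reach_iff_bfsLabel [Fintype V] (i : ℕ) (u : V) :
    u ∈ reach G S v i ↔ 0 < bfsLabel G S v (Fintype.card V) u ∧
      bfsLabel G S v (Fintype.card V) u ≤ i + 1 := by
  obtain ⟨h1, h2⟩ := bfsLabel_spec (G := G) (S := S) (v := v) (Fintype.card V)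
  rcases Nat.le_total i (Fintype.card V) with h | h
  · exact h2 i h u
  · rw [reach_card h, h2 _ le_rfl u]
    have := h1 u
    omega

end Reach

/-! ### Breadth-first search as a program -/

/-- The memory contains the input graph. -/
def HasGraph {n : ℕ} (G : SimpleGraph (Fin n)) (m : Mem) : Prop :=
  m 0 0 = n ∧ ∀ u v : Fin n, (G.Adj u v → m 2 (u * n + v) = 1) ∧ (¬G.Adj u v → m 2 (u * n + v) = 0)

/-- Array `a` is the characteristic function of `S`. -/
def HoldsSet {n : ℕ} (a : ℕ) (S : Finset (Fin n)) (m : Mem) : Prop :=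
  ∀ u : Fin n, (u ∈ S → m a u = 1) ∧ (u ∉ S → m a u = 0)

/-- The memories agree outside of the scratch arrays of breadth-first search. -/
def AgreeBFS (m m' : Mem) : Prop := ∀ a, a < 20 ∨ 30 ≤ a → m' a = m a

theorem AgreeBFS.write {m m' : Mem} (h : AgreeBFS m m') {a : ℕ} (i x : ℕ) (h1 : 20 ≤ a)
    (h2 : a < 30) : AgreeBFS m (m'.write a i x) := fun b hb => by
  rw [Mem.write_ne _ _ _ (by omega), h b hb]

theorem AgreeBFS.fill {m m' : Mem} (h : AgreeBFS m m') {a : ℕ} (N : ℕ) (f : ℕ → ℕ) (h1 : 20 ≤ a)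
    (h2 : a < 30) : AgreeBFS m (m'.fill a N f) := fun b hb => by
  rw [Mem.fill_ne _ _ _ (by omega), h b hb]

/-- Cell `0` of array `a`, used as a variable. -/
abbrev Expr.var (a : ℕ) : Expr := .get a (.lit 0)

/-- An expression that vanishes iff the two values are equal. -/
abbrev Expr.diff (e f : Expr) : Expr := .add (.sub e f) (.sub f e)

/-- `1` if the value of `e` is `0`, and `0` otherwise. -/
abbrev Expr.isZero (e : Expr) : Expr := .sub (.lit 1) e

/-- Breadth-first search from the vertex in variable `sv` in the graph induced by the set in
array `al`; the labels are written to array `20`. -/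
def bfs (al sv : ℕ) : Prog :=
  .seq (fillLoop 20 21 (.var 0) (.lit 0))
  (.seq (.assign 20 (.var sv) (.lit 1))
  (forLoop 23 (.var 0)
    (.seq (.assign 24 (.lit 0) (.lit 0))
    (forLoop 21 (.var 0)
      (.seq (sumLoop 26 22 (.var 0)
        (.isZero (.add (.diff (.get 20 (.var 22)) (.add (.var 23) (.lit 1)))
          (.isZero (.get 2 (.add (.var 24) (.var 22)))))))
      (.seq (.ite (.isZero (.add (.isZero (.var 26))
            (.add (.isZero (.get al (.var 21))) (.get 20 (.var 21)))))
          (.assign 20 (.var 21) (.add (.var 23) (.lit 2))) .skip)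
      (.assign 24 (.lit 0) (.add (.var 24) (.var 0)))))))))

/-- A bound for the running time of breadth-first search. -/
def bfsTime (W : ℕ) : ℕ := W * (W * (W * 4 + 13) + 8) + W * 4 + 9

theorem Does.bfs {n : ℕ} {G : SimpleGraph (Fin n)} {S : Finset (Fin n)} {al sv : ℕ} {m : Mem}
    {W : ℕ} {Q : Mem → Prop} (v : Fin n) (hG : HasGraph G m) (hS : HoldsSet al S m)
    (hal : al < 20) (hsv : 30 ≤ sv) (hv : m sv 0 = v) (hW : n ≤ W)
    (hQ : ∀ m', AgreeBFS m m' → (∀ u : Fin n, m' 20 u = bfsLabel G S v n u) → Q m') :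
    Does (bfs al sv) m (bfsTime W) Q := by
  have h0 : ∀ m', AgreeBFS m m' → m' 0 0 = n := fun m' h => by rw [h 0 (by omega)]; exact hG.1
  unfold _root_.bfs
  refine Does.mono (T := (W * 4 + 3) + (1 + (W * ((1 + (W * (((W * 4 + 5) +
    ((1 + 1) + 1 + 1) + 1) + 3) + 3) + 1) + 3) + 3) + 1) + 1)
    (Q := Q) (Does.seq ?_) (by unfold bfsTime; apply le_of_eq; ring) fun _ h => h
  refine Does.fillLoop (N := n) (fun _ => 0) (by norm_num) hW ?_ ?_ ?_
  · intro i
    simpa [Expr.eval, Mem.write_apply, Mem.fill_apply] using hG.1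
  · intro i _; simp [Expr.eval]
  have ha1 : AgreeBFS m ((m.fill 20 n fun _ => 0).write 21 0 n) :=
    AgreeBFS.write (AgreeBFS.fill (fun _ _ => rfl) _ _ (by omega) (by omega)) _ _
      (by omega) (by omega)
  refine Does.seq (Does.assign ?_)
  have hsv1 : Expr.eval ((m.fill 20 n fun _ => 0).write 21 0 n) (.var sv) = v := by
    simp only [Expr.eval, ha1 sv (by omega), hv]
  rw [hsv1]
  set m1 := ((m.fill 20 n fun _ => 0).write 21 0 n).write 20 v
    (Expr.eval ((m.fill 20 n fun _ => 0).write 21 0 n) (.lit 1)) with hm1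
  have ha2 : AgreeBFS m m1 := ha1.write _ _ (by omega) (by omega)
  refine Does.forLoop (N := n) (fun i m' => AgreeBFS m m' ∧ m' 23 0 = i ∧
    ∀ u : Fin n, m' 20 u = bfsLabel G S v i u) hW ?_ ?_ ?_ ?_
  · refine ⟨ha2.write _ _ (by omega) (by omega), by simp [Mem.write_apply], fun u => ?_⟩
    simp only [hm1, Mem.write_apply, Mem.fill_apply, bfsLabel, Expr.eval]
    by_cases h : u = v
    · simp [h]
    · have : (u : ℕ) ≠ v := fun h' => h (Fin.ext h')
      simp [h, this]
  · rintro i - m' ⟨h1, h2, -⟩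
    exact ⟨h2, h0 _ h1⟩
  · rintro i hi m' ⟨h1, h2, h3⟩
    refine Does.seq (Does.assign ?_)
    -- Variable `24` holds the offset `j * n` of row `j` of the adjacency matrix, accumulated by
    -- additions since there is no multiplication. The labels are overwritten in place: those of
    -- vertices below `j` are already the new ones.
    refine Does.forLoop (N := n) (fun j m' => AgreeBFS m m' ∧ m' 23 0 = i ∧ m' 21 0 = j ∧
      m' 24 0 = j * n ∧ ∀ u : Fin n, m' 20 u =
        if (u : ℕ) < j then bfsLabel G S v (i + 1) u else bfsLabel G S v i u) hW ?_ ?_ ?_ ?_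
    · refine ⟨(h1.write _ _ (by omega) (by omega)).write _ _ (by omega) (by omega), ?_, ?_, ?_, ?_⟩
      · simpa [Mem.write_apply] using h2
      · simp [Mem.write_apply]
      · simp [Mem.write_apply, Expr.eval]
      · simpa [Mem.write_apply] using h3
    · rintro j - m'' ⟨h4, -, h5, -⟩
      exact ⟨h5, h0 _ h4⟩
    · rintro j hj m2 ⟨h4, h5, h6, h7, h8⟩
      classical
      refine Does.seq (T := W * 4 + 5) (T' := 1 + 1 + 1 + 1)
        (Does.sumLoop (s := 26) (c := 22) (N := n) (fun u => if ∃ hu : u < n,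
        bfsLabel G S v i ⟨u, hu⟩ = i + 1 ∧ G.Adj ⟨u, hu⟩ ⟨j, hj⟩ then 1 else 0) (by norm_num) hW
        ?_ ?_ ?_)
      · intro a b
        have := h0 m2 h4
        simpa [Expr.eval, Mem.write_apply] using this
      · intro u hu x
        have h9 := h8 ⟨u, hu⟩
        have h10 := hG.2 ⟨j, hj⟩ ⟨u, hu⟩
        rw [← h4 2 (by omega)] at h10
        have hle := (bfsLabel_spec (G := G) (S := S) (v := v) i).1 ⟨u, hu⟩
        -- Mixing old and new labels is harmless: a label that changes in this round changes from
        -- `0` to `i + 2`, so the comparison with `i + 1` gives the same answer.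
        have h11 : m2 20 u = i + 1 ↔ bfsLabel G S v i ⟨u, hu⟩ = i + 1 := by
          simp only at h9
          rw [h9]
          split_ifs with h
          · simp only [bfsLabel]
            split_ifs with h'
            · have := h'.1
              omega
            · rfl
          · rfl
        rw [G.adj_comm] at h10
        simp only at h10
        simp only [hu, exists_true_left, Expr.eval, Mem.write_apply, h5, h7]
        norm_num
        split_ifs with h
        · rw [h10.1 h.2, h11.2 h.1]
          simp
        · by_cases hadj : G.Adj ⟨u, hu⟩ ⟨j, hj⟩
          · have : m2 20 u ≠ i + 1 := fun h' => h ⟨h11.1 h', hadj⟩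
            omega
          · rw [h10.2 hadj]
            omega
      · set F := ∑ x ∈ Finset.range n, (if ∃ hu : x < n,
          bfsLabel G S v i ⟨x, hu⟩ = i + 1 ∧ G.Adj ⟨x, hu⟩ ⟨j, hj⟩ then 1 else 0) with hF
        have hF0 : F ≠ 0 ↔ ∃ u, bfsLabel G S v i u = i + 1 ∧ G.Adj u ⟨j, hj⟩ := by
          rw [hF, ne_eq, Finset.sum_eq_zero_iff]
          push Not
          constructor
          · rintro ⟨u, -, h⟩
            simp only [ne_eq, ite_eq_right_iff, one_ne_zero, imp_false, not_not] at h
            obtain ⟨hu, h⟩ := h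
            exact ⟨⟨u, hu⟩, h⟩
          · rintro ⟨u, h⟩
            exact ⟨u, Finset.mem_range.2 u.2, by simp [h]⟩
        have h9 := hS ⟨j, hj⟩
        have h10 := h8 ⟨j, hj⟩
        simp only [lt_irrefl, if_false] at h10
        rw [← h4 al (by omega)] at h9
        have hne : al ≠ 26 ∧ al ≠ 22 ∧ al ≠ 20 ∧ al ≠ 24 := by omega
        have hcond : Expr.eval ((m2.write 26 0 F).write 22 0 n)
            (.isZero (.add (.isZero (.var 26))
            (.add (.isZero (.get al (.var 21))) (.get 20 (.var 21))))) =
            1 - ((1 - F) + ((1 - m2 al j) + m2 20 j)) := by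
          simp [Expr.eval, Mem.write_apply, hne, h6]
        have hb : bfsLabel G S v (i + 1) ⟨j, hj⟩ = if F ≠ 0 ∧ m2 al j = 1 ∧ m2 20 j = 0 then i + 2
            else m2 20 j := by
          simp only [bfsLabel, hF0, ← h10]
          refine if_congr ?_ rfl rfl
          have : m2 al j = 1 ↔ ⟨j, hj⟩ ∈ S := by
            constructor
            · intro h; by_contra h'; rw [h9.2 h'] at h; omega
            · exact h9.1
          rw [this]
          tauto
        have hfin : ∀ m3 : Mem, AgreeBFS m m3 → m3 23 0 = i → m3 21 0 = j → m3 24 0 = j * n →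
            (∀ u : ℕ, m3 20 u = if u = j then bfsLabel G S v (i + 1) ⟨j, hj⟩ else m2 20 u) →
            Does (.assign 24 (.lit 0) (.add (.var 24) (.var 0))) m3 1 fun m' => m' 21 0 = j ∧
              (AgreeBFS m (m'.write 21 0 (j + 1)) ∧ (m'.write 21 0 (j + 1)) 23 0 = i ∧
              (m'.write 21 0 (j + 1)) 21 0 = j + 1 ∧ (m'.write 21 0 (j + 1)) 24 0 = (j + 1) * n ∧
              ∀ u : Fin n, (m'.write 21 0 (j + 1)) 20 u =
              if (u : ℕ) < j + 1 then bfsLabel G S v (i + 1) u else bfsLabel G S v i u) := by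
          intro m3 k1 k2 k3 k4 k5
          refine Does.assign ⟨?_, ?_, ?_, ?_, ?_, ?_⟩
          · simpa [Mem.write_apply] using k3
          · exact (k1.write _ _ (by omega) (by omega)).write _ _ (by omega) (by omega)
          · simpa [Mem.write_apply] using k2
          · simp [Mem.write_apply]
          · simp [Mem.write_apply, Expr.eval, k4, h0 m3 k1, Nat.succ_mul]
          · intro u
            simp only [Mem.write_apply]
            norm_num
            rw [k5, h8]
            rcases lt_trichotomy (u : ℕ) j with h | h | h
            · simp [h, h.ne, h.le]
            · have : u = ⟨j, hj⟩ := Fin.ext h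
              simp [this]
            · simp [h.ne', h.not_gt, Nat.not_le.2 h]
        refine Does.seq (T := 1 + 1) (T' := 1) (Does.ite (T := 1) ?_ ?_)
        · intro hc
          rw [hcond] at hc
          refine Does.assign ?_
          refine hfin _ ?_ ?_ ?_ ?_ ?_
          · exact ((h4.write _ _ (by omega) (by omega)).write _ _ (by omega) (by omega)).write _ _
              (by omega) (by omega)
          · simpa [Mem.write_apply] using h5
          · simpa [Mem.write_apply] using h6
          · simpa [Mem.write_apply] using h7
          · intro u
            have : F ≠ 0 ∧ m2 al j = 1 ∧ m2 20 j = 0 := by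
              refine ⟨by omega, ?_, by omega⟩
              by_cases hjS : (⟨j, hj⟩ : Fin n) ∈ S
              · exact h9.1 hjS
              · have := h9.2 hjS
                simp only at this
                omega
            rw [hb, if_pos this]
            simp [Mem.write_apply, Expr.eval, h6, h5]
        · intro hc
          rw [hcond] at hc
          refine Does.skip ?_
          refine hfin _ ?_ ?_ ?_ ?_ ?_
          · exact (h4.write _ _ (by omega) (by omega)).write _ _ (by omega) (by omega)
          · simpa [Mem.write_apply] using h5
          · simpa [Mem.write_apply] using h6
          · simpa [Mem.write_apply] using h7
          · intro u
            have : ¬(F ≠ 0 ∧ m2 al j = 1 ∧ m2 20 j = 0) := by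
              rintro ⟨k1, k2, k3⟩
              omega
            rw [hb, if_neg this]
            simp only [Mem.write_apply]
            norm_num
            rintro rfl
            rfl
    · rintro m2 ⟨h4, h5, h6, h7, h8⟩
      refine ⟨h5, h4.write _ _ (by omega) (by omega), by simp [Mem.write_apply], fun u => ?_⟩
      have := h8 u
      simpa [Mem.write_apply] using this
  · rintro m2 ⟨h1, -, h2⟩
    exact hQ m2 h1 h2

/-! ### The preparatory phase of the algorithm -/

/-- The `c`-fold of an expression. -/
def Expr.mulLit : ℕ → Expr → Expr
  | 0, _ => .lit 0
  | c + 1, e => .add (mulLit c e) e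

theorem Expr.eval_mulLit (m : Mem) (c : ℕ) (e : Expr) : (mulLit c e).eval m = c * e.eval m := by
  induction c with
  | zero => simp [mulLit, Expr.eval]
  | succ c ih => simp [mulLit, Expr.eval, ih, Nat.succ_mul]

/-- Compute the number of binary digits of `k` (variable `4`). -/
def sizeProg : Prog :=
  .seq (.assign 31 (.lit 0) (.lit 1))
    (.loop (.sub (.add (.var 1) (.lit 1)) (.var 31))
      (.seq (.assign 31 (.lit 0) (.add (.var 31) (.var 31)))
        (.assign 4 (.lit 0) (.add (.var 4) (.lit 1)))))

/-- The loop continues while `2 ^ i ≤ k`, that is, exactly for `i < Nat.size k`. -/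
theorem Does.sizeProg {m : Mem} {k W : ℕ} {Q : Mem → Prop} (hk : m 1 0 = k) (h4 : m 4 0 = 0)
    (hW : Nat.size k ≤ W)
    (hQ : ∀ m', m' 4 0 = Nat.size k → (∀ a, a ≠ 4 → a ≠ 31 → m' a = m a) → Q m') :
    Does sizeProg m (W * 4 + 3) Q := by
  unfold _root_.sizeProg
  refine Does.mono (T := 1 + (Nat.size k * ((1 + 1 + 1) + 1) + 1) + 1) (Q := Q)
    (Does.seq (Does.assign ?_)) (by omega) fun _ h => h
  refine Does.loop (fun i m' => m' 31 0 = 2 ^ i ∧ m' 4 0 = i ∧ ∀ a, a ≠ 4 → a ≠ 31 → m' a = m a)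
    ?_ ?_ ?_
  · refine ⟨by simp [Mem.write_apply, Expr.eval], by simpa [Mem.write_apply] using h4, ?_⟩
    intro a _ ha
    exact Mem.write_ne _ _ _ ha
  · rintro i hi m' ⟨h1, h2, h3⟩
    have := Nat.lt_size.1 hi
    refine ⟨?_, Does.seq (T := 1) (T' := 1) (Does.assign (Does.assign ⟨?_, ?_, ?_⟩))⟩
    · simp only [Expr.eval, h3 1 (by omega) (by omega), hk, h1]
      omega
    · simp [Mem.write_apply, Expr.eval, h1, pow_succ, mul_two]
    · simp [Mem.write_apply, Expr.eval, h2]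
    · intro a ha ha'
      rw [Mem.write_ne _ _ _ ha, Mem.write_ne _ _ _ ha', h3 a ha ha']
  · rintro m' ⟨h1, h2, h3⟩
    have : k < 2 ^ Nat.size k := Nat.lt_size_self k
    refine ⟨?_, hQ m' h2 h3⟩
    simp only [Expr.eval, h3 1 (by omega) (by omega), hk, h1]
    omega

/-- The growth condition that is tested in round `q`. -/
def GrowthTest {n : ℕ} (G : SimpleGraph (Fin n)) (K C k q : ℕ) : Prop :=
  ∀ v : Fin n, (q + 1) * (reach G Finset.univ v (K * (q + 1))).card ≤ C * k

/-- `d` is the first round, among `0, ..., n`, whose test fails (or `n`). -/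
structure GrowthParam {n : ℕ} (G : SimpleGraph (Fin n)) (K C k d : ℕ) : Prop where
  le : d ≤ n
  pass : ∀ q < d, GrowthTest G K C k q
  fail : d < n → ¬GrowthTest G K C k d

/-- Compute the growth parameter (variable `5`). -/
def growthProg (K C : ℕ) : Prog :=
  .seq (.assign 32 (.lit 0) (.lit 1))
  (forLoop 33 (.var 0)
    (.seq (forLoop 30 (.var 0)
      (.seq (bfs 10 30)
      (.seq (sumLoop 34 35 (.var 0) (.isZero (.add (.isZero (.get 20 (.var 35)))
        (.sub (.get 20 (.var 35)) (.add (.mulLit K (.add (.var 33) (.lit 1))) (.lit 1))))))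
      (.seq (sumLoop 36 35 (.add (.var 33) (.lit 1)) (.var 34))
      (.ite (.sub (.var 36) (.mulLit C (.var 1))) (.assign 32 (.lit 0) (.lit 0)) .skip)))))
    (.assign 5 (.lit 0) (.add (.var 5) (.var 32)))))

/-- A bound for the running time of `growthProg`. -/
def growthTime (W : ℕ) : ℕ := W * (W * (bfsTime W + W * 8 + 18) + 8) + 5

/-- With truncated subtraction the summand is the indicator of a label between `1` and `i + 1`. -/
theorem card_reach_eq_sum {n : ℕ} {G : SimpleGraph (Fin n)} {S : Finset (Fin n)} {v : Fin n}
    {i : ℕ} {f : ℕ → ℕ} (hf : ∀ u : Fin n, f u = 1 - ((1 - bfsLabel G S v n u) +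
      (bfsLabel G S v n u - (i + 1)))) :
    ∑ u ∈ Finset.range n, f u = (reach G S v i).card := by
  classical
  rw [Finset.sum_range, Finset.card_eq_sum_ones, ← Finset.sum_filter_add_sum_filter_not
    Finset.univ (· ∈ reach G S v i)]
  rw [Finset.sum_eq_zero (s := Finset.univ.filter (· ∉ reach G S v i)), add_zero,
    Finset.filter_mem_eq_inter, Finset.univ_inter]
  · refine Finset.sum_congr rfl fun u hu => ?_
    rw [mem_reach_iff_bfsLabel, Fintype.card_fin] at hu
    rw [hf u]
    omega
  · intro u hu
    rw [Finset.mem_filter, mem_reach_iff_bfsLabel, Fintype.card_fin] at hu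
    rw [hf u]
    omega

theorem Does.growthProg {n : ℕ} {G : SimpleGraph (Fin n)} {K C k W : ℕ} {m : Mem}
    {Q : Mem → Prop} (hG : HasGraph G m) (hk : m 1 0 = k) (h5 : m 5 0 = 0)
    (hal : HoldsSet 10 (Finset.univ : Finset (Fin n)) m) (hW : n ≤ W)
    (hQ : ∀ m', GrowthParam G K C k (m' 5 0) →
      (∀ a, a < 20 ∨ 40 ≤ a → a ≠ 5 → m' a = m a) → Q m') :
    Does (growthProg K C) m (growthTime W) Q := by
  unfold _root_.growthProg
  refine Does.mono (T := 1 + (W * (((W * (((bfsTime W) + ((W * 4 + 5) + ((W * 4 + 5) + (1 + 1) + 1)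
    + 1) + 1) + 3) + 3) + 1 + 1) + 3) + 3) + 1) (Q := Q)
    (Does.seq (Does.assign ?_)) (by unfold growthTime; apply le_of_eq; ring) fun _ h => h
  -- Variable `32` is `1` as long as all tests have passed, and it is added to variable `5` after
  -- every round; hence variable `5` stops at the first failing round.
  refine Does.forLoop (N := n) (fun q m' => (∀ a, a < 20 ∨ 40 ≤ a → a ≠ 5 → m' a = m a) ∧
    m' 33 0 = q ∧ ((m' 32 0 = 1 ∧ m' 5 0 = q ∧ ∀ q' < q, GrowthTest G K C k q') ∨
      (m' 32 0 = 0 ∧ m' 5 0 < q ∧ (∀ q' < m' 5 0, GrowthTest G K C k q') ∧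
        ¬GrowthTest G K C k (m' 5 0)))) hW ?_ ?_ ?_ ?_
  · refine ⟨fun a ha _ => ?_, ?_, ?_⟩
    · rw [Mem.write_ne _ _ _ (by omega), Mem.write_ne _ _ _ (by omega)]
    · simp [Mem.write_apply]
    · left
      simp [Mem.write_apply, Expr.eval, h5]
  · rintro q - m' ⟨h1, h2, -⟩
    refine ⟨h2, ?_⟩
    simp only [Expr.eval, h1 0 (by omega) (by omega)]
    exact hG.1
  · rintro q hq m1 ⟨h1, h2, h3⟩
    refine Does.seq (T' := 1) ?_
    refine Does.forLoop (N := n) (fun v m' => (∀ a, a < 20 ∨ 40 ≤ a → m' a = m1 a) ∧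
      m' 33 0 = q ∧ m' 30 0 = v ∧ ((m' 32 0 = m1 32 0 ∧ ∀ u : Fin n, (u : ℕ) < v →
        (q + 1) * (reach G Finset.univ u (K * (q + 1))).card ≤ C * k) ∨
        (m' 32 0 = 0 ∧ ¬GrowthTest G K C k q))) hW ?_ ?_ ?_ ?_
    · refine ⟨fun a ha => Mem.write_ne _ _ _ (by omega), ?_, ?_, ?_⟩
      · simpa [Mem.write_apply] using h2
      · simp [Mem.write_apply]
      · left
        simp [Mem.write_apply]
    · rintro v - m' ⟨h4, -, h5, -⟩
      refine ⟨h5, ?_⟩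
      simp only [Expr.eval, h4 0 (by omega), h1 0 (by omega) (by omega)]
      exact hG.1
    · rintro v hv m2 ⟨k1, k2, k3, k4⟩
      have hm2 : ∀ a, a < 20 ∨ 40 ≤ a → a ≠ 5 → m2 a = m a := fun a h h' => by
        rw [k1 a h, h1 a h h']
      have hG2 : HasGraph G m2 := by
        unfold HasGraph
        rw [hm2 0 (by omega) (by omega), hm2 2 (by omega) (by omega)]
        exact hG
      have hal2 : HoldsSet 10 (Finset.univ : Finset (Fin n)) m2 := by
        unfold HoldsSet
        rw [hm2 10 (by omega) (by omega)]
        exact hal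
      refine Does.seq (Does.bfs ⟨v, hv⟩ hG2 hal2 (by omega) (by omega) k3 hW ?_)
      intro m3 l1 l2
      refine Does.seq (T := W * 4 + 5) (T' := (W * 4 + 5) + (1 + 1) + 1)
        (Does.sumLoop (s := 34) (c := 35) (N := n) (fun u => 1 - ((1 - m3 20 u) +
        (m3 20 u - (K * (q + 1) + 1)))) (by norm_num) hW ?_ ?_ ?_)
      · intro a b
        have : m3 0 0 = n := by rw [l1 0 (by omega)]; exact hG2.1
        simpa [Expr.eval, Mem.write_apply] using this
      · intro u hu x
        have : m3 33 0 = q := by rw [l1 33 (by omega)]; exact k2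
        simp [Expr.eval, Expr.eval_mulLit, Mem.write_apply, this]
      rw [card_reach_eq_sum (G := G) (S := Finset.univ) (v := ⟨v, hv⟩) (i := K * (q + 1))
        fun u => by rw [l2]]
      set R := (reach G Finset.univ ⟨v, hv⟩ (K * (q + 1))).card with hR
      -- The product `(q + 1) * R` is formed by repeated addition, in at most `n ≤ W` rounds.
      refine Does.seq (T := W * 4 + 5) (T' := 1 + 1)
        (Does.sumLoop (s := 36) (c := 35) (N := q + 1) (fun _ => R) (by norm_num)
          (by omega) ?_ ?_ ?_)
      · intro a b
        have : m3 33 0 = q := by rw [l1 33 (by omega)]; exact k2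
        simpa [Expr.eval, Mem.write_apply] using this
      · intro u hu x
        simp [Expr.eval, Mem.write_apply]
      rw [Finset.sum_const, Finset.card_range, smul_eq_mul]
      set m4 := (((m3.write 34 0 R).write 35 0 n).write 36 0 ((q + 1) * R)).write 35 0 (q + 1)
        with hm4
      have e1 : ∀ a, a < 20 ∨ 40 ≤ a → m4 a = m1 a := by
        intro a ha
        rw [hm4, Mem.write_ne _ _ _ (by omega), Mem.write_ne _ _ _ (by omega),
          Mem.write_ne _ _ _ (by omega), Mem.write_ne _ _ _ (by omega), l1 a (by omega), k1 a ha]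
      have e2 : m4 33 0 = q := by
        simpa [hm4, Mem.write_apply, l1 33 (by omega)] using k2
      have e3 : m4 30 0 = v := by
        simpa [hm4, Mem.write_apply, l1 30 (by omega)] using k3
      have e4 : m4 32 0 = m2 32 0 := by
        simp [hm4, Mem.write_apply, l1 32 (by omega)]
      have e5 : Expr.eval m4 (.sub (.var 36) (.mulLit C (.var 1))) = (q + 1) * R - C * k := by
        have : m4 1 0 = k := by
          rw [e1 1 (by omega), h1 1 (by omega) (by omega)]
          exact hk
        simp only [Expr.eval, Expr.eval_mulLit, this]
        simp [hm4, Mem.write_apply]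
      refine Does.ite (T := 1) ?_ ?_
      · intro hc
        rw [e5] at hc
        refine Does.assign ⟨?_, ?_, ?_, ?_, ?_⟩
        · simpa [Mem.write_apply] using e3
        · intro a ha
          rw [Mem.write_ne _ _ _ (by omega), Mem.write_ne _ _ _ (by omega), e1 a ha]
        · simpa [Mem.write_apply] using e2
        · simp [Mem.write_apply]
        · right
          refine ⟨by simp [Mem.write_apply, Expr.eval], fun h => ?_⟩
          have := h ⟨v, hv⟩
          rw [← hR] at this
          omega
      · intro hc
        rw [e5] at hc
        refine Does.skip ⟨e3, ?_, ?_, ?_, ?_⟩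
        · intro a ha
          rw [Mem.write_ne _ _ _ (by omega), e1 a ha]
        · simpa [Mem.write_apply] using e2
        · simp [Mem.write_apply]
        · rcases k4 with ⟨k4, k5⟩ | k4
          · left
            refine ⟨by simp [Mem.write_apply, e4, k4], fun u hu => ?_⟩
            rcases Nat.lt_succ_iff_lt_or_eq.1 hu with h | h
            · exact k5 u h
            · have : u = ⟨v, hv⟩ := Fin.ext h
              rw [this, ← hR]
              omega
          · right
            simpa [Mem.write_apply, e4] using k4
    · rintro m2 ⟨k1, k2, k3, k4⟩
      have e5 : m2 5 = m1 5 := k1 5 (by omega)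
      refine Does.assign ⟨by simpa [Mem.write_apply] using k2, ?_, ?_, ?_⟩
      · intro a ha ha'
        rw [Mem.write_ne _ _ _ (by omega), Mem.write_ne _ _ _ ha', k1 a ha, h1 a ha ha']
      · simp [Mem.write_apply]
      · have f1 : ∀ x, ((m2.write 5 (Expr.eval m2 (.lit 0)) x).write 33 0 (q + 1)) 32 0 = m2 32 0 :=
          fun x => by simp [Mem.write_apply]
        have f2 : ((m2.write 5 (Expr.eval m2 (.lit 0))
            (Expr.eval m2 (.add (.var 5) (.var 32)))).write 33 0 (q + 1)) 5 0 =
            m1 5 0 + m2 32 0 := by simp [Mem.write_apply, Expr.eval, e5]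
        rw [f1, f2]
        rcases h3 with ⟨h3, h4, h6⟩ | ⟨h3, h4, h6, h7⟩
        · rcases k4 with ⟨k4, k5⟩ | ⟨k4, k5⟩
          · left
            refine ⟨by omega, by omega, fun q' hq' => ?_⟩
            rcases Nat.lt_succ_iff_lt_or_eq.1 hq' with h | rfl
            · exact h6 q' h
            · exact fun u => k5 u u.2
          · right
            rw [k4, h4]
            exact ⟨rfl, by omega, h6, k5⟩
        · right
          have : m2 32 0 = 0 := by
            rcases k4 with ⟨k4, k5⟩ | ⟨k4, k5⟩
            · rw [k4, h3]
            · exact k4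
          rw [this]
          exact ⟨rfl, by omega, h6, h7⟩
  · rintro m1 ⟨h1, h2, h3⟩
    refine hQ m1 ?_ h1
    rcases h3 with ⟨-, h3, h4⟩ | ⟨-, h3, h4, h5⟩
    · exact ⟨h3.le, h3 ▸ h4, fun h => by omega⟩
    · exact ⟨h3.le, h4, fun _ => h5⟩

/-- `s` is the largest exponent with `3 * L * 2 ^ s ≤ M`, or `0` if there is none. -/
structure HazardParam (L M s : ℕ) : Prop where
  le : s ≤ M
  lower : 3 * L * 2 ^ s ≤ M ∨ s = 0
  upper : M < 3 * L * 2 ^ (s + 1)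

/-- Compute the hazard parameter `s` (variable `7`) and its power `2 ^ s` (variable `6`). -/
def hazardProg (K : ℕ) : Prog :=
  .seq (.assign 37 (.lit 0) (.mulLit 3 (.var 4)))
  (.seq (.assign 6 (.lit 0) (.lit 1))
  (forLoop 38 (.mulLit K (.var 5))
    (.ite (.sub (.add (.mulLit K (.var 5)) (.lit 1)) (.add (.var 37) (.var 37)))
      (.seq (.assign 37 (.lit 0) (.add (.var 37) (.var 37)))
      (.seq (.assign 6 (.lit 0) (.add (.var 6) (.var 6)))
        (.assign 7 (.lit 0) (.add (.var 7) (.lit 1)))))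
      .skip)))

theorem Does.hazardProg {m : Mem} {K L d W : ℕ} {Q : Mem → Prop} (h4 : m 4 0 = L) (hL : 0 < L)
    (h5 : m 5 0 = d) (h7 : m 7 0 = 0) (hW : K * d ≤ W)
    (hQ : ∀ m', HazardParam L (K * d) (m' 7 0) → m' 6 0 = 2 ^ m' 7 0 →
      (∀ a, a ≠ 6 → a ≠ 7 → a ≠ 37 → a ≠ 38 → m' a = m a) → Q m') :
    Does (hazardProg K) m (W * 9 + 7) Q := by
  unfold _root_.hazardProg
  refine Does.mono (T := 1 + (1 + (W * ((5 + 1) + 3) + 3) + 1) + 1) (Q := Q)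
    (Does.seq (Does.assign (Does.seq (Does.assign ?_)))) (by omega) fun _ h => h
  -- The number of rounds is generous. The last disjunct says that either every round so far has
  -- doubled, or doubling once more would exceed `K * d`.
  refine Does.forLoop (N := K * d) (fun i m' =>
    (∀ a, a ≠ 6 → a ≠ 7 → a ≠ 37 → a ≠ 38 → m' a = m a) ∧ m' 38 0 = i ∧ m' 6 0 = 2 ^ m' 7 0 ∧
      m' 37 0 = 3 * L * 2 ^ m' 7 0 ∧ m' 7 0 ≤ i ∧ (3 * L * 2 ^ m' 7 0 ≤ K * d ∨ m' 7 0 = 0) ∧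
      (m' 7 0 = i ∨ K * d < 3 * L * 2 ^ (m' 7 0 + 1))) hW ?_ ?_ ?_ ?_
  · refine ⟨fun a h1 h2 h3 h4 => ?_, ?_⟩
    · rw [Mem.write_ne _ _ _ h4, Mem.write_ne _ _ _ h1, Mem.write_ne _ _ _ h3]
    · simp [Mem.write_apply, Expr.eval, Expr.eval_mulLit, h7, h4]
  · rintro i - m' ⟨h1, h2, -⟩
    refine ⟨h2, ?_⟩
    simp only [Expr.eval_mulLit, Expr.eval, h1 5 (by omega) (by omega) (by omega) (by omega), h5]
  · rintro i hi m1 ⟨h1, h2, h3, h6, h8, h9, h10⟩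
    have e5 : m1 5 0 = d := by rw [h1 5 (by omega) (by omega) (by omega) (by omega), h5]
    have ev : Expr.eval m1 (.sub (.add (.mulLit K (.var 5)) (.lit 1)) (.add (.var 37) (.var 37))) =
        K * d + 1 - 3 * L * 2 ^ (m1 7 0 + 1) := by
      simp only [Expr.eval, Expr.eval_mulLit, e5, h6]
      rw [pow_succ, ← mul_assoc, mul_two]
    refine Does.ite (T := 5) ?_ ?_
    · intro hc
      rw [ev] at hc
      refine Does.seq (T := 1) (T' := 3) (Does.assign (Does.seq (T := 1) (T' := 1)
        (Does.assign (Does.assign ⟨?_, ?_⟩))))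
      · simpa [Mem.write_apply] using h2
      · refine ⟨fun a k1 k2 k3 k4 => ?_, ?_⟩
        · rw [Mem.write_ne _ _ _ k4, Mem.write_ne _ _ _ k2, Mem.write_ne _ _ _ k1,
            Mem.write_ne _ _ _ k3, h1 a k1 k2 k3 k4]
        · simp only [Mem.write_apply, Expr.eval, h3, h6]
          norm_num
          refine ⟨by ring, by ring, h8, by omega, by omega⟩
    · intro hc
      rw [ev] at hc
      refine (Does.skip (m := m1) ⟨h2, ⟨fun a k1 k2 k3 k4 => ?_, ?_⟩⟩).mono (by omega) fun _ h => h
      · rw [Mem.write_ne _ _ _ k4, h1 a k1 k2 k3 k4]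
      · simp only [Mem.write_apply, h3, h6]
        norm_num
        exact ⟨by omega, h9, by omega⟩
  · rintro m1 ⟨h1, h2, h3, h6, h8, h9, h10⟩
    refine hQ m1 ⟨h8, h9, ?_⟩ h3 h1
    rcases h10 with h | h
    · rw [h]
      -- If all `K * d` rounds had doubled, the upper bound would hold because `2 ^ (K * d + 1)`
      -- alone exceeds `K * d`.
      have : K * d < 2 ^ (K * d + 1) := (Nat.lt_two_pow_self).trans
        (Nat.pow_lt_pow_right (by norm_num) (by omega))
      nlinarith
    · exact h

/-- The deterministic preparation: the size of `k`, the growth parameter, the hazard parameter. -/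
def prepProg (K C : ℕ) : Prog :=
  .seq sizeProg (.seq (fillLoop 10 21 (.var 0) (.lit 1)) (.seq (growthProg K C) (hazardProg K)))

/-- The memory after the preparation, with growth parameter `d` and hazard parameter `s`. -/
structure Prepared {n : ℕ} (G : SimpleGraph (Fin n)) (k d s : ℕ) (m : Mem) : Prop where
  graph : HasGraph G m
  k_eq : m 1 0 = k
  size_eq : m 4 0 = Nat.size k
  growth_eq : m 5 0 = d
  pow_eq : m 6 0 = 2 ^ s
  hazard_eq : m 7 0 = s
  alive : HoldsSet 10 (Finset.univ : Finset (Fin n)) m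
  zero : ∀ a, a = 3 ∨ a = 8 ∨ a = 9 ∨ a = 11 ∨ a = 12 ∨ 40 ≤ a → m a = fun _ => 0

theorem hasGraph_inputMem {n : ℕ} (G : SimpleGraph (Fin n)) (k : ℕ) :
    HasGraph G (inputMem G k) := by
  refine ⟨rfl, fun u v => ?_⟩
  -- Division with remainder by `n` recovers the pair of vertices from the index of the cell.
  have h : (∃ u' v' : Fin n, G.Adj u' v' ∧ (u : ℕ) * n + v = (u' : ℕ) * n + v') ↔ G.Adj u v := by
    constructor
    · rintro ⟨u', v', h, he⟩
      have hv := congrArg (· % n) he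
      have hu := congrArg (· / n) he
      have hn : 0 < n := u.pos
      simp only [Nat.mod_eq_of_lt v.2, Nat.mod_eq_of_lt v'.2,
        Nat.add_comm (_ * n), Nat.add_mul_div_right _ _ hn, Nat.div_eq_of_lt v.2,
        Nat.div_eq_of_lt v'.2, Nat.add_mul_mod_self_right, zero_add] at hv hu
      rwa [Fin.ext hu, Fin.ext hv]
    · exact fun h => ⟨u, v, h, rfl⟩
  constructor
  · intro hadj
    simp only [inputMem]
    rw [if_pos (h.2 hadj)]
  · intro hadj
    simp only [inputMem]
    rw [if_neg (mt h.1 hadj)]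

/-- A bound for the running time of the preparation. -/
def prepTime (K W : ℕ) : ℕ := growthTime W + W * 8 + K * W * 9 + 16

theorem does_prepProg {n : ℕ} (G : SimpleGraph (Fin n)) (K C k W : ℕ) (hk : 2 ≤ k)
    (hn : n ≤ W) (hkW : Nat.size k ≤ W) :
    Does (prepProg K C) (inputMem G k) (prepTime K W) fun m =>
      ∃ d s, GrowthParam G K C k d ∧ HazardParam (Nat.size k) (K * d) s ∧ Prepared G k d s m := by
  unfold prepProg
  refine Does.mono (T := (W * 4 + 3) + ((W * 4 + 3) + (growthTime W + (K * W * 9 + 7) + 1) + 1) + 1)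
    (Does.seq ?_) (by unfold prepTime; omega) fun _ h => h
  refine Does.sizeProg (k := k) rfl rfl hkW fun m1 h1 h2 => Does.seq ?_
  have h00 : m1 0 0 = n := by rw [h2 0 (by omega) (by omega)]; rfl
  refine Does.fillLoop (N := n) (fun _ => 1) (by norm_num) hn ?_ ?_ (Does.seq ?_)
  · intro i
    simpa [Expr.eval, Mem.write_apply, Mem.fill_apply] using h00
  · intro i _
    simp [Expr.eval]
  set m2 := (m1.fill 10 n fun _ => 1).write 21 0 n with hm2
  have f2 : ∀ a, a ≠ 4 → a ≠ 31 → a ≠ 10 → a ≠ 21 → m2 a = inputMem G k a := fun a k1 k2 k3 k4 => by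
    rw [hm2, Mem.write_ne _ _ _ k4, Mem.fill_ne _ _ _ k3, h2 a k1 k2]
  have hG2 : HasGraph G m2 := by
    unfold HasGraph
    rw [f2 0 (by omega) (by omega) (by omega) (by omega),
      f2 2 (by omega) (by omega) (by omega) (by omega)]
    exact hasGraph_inputMem G k
  have e4 : m2 4 0 = Nat.size k := by simpa [hm2, Mem.write_apply, Mem.fill_apply] using h1
  have hal : HoldsSet 10 (Finset.univ : Finset (Fin n)) m2 := fun u => by
    simp [hm2, Mem.write_apply, Mem.fill_apply]
  refine Does.growthProg hG2 (k := k)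
    (by rw [f2 1 (by omega) (by omega) (by omega) (by omega)]; rfl)
    (by rw [f2 5 (by omega) (by omega) (by omega) (by omega)]; rfl) hal hn fun m3 h3 h4 => ?_
  have hL : 0 < Nat.size k := Nat.size_pos.2 (by omega)
  refine Does.hazardProg (d := m3 5 0) (L := Nat.size k) ?_ hL rfl ?_ ?_ ?_
  · rw [h4 4 (by omega) (by omega), e4]
  · rw [h4 7 (by omega) (by omega), f2 7 (by omega) (by omega) (by omega) (by omega)]
    rfl
  · exact Nat.mul_le_mul_left _ (h3.le.trans hn)
  · intro m4 h5 h6 h7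
    have f4 : ∀ a, a < 20 ∨ 40 ≤ a → a ≠ 5 → a ≠ 6 → a ≠ 7 → m4 a = m2 a :=
      fun a k1 k2 k3 k4 => by rw [h7 a k3 k4 (by omega) (by omega), h4 a k1 k2]
    refine ⟨m3 5 0, m4 7 0, h3, h5, ⟨?_, ?_, ?_, ?_, h6, rfl, ?_, ?_⟩⟩
    · unfold HasGraph
      rw [f4 0 (by omega) (by omega) (by omega) (by omega),
        f4 2 (by omega) (by omega) (by omega) (by omega)]
      exact hG2
    · rw [f4 1 (by omega) (by omega) (by omega) (by omega),
        f2 1 (by omega) (by omega) (by omega) (by omega)]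
      rfl
    · rw [f4 4 (by omega) (by omega) (by omega) (by omega), e4]
    · rw [h7 5 (by omega) (by omega) (by omega) (by omega)]
    · unfold HoldsSet
      rw [f4 10 (by omega) (by omega) (by omega) (by omega)]
      exact hal
    · intro a ha
      rw [f4 a (by omega) (by omega) (by omega) (by omega),
        f2 a (by omega) (by omega) (by omega) (by omega)]
      funext i
      unfold inputMem
      split <;> omega

/-! ### Carving balls and pruning components -/

open Classical in
/-- The vertices at distance exactly `i` from `v` in the graph induced by `S`. -/
noncomputable def sphere {V : Type} (G : SimpleGraph V) (S : Finset V) (v : V) : ℕ → Finset V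
  | 0 => {v}
  | i + 1 => reach G S v (i + 1) \ reach G S v i

theorem sphere_subset_reach {V : Type} {G : SimpleGraph V} {S : Finset V} {v : V} {i : ℕ} :
    sphere G S v i ⊆ reach G S v i := by
  cases i with
  | zero => simp [sphere, reach]
  | succ i =>
    classical
    intro u hu
    simp only [sphere, Finset.mem_sdiff] at hu
    exact hu.1

theorem mem_sphere_iff_bfsLabel {V : Type} [Fintype V] {G : SimpleGraph V} {S : Finset V} {v : V}
    (i : ℕ) (u : V) : u ∈ sphere G S v i ↔ bfsLabel G S v (Fintype.card V) u = i + 1 := by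
  cases i with
  | zero =>
    have := mem_reach_iff_bfsLabel (G := G) (S := S) (v := v) 0 u
    simp only [reach] at this
    rw [sphere, this]
    omega
  | succ i =>
    simp only [sphere, Finset.mem_sdiff, mem_reach_iff_bfsLabel]
    omega

open Classical in
/-- The remaining vertices and the boundary after the first `j` vertices have been offered as
centers: if the vertex `v` is still there, then the ball of radius `r v` around it is removed, and
its outermost sphere joins the boundary. -/
noncomputable def carve {n : ℕ} (G : SimpleGraph (Fin n)) (r : ℕ → ℕ) :
    ℕ → Finset (Fin n) × Finset (Fin n)
  | 0 => (Finset.univ, ∅)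
  | j + 1 =>
    if h : ∃ hj : j < n, (⟨j, hj⟩ : Fin n) ∈ (carve G r j).1 then
      ((carve G r j).1 \ reach G (carve G r j).1 ⟨j, h.1⟩ (r j),
        (carve G r j).2 ∪ sphere G (carve G r j).1 ⟨j, h.1⟩ (r j))
    else carve G r j

/-- The boundary of the carving. -/
noncomputable def boundary {n : ℕ} (G : SimpleGraph (Fin n)) (r : ℕ → ℕ) : Finset (Fin n) :=
  (carve G r n).2

open Classical in
/-- The vertices outside of the boundary, and the boundary vertices selected by `κ`. -/
noncomputable def kept {n : ℕ} (G : SimpleGraph (Fin n)) (r κ : ℕ → ℕ) : Finset (Fin n) :=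
  Finset.univ.filter fun u => u ∈ boundary G r → κ u ≠ 0

open Classical in
/-- The kept vertices whose component has few boundary vertices. -/
noncomputable def pruned {n : ℕ} (G : SimpleGraph (Fin n)) (N k : ℕ) (r κ : ℕ → ℕ) :
    Finset (Fin n) :=
  (kept G r κ).filter fun u => (boundary G r ∩ reach G (kept G r κ) u n).card * N ≤ k

/-- The carving procedure; array `8` holds the radii, array `10` the remaining vertices and
array `11` the boundary. -/
def carveProg : Prog :=
  forLoop 30 (.var 0)
    (.ite (.get 10 (.var 30))
      (.seq (bfs 10 30)
      (.seq (fillLoop 11 21 (.var 0) (.isZero (.isZero (.add (.get 11 (.var 21))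
        (.isZero (.diff (.get 20 (.var 21)) (.add (.get 8 (.var 30)) (.lit 1))))))))
      (fillLoop 10 21 (.var 0) (.sub (.get 10 (.var 21))
        (.isZero (.add (.isZero (.get 20 (.var 21)))
          (.sub (.get 20 (.var 21)) (.add (.get 8 (.var 30)) (.lit 1)))))))))
      .skip)

theorem Does.carveProg {n : ℕ} {G : SimpleGraph (Fin n)} {W : ℕ} {m : Mem} {Q : Mem → Prop}
    {r : ℕ → ℕ} (hG : HasGraph G m) (hr : ∀ i < n, m 8 i = r i)
    (hal : HoldsSet 10 (Finset.univ : Finset (Fin n)) m)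
    (hbd : HoldsSet 11 (∅ : Finset (Fin n)) m) (hW : n ≤ W)
    (hQ : ∀ m', HoldsSet 11 (boundary G r) m' → (∀ a, a < 10 ∨ a = 12 → m' a = m a) → Q m') :
    Does carveProg m (W * (bfsTime W + W * 8 + 12) + 3) Q := by
  unfold _root_.carveProg
  refine Does.mono (T := W * ((bfsTime W + ((W * 4 + 3) + (W * 4 + 3) + 1) + 1 + 1) + 3) + 3)
    (Q := Q) ?_ (by apply le_of_eq; ring) fun _ h => h
  refine Does.forLoop (N := n) (fun j m' => (∀ a, a < 10 ∨ a = 12 → m' a = m a) ∧ m' 30 0 = j ∧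
    HoldsSet 10 (carve G r j).1 m' ∧ HoldsSet 11 (carve G r j).2 m') hW ?_ ?_ ?_ ?_
  · refine ⟨fun a ha => Mem.write_ne _ _ _ (by omega), by simp [Mem.write_apply], ?_, ?_⟩
    · intro u
      simpa [Mem.write_apply, carve] using hal u
    · intro u
      simpa [Mem.write_apply, carve] using hbd u
  · rintro j - m' ⟨h1, h2, -⟩
    refine ⟨h2, ?_⟩
    simp only [Expr.eval, h1 0 (by omega)]
    exact hG.1
  · rintro j hj m1 ⟨h1, h2, h3, h4⟩
    have hG1 : HasGraph G m1 := by
      unfold HasGraph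
      rw [h1 0 (by omega), h1 2 (by omega)]
      exact hG
    refine Does.ite (fun hc => ?_) fun hc => ?_
    · have hj' : (⟨j, hj⟩ : Fin n) ∈ (carve G r j).1 := by
        by_contra h
        have := (h3 ⟨j, hj⟩).2 h
        simp only [Expr.eval, h2] at hc
        exact hc this
      have hc1 : (carve G r (j + 1)) =
          ((carve G r j).1 \ reach G (carve G r j).1 ⟨j, hj⟩ (r j),
          (carve G r j).2 ∪ sphere G (carve G r j).1 ⟨j, hj⟩ (r j)) := by
        rw [carve, dif_pos ⟨hj, hj'⟩]
      rw [hc1]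
      set U := (carve G r j).1
      set D := (carve G r j).2
      refine Does.seq (T' := (W * 4 + 3) + (W * 4 + 3) + 1)
        (Does.bfs ⟨j, hj⟩ hG1 h3 (by omega) (by omega) h2 hW ?_)
      intro m2 k1 k2
      have a0 : m2 0 0 = n := by rw [k1 0 (by omega)]; exact hG1.1
      have a30 : m2 30 0 = j := by rw [k1 30 (by omega)]; exact h2
      have a8 : m2 8 j = r j := by rw [k1 8 (by omega), h1 8 (by omega), hr j hj]
      refine Does.seq (T := W * 4 + 3) (T' := W * 4 + 3) (Does.fillLoop (a := 11) (c := 21) (N := n)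
        (fun u => 1 - (1 - (m2 11 u + (1 - ((m2 20 u - (r j + 1)) + ((r j + 1) - m2 20 u))))))
        (by norm_num) hW ?_ ?_ ?_)
      · intro i
        simpa [Expr.eval, Mem.write_apply, Mem.fill_apply] using a0
      · intro i hi
        simp [Expr.eval, Mem.write_apply, Mem.fill_apply, a30, a8]
      refine Does.fillLoop (a := 10) (c := 21) (N := n) 
        (fun u => m2 10 u - (1 - ((1 - m2 20 u) + (m2 20 u - (r j + 1)))))
        (by norm_num) hW ?_ ?_ ?_
      · intro i
        simpa [Expr.eval, Mem.write_apply, Mem.fill_apply] using a0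
      · intro i hi
        simp [Expr.eval, Mem.write_apply, Mem.fill_apply, a30, a8]
      · refine ⟨?_, ?_, ?_, ?_, ?_⟩
        · simpa [Mem.write_apply, Mem.fill_apply] using a30
        · intro a ha
          rw [Mem.write_ne _ _ _ (by omega), Mem.write_ne _ _ _ (by omega),
            Mem.fill_ne _ _ _ (by omega), Mem.write_ne _ _ _ (by omega),
            Mem.fill_ne _ _ _ (by omega), k1 a (by omega), h1 a ha]
        · simp [Mem.write_apply]
        · intro u
          have l1 := h3 u
          have l2 := mem_reach_iff_bfsLabel (G := G) (S := U) (v := ⟨j, hj⟩) (r j) u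
          rw [Fintype.card_fin, ← k2 u] at l2
          rw [← k1 10 (by omega)] at l1
          simp only [Finset.mem_sdiff, l2]
          simp only [Mem.write_apply, Mem.fill_apply]
          norm_num
          by_cases hu : u ∈ U
          · rw [l1.1 hu]; simp only [hu, forall_const]; omega
          · rw [l1.2 hu]; simp [hu]
        · intro u
          have l1 := h4 u
          have l2 := mem_sphere_iff_bfsLabel (G := G) (S := U) (v := ⟨j, hj⟩) (r j) u
          rw [Fintype.card_fin, ← k2 u] at l2
          rw [← k1 11 (by omega)] at l1
          simp only [Finset.mem_union, l2]
          simp only [Mem.write_apply, Mem.fill_apply]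
          norm_num
          by_cases hu : u ∈ D
          · rw [l1.1 hu]; simp [hu]
          · rw [l1.2 hu]; simp only [hu, false_or]; omega
    · have hj' : (⟨j, hj⟩ : Fin n) ∉ (carve G r j).1 := by
        intro h
        have := (h3 ⟨j, hj⟩).1 h
        simp only [Expr.eval, h2] at hc
        simp only at this
        omega
      have hc1 : carve G r (j + 1) = carve G r j := by
        rw [carve, dif_neg]
        rintro ⟨_, h⟩
        exact hj' h
      rw [hc1]
      refine (Does.skip (m := m1) ⟨h2, ?_, ?_, ?_, ?_⟩).mono (by omega) fun _ h => h
      · intro a ha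
        rw [Mem.write_ne _ _ _ (by omega), h1 a ha]
      · simp [Mem.write_apply]
      · intro u
        simpa [Mem.write_apply] using h3 u
      · intro u
        simpa [Mem.write_apply] using h4 u
  · rintro m1 ⟨h1, -, -, h4⟩
    exact hQ m1 h4 h1

/-- Output the kept vertices whose component has few boundary vertices; array `9` holds the
selection and array `12` the kept vertices. -/
def pruneProg : Prog :=
  .seq (fillLoop 12 21 (.var 0) (.isZero (.sub (.get 11 (.var 21)) (.get 9 (.var 21)))))
  (forLoop 30 (.var 0)
    (.ite (.get 12 (.var 30))
      (.seq (bfs 12 30)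
      (.seq (sumLoop 34 35 (.var 0) (.isZero (.add (.isZero (.get 20 (.var 35)))
        (.isZero (.get 11 (.var 35))))))
      (.seq (sumLoop 36 35 (.var 34) (.var 6))
      (.ite (.sub (.var 36) (.var 1)) .skip (.assign 3 (.var 30) (.lit 1))))))
      .skip))

theorem Does.pruneProg {n : ℕ} {G : SimpleGraph (Fin n)} {W N k : ℕ} {m : Mem} {Q : Mem → Prop}
    {r κ : ℕ → ℕ} (hG : HasGraph G m) (hk : m 1 0 = k) (hN : m 6 0 = N) (h3 : ∀ i, m 3 i = 0)
    (hκ : ∀ i < n, m 9 i = κ i) (hbd : HoldsSet 11 (boundary G r) m) (hW : n ≤ W)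
    (hQ : ∀ m', outputSet n m' = pruned G N k r κ →
      (∀ a, a < 10 → a ≠ 3 → m' a = m a) → Q m') :
    Does pruneProg m (W * (bfsTime W + W * 8 + 19) + W * 4 + 7) Q := by
  classical
  unfold _root_.pruneProg
  refine Does.mono (T := (W * 4 + 3) + (W * ((bfsTime W + ((W * 4 + 5) + ((W * 4 + 5) + (1 + 1) + 1)
    + 1) + 1 + 1) + 3) + 3) + 1) (Q := Q) (Does.seq ?_) (by ring_nf; omega) fun _ h => h
  -- The value is `0` only for a boundary vertex with selection `0`: truncated subtraction expresses
  -- the implication in `kept`.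
  refine Does.fillLoop (N := n) (fun u => 1 - (m 11 u - m 9 u)) (by norm_num) hW ?_ ?_ ?_
  · intro i
    have := hG.1
    simpa [Expr.eval, Mem.write_apply, Mem.fill_apply] using this
  · intro i hi
    simp [Expr.eval, Mem.write_apply, Mem.fill_apply]
  set m1 := (m.fill 12 n fun u => 1 - (m 11 u - m 9 u)).write 21 0 n with hm1
  have f1 : ∀ a, a < 12 → m1 a = m a := fun a ha => by
    rw [hm1, Mem.write_ne _ _ _ (by omega), Mem.fill_ne _ _ _ (by omega)]
  have hA : HoldsSet 12 (kept G r κ) m1 := by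
    intro u
    have h1 := hbd u
    have h2 := hκ u u.2
    simp only [hm1, Mem.write_apply, Mem.fill_apply, kept, Finset.mem_filter, Finset.mem_univ,
      true_and]
    norm_num
    rw [h2]
    by_cases hu : u ∈ boundary G r
    · rw [h1.1 hu]; simp only [hu, forall_const]; omega
    · rw [h1.2 hu]; simp [hu]
  refine Does.forLoop (N := n) (fun j m' => (∀ a, a < 13 → a ≠ 3 → m' a = m1 a) ∧ m' 30 0 = j ∧
    ∀ u : Fin n, m' 3 u ≠ 0 ↔ (u : ℕ) < j ∧ u ∈ pruned G N k r κ) hW ?_ ?_ ?_ ?_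
  · refine ⟨fun a ha _ => Mem.write_ne _ _ _ (by omega), by simp [Mem.write_apply], fun u => ?_⟩
    simp [Mem.write_apply, f1 3, h3]
  · rintro j - m' ⟨h1, h2, -⟩
    refine ⟨h2, ?_⟩
    simp only [Expr.eval, h1 0 (by omega) (by omega), f1 0 (by omega)]
    exact hG.1
  · rintro j hj m2 ⟨k1, k2, k3⟩
    have hG2 : HasGraph G m2 := by
      unfold HasGraph
      rw [k1 0 (by omega) (by omega), k1 2 (by omega) (by omega), f1 0 (by omega),
        f1 2 (by omega)]
      exact hG
    have hA2 : HoldsSet 12 (kept G r κ) m2 := by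
      unfold HoldsSet
      rw [k1 12 (by omega) (by omega)]
      exact hA
    have hfin : ∀ m' : Mem, (∀ a, a < 13 → a ≠ 3 → m' a = m1 a) → m' 30 0 = j →
        (∀ u : Fin n, m' 3 u ≠ 0 ↔ m2 3 u ≠ 0 ∨ (u : ℕ) = j ∧ u ∈ pruned G N k r κ) →
        m' 30 0 = j ∧ (∀ a, a < 13 → a ≠ 3 → (m'.write 30 0 (j + 1)) a = m1 a) ∧
          (m'.write 30 0 (j + 1)) 30 0 = j + 1 ∧
          ∀ u : Fin n, (m'.write 30 0 (j + 1)) 3 u ≠ 0 ↔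
            (u : ℕ) < j + 1 ∧ u ∈ pruned G N k r κ := by
      intro m' l1 l2 l3
      refine ⟨l2, fun a ha ha' => ?_, by simp [Mem.write_apply], fun u => ?_⟩
      · rw [Mem.write_ne _ _ _ (by omega), l1 a ha ha']
      · rw [Mem.write_ne _ _ _ (by omega), l3, k3, Nat.lt_succ_iff_lt_or_eq]
        tauto
    refine Does.ite (fun hc => ?_) fun hc => ?_
    · have hjA : (⟨j, hj⟩ : Fin n) ∈ kept G r κ := by
        by_contra h
        have := (hA2 ⟨j, hj⟩).2 h
        simp only [Expr.eval, k2] at hc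
        exact hc this
      refine Does.seq (T' := (W * 4 + 5) + ((W * 4 + 5) + (1 + 1) + 1) + 1)
        (Does.bfs ⟨j, hj⟩ hG2 hA2 (by omega) (by omega) k2 hW ?_)
      intro m3 l1 l2
      refine Does.seq (T := W * 4 + 5) (T' := (W * 4 + 5) + (1 + 1) + 1)
        (Does.sumLoop (s := 34) (c := 35) (N := n)
        (fun w => 1 - ((1 - m3 20 w) + (1 - m3 11 w))) (by norm_num) hW ?_ ?_ ?_)
      · intro a b
        have : m3 0 0 = n := by rw [l1 0 (by omega)]; exact hG2.1
        simpa [Expr.eval, Mem.write_apply] using this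
      · intro u hu x
        simp [Expr.eval, Mem.write_apply]
      have hbd3 : HoldsSet 11 (boundary G r) m3 := by
        unfold HoldsSet
        rw [l1 11 (by omega), k1 11 (by omega) (by omega), f1 11 (by omega)]
        exact hbd
      have hsum : ∑ w ∈ Finset.range n, (1 - ((1 - m3 20 w) + (1 - m3 11 w))) =
          (boundary G r ∩ reach G (kept G r κ) ⟨j, hj⟩ n).card := by
        rw [Finset.sum_range, Finset.card_eq_sum_ones, ← Finset.sum_filter_add_sum_filter_not
          Finset.univ (· ∈ boundary G r ∩ reach G (kept G r κ) ⟨j, hj⟩ n)]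
        rw [Finset.sum_eq_zero (s := Finset.univ.filter
          (· ∉ boundary G r ∩ reach G (kept G r κ) ⟨j, hj⟩ n)), add_zero,
          Finset.filter_mem_eq_inter, Finset.univ_inter]
        all_goals
          have hle := (bfsLabel_spec (G := G) (S := kept G r κ) (v := ⟨j, hj⟩) n).1
        · refine Finset.sum_congr rfl fun u hu => ?_
          rw [Finset.mem_inter, mem_reach_iff_bfsLabel, Fintype.card_fin] at hu
          rw [(hbd3 u).1 hu.1, l2 u]
          omega
        · intro u hu
          rw [Finset.mem_filter, Finset.mem_inter, mem_reach_iff_bfsLabel, Fintype.card_fin] at hu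
          by_cases hub : u ∈ boundary G r
          · rw [(hbd3 u).1 hub, l2 u]
            have := hle u
            have := hu.2
            simp only [hub, true_and] at this
            omega
          · rw [(hbd3 u).2 hub]
            omega
      rw [hsum]
      set R := (boundary G r ∩ reach G (kept G r κ) ⟨j, hj⟩ n).card with hR
      -- This bounds the number of additions that form `R * N`; the size of `N` does not enter the
      -- running time.
      have hRn : R ≤ n := (Finset.card_le_univ _).trans_eq (Fintype.card_fin n)
      refine Does.seq (T := W * 4 + 5) (T' := 1 + 1)
        (Does.sumLoop (s := 36) (c := 35) (N := R) (fun _ => N) (by norm_num) (by omega) ?_ ?_ ?_)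
      · intro a b
        simp [Expr.eval, Mem.write_apply]
      · intro u hu x
        have : m3 6 0 = N := by
          rw [l1 6 (by omega), k1 6 (by omega) (by omega), f1 6 (by omega), hN]
        simpa [Expr.eval, Mem.write_apply] using this
      rw [Finset.sum_const, Finset.card_range, smul_eq_mul]
      set m4 := (((m3.write 34 0 R).write 35 0 n).write 36 0 (R * N)).write 35 0 R with hm4
      have e1 : ∀ a, a < 20 → m4 a = m2 a := by
        intro a ha
        rw [hm4, Mem.write_ne _ _ _ (by omega), Mem.write_ne _ _ _ (by omega),
          Mem.write_ne _ _ _ (by omega), Mem.write_ne _ _ _ (by omega), l1 a (by omega)]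
      have e3 : m4 30 0 = j := by
        simpa [hm4, Mem.write_apply, l1 30 (by omega)] using k2
      have e5 : Expr.eval m4 (.sub (.var 36) (.var 1)) = R * N - k := by
        have : m4 1 0 = k := by
          rw [e1 1 (by omega), k1 1 (by omega) (by omega), f1 1 (by omega)]
          exact hk
        simp only [Expr.eval, this]
        simp [hm4, Mem.write_apply]
      have hpr : (⟨j, hj⟩ : Fin n) ∈ pruned G N k r κ ↔ R * N ≤ k := by
        simp [pruned, hjA, ← hR]
      refine Does.ite (T := 1) ?_ ?_
      · intro hc
        rw [e5] at hc
        refine Does.skip (hfin _ (fun a ha ha' => ?_) e3 fun u => ?_)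
        · rw [e1 a (by omega), k1 a ha ha']
        · rw [e1 3 (by omega)]
          refine ⟨Or.inl, fun h => h.elim id ?_⟩
          rintro ⟨h, h'⟩
          rw [show u = ⟨j, hj⟩ from Fin.ext h, hpr] at h'
          omega
      · intro hc
        rw [e5] at hc
        refine Does.assign (hfin _ (fun a ha ha' => ?_) ?_ fun u => ?_)
        · rw [Mem.write_ne _ _ _ ha', e1 a (by omega), k1 a ha ha']
        · simpa [Mem.write_apply] using e3
        · simp only [Expr.eval, Mem.write_apply, true_and, e3, e1 3 (by omega)]
          by_cases h : (u : ℕ) = j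
          · have h' := hpr.2 (by omega)
            rw [← show u = ⟨j, hj⟩ from Fin.ext h] at h'
            simp [h, h']
          · simp [h]
    · have hjA : (⟨j, hj⟩ : Fin n) ∉ kept G r κ := by
        intro h
        have := (hA2 ⟨j, hj⟩).1 h
        simp only [Expr.eval, k2] at hc
        simp only at this
        omega
      refine (Does.skip (m := m2) (hfin _ k1 k2 fun u => ?_)).mono (by omega) fun _ h => h
      refine ⟨Or.inl, fun h => h.elim id ?_⟩
      rintro ⟨h, h'⟩
      rw [show u = ⟨j, hj⟩ from Fin.ext h] at h'
      exact absurd (Finset.mem_filter.1 h').1 hjA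
  · rintro m2 ⟨k1, -, k3⟩
    refine hQ m2 ?_ fun a ha ha' => ?_
    · ext u
      simp only [outputSet, Finset.mem_filter, Finset.mem_univ, true_and]
      rw [k3 u]
      simp
    · rw [k1 a (by omega) ha', f1 a (by omega)]

/-- The deterministic final phase of the algorithm. -/
def finishProg : Prog :=
  .seq carveProg (.seq pruneProg
    (.ite (.sub (.var 0) (.var 5)) .skip (fillLoop 3 21 (.var 0) (.lit 1))))

/-- A bound for the running time of the final phase. -/
def finishTime (W : ℕ) : ℕ :=
  W * (bfsTime W + W * 8 + 12) + W * (bfsTime W + W * 8 + 19) + W * 8 + 16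

theorem does_finishProg {n : ℕ} {G : SimpleGraph (Fin n)} {k d s W : ℕ} {m : Mem} {r κ : ℕ → ℕ}
    (hm : Prepared G k d s m) (hW : n ≤ W) (m' : Mem)
    (hm' : ∀ a, a ≠ 8 → a ≠ 9 → a < 40 → m' a = m a)
    (hr : ∀ i < n, m' 8 i = r i) (hκ : ∀ i < n, m' 9 i = κ i) :
    Does finishProg m' (finishTime W) fun m'' =>
      outputSet n m'' = if d < n then pruned G (2 ^ s) k r κ else Finset.univ := by
  unfold finishProg
  refine Does.mono (T := (W * (bfsTime W + W * 8 + 12) + 3) +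
    ((W * (bfsTime W + W * 8 + 19) + W * 4 + 7) + ((W * 4 + 3) + 1) + 1) + 1)
    (Does.seq ?_) (by unfold finishTime; omega) fun _ h => h
  have g0 := hm' 0 (by omega) (by omega) (by omega)
  have hG : HasGraph G m' := by
    unfold HasGraph
    rw [g0, hm' 2 (by omega) (by omega) (by omega)]
    exact hm.graph
  refine Does.carveProg hG hr ?_ ?_ hW fun m1 h1 h2 => Does.seq ?_
  · unfold HoldsSet
    rw [hm' 10 (by omega) (by omega) (by omega)]
    exact hm.alive
  · intro u
    rw [hm' 11 (by omega) (by omega) (by omega), hm.zero 11 (by omega)]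
    simp
  have hG1 : HasGraph G m1 := by
    unfold HasGraph
    rw [h2 0 (by omega), h2 2 (by omega)]
    exact hG
  refine Does.pruneProg (N := 2 ^ s) (k := k) (κ := κ) hG1 ?_ ?_ ?_ ?_ h1 hW fun m2 h3 h4 => ?_
  · rw [h2 1 (by omega), hm' 1 (by omega) (by omega) (by omega)]
    exact hm.k_eq
  · rw [h2 6 (by omega), hm' 6 (by omega) (by omega) (by omega)]
    exact hm.pow_eq
  · intro i
    rw [h2 3 (by omega), hm' 3 (by omega) (by omega) (by omega), hm.zero 3 (by omega)]
  · rw [h2 9 (by omega)]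
    exact hκ
  have e0 : m2 0 0 = n := by
    rw [h4 0 (by omega) (by omega)]
    exact hG1.1
  have e5 : m2 5 0 = d := by
    rw [h4 5 (by omega) (by omega), h2 5 (by omega), hm' 5 (by omega) (by omega) (by omega)]
    exact hm.growth_eq
  refine Does.ite (fun hc => ?_) fun hc => ?_
  · simp only [Expr.eval, e0, e5] at hc
    refine (Does.skip (m := m2) ?_).mono (by omega) fun _ h => h
    rw [h3, if_pos (by omega)]
  · simp only [Expr.eval, e0, e5] at hc
    refine Does.fillLoop (N := n) (fun _ => 1) (by norm_num) hW ?_ ?_ ?_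
    · intro i
      simpa [Expr.eval, Mem.write_apply, Mem.fill_apply] using e0
    · intro i hi
      simp [Expr.eval]
    · rw [if_neg (by omega)]
      ext u
      simp [outputSet, Mem.write_apply, Mem.fill_apply]

/-! ### The random phase of the algorithm -/

/-- The conjunction of `s` fair coin flips: it is `1` with probability `2 ^ (-s)`. -/
noncomputable def trial (s : ℕ) : PMF ℕ :=
  chain (fun _ x => (PMF.uniformOfFintype Bool).map fun c => x - (1 - c.toNat)) 0 s 1

/-- The waiting time for the first success in a sequence of `M` trials. -/
noncomputable def radius (s M : ℕ) : PMF ℕ :=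
  (chain (fun _ (x : ℕ × ℕ) => (trial s).map fun t => (x.1 - t, x.2 + (x.1 - t))) 0 M (1, 0)).map
    Prod.snd

/-- A sequence whose first `n` members are independent with distribution `ν`. -/
noncomputable def iid (ν : PMF ℕ) (n : ℕ) : PMF (ℕ → ℕ) :=
  chain (fun v f => ν.map fun x => Function.update f v x) 0 n fun _ => 0

theorem Sem.assign_eq {a : ℕ} {i e : Expr} {m m' : Mem}
    (h : m.write a (i.eval m) (e.eval m) = m') : Sem (.assign a i e) m 1 (PMF.pure m') :=
  h ▸ Sem.assign a i e m

/-- Replace array `a` by `f`. -/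
def Mem.setArray (m : Mem) (a : ℕ) (f : ℕ → ℕ) : Mem := Function.update m a f

theorem Mem.setArray_apply (m : Mem) (a : ℕ) (f : ℕ → ℕ) (b j : ℕ) :
    m.setArray a f b j = if b = a then f j else m b j := by
  by_cases h : b = a
  · subst h; simp [Mem.setArray]
  · simp [Mem.setArray, h]

/-- A trial with `sz` coin flips; the result is written to variable `40`. -/
def trialProg (sz : Expr) : Prog :=
  .seq (.assign 40 (.lit 0) (.lit 1))
  (.seq (forLoop 41 sz
    (.seq (.coin 42 (.lit 0))
    (.seq (.assign 40 (.lit 0) (.sub (.var 40) (.isZero (.var 42))))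
    (.assign 42 (.lit 0) (.lit 0)))))
  (.assign 41 (.lit 0) (.lit 0)))

/-- The scratch cells are zero before and are cleared afterwards. So the final memory is a function
of the outcome `x` alone, and its law is an image of the law of `x`. -/
theorem sem_trialProg {sz : Expr} {m : Mem} {s : ℕ} (h41 : m 41 0 = 0) (h42 : m 42 0 = 0)
    (hsz : ∀ x i, sz.eval ((m.write 40 0 x).write 41 0 i) = s) :
    Sem (trialProg sz) m (s * 8 + 7) ((trial s).map fun x => m.write 40 0 x) := by
  have h := Sem.forLoop (c := 41) (b := sz) (m := m.write 40 0 1) (N := s) (t := 5)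
    (body := .seq (.coin 42 (.lit 0))
      (.seq (.assign 40 (.lit 0) (.sub (.var 40) (.isZero (.var 42))))
      (.assign 42 (.lit 0) (.lit 0))))
    (fun _ x => (PMF.uniformOfFintype Bool).map fun c => x - (1 - c.toNat))
    (fun i x => (m.write 40 0 x).write 41 0 i) 1 rfl
    (fun i x => ⟨by simp [Mem.write_apply], hsz x i⟩) ?_
  · refine Sem.seq_pure (t := 1) (t' := s * 8 + 5) (Sem.assign 40 (.lit 0) (.lit 1) m) ?_
    have := Sem.seq_map (t' := 1) (d := .assign 41 (.lit 0) (.lit 0))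
      (g := fun x => m.write 40 0 x) h fun x => Sem.assign_eq ?_
    · rw [show s * 8 + 5 = 1 + (s * (5 + 3) + 3) + 1 by ring]
      exact this
    · funext a j
      simp only [Mem.write_apply, Expr.eval]
      grind
  · intro i hi x
    refine ⟨fun y => (m.write 40 0 y).write 41 0 i, ?_, fun y => ⟨by simp [Mem.write_apply], ?_⟩⟩
    · rw [PMF.map_comp]
      refine Sem.seq_map (t := 1) (t' := 3) (Sem.coin 42 (.lit 0) _) fun b => ?_
      refine Sem.seq_pure (t := 1) (t' := 1) (Sem.assign _ _ _ _) (Sem.assign_eq ?_)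
      funext a j
      simp only [Mem.write_apply, Expr.eval, Function.comp]
      grind
    · funext a j
      simp only [Mem.write_apply]
      grind

/-- Sample the radius of the center in variable `43`. -/
def radiusProg (K : ℕ) : Prog :=
  .seq (.assign 44 (.lit 0) (.lit 1))
  (.seq (forLoop 46 (.mulLit K (.var 5))
    (.seq (trialProg (.var 7))
    (.seq (.assign 44 (.lit 0) (.sub (.var 44) (.var 40)))
    (.seq (.assign 45 (.lit 0) (.add (.var 45) (.var 44)))
    (.assign 40 (.lit 0) (.lit 0))))))
  (.seq (.assign 8 (.var 43) (.var 45))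
  (.seq (.assign 44 (.lit 0) (.lit 0))
  (.seq (.assign 45 (.lit 0) (.lit 0))
  (.assign 46 (.lit 0) (.lit 0))))))

/-- All `K * d` trials are carried out, even after a success, so that the running time is constant.
The flag `x.1` drops to `0` at the first success, and the counter `x.2`, to which the flag is added,
then stands still. -/
theorem sem_radiusProg {K s d : ℕ} {m : Mem} (h40 : ∀ a, 40 ≤ a → a ≠ 43 → m a 0 = 0)
    (h5 : m 5 0 = d) (h7 : m 7 0 = s) :
    Sem (radiusProg K) m (K * d * (s * 8 + 16) + 13)
      ((radius s (K * d)).map fun x => m.write 8 (m 43 0) x) := by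
  have h := Sem.forLoop (c := 46) (b := .mulLit K (.var 5)) (m := m.write 44 0 1) (N := K * d)
    (t := s * 8 + 13)
    (body := .seq (trialProg (.var 7))
      (.seq (.assign 44 (.lit 0) (.sub (.var 44) (.var 40)))
      (.seq (.assign 45 (.lit 0) (.add (.var 45) (.var 44)))
      (.assign 40 (.lit 0) (.lit 0)))))
    (fun _ (x : ℕ × ℕ) => (trial s).map fun t => (x.1 - t, x.2 + (x.1 - t)))
    (fun i x => ((m.write 44 0 x.1).write 45 0 x.2).write 46 0 i) (1, 0) ?_ ?_ ?_
  · refine Sem.seq_pure (t := 1) (t' := K * d * (s * 8 + 16) + 11)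
      (Sem.assign 44 (.lit 0) (.lit 1) m) ?_
    rw [radius, PMF.map_comp]
    rw [show K * d * (s * 8 + 16) + 11 = 7 + (K * d * (s * 8 + 13 + 3) + 3) + 1 by ring]
    refine Sem.seq_map h fun x => ?_
    refine Sem.seq_pure (t := 1) (t' := 5) (Sem.assign _ _ _ _)
      (Sem.seq_pure (t := 1) (t' := 3) (Sem.assign _ _ _ _)
      (Sem.seq_pure (t := 1) (t' := 1) (Sem.assign _ _ _ _) (Sem.assign_eq ?_)))
    funext a j
    have := h40 44 (by omega) (by omega)
    have := h40 45 (by omega) (by omega)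
    have := h40 46 (by omega) (by omega)
    simp only [Mem.write_apply, Expr.eval, Function.comp]
    grind
  · have := h40 45 (by omega) (by omega)
    funext a j
    simp only [Mem.write_apply]
    grind
  · intro i x
    exact ⟨by simp [Mem.write_apply], by simp [Expr.eval_mulLit, Expr.eval, Mem.write_apply, h5]⟩
  · intro i hi x
    refine ⟨fun y => ((m.write 44 0 y.1).write 45 0 y.2).write 46 0 i, ?_,
      fun y => ⟨by simp [Mem.write_apply], ?_⟩⟩
    · rw [PMF.map_comp]
      rw [show s * 8 + 13 = 5 + (s * 8 + 7) + 1 by ring]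
      refine Sem.seq_map (sem_trialProg ?_ ?_ ?_) fun b => ?_
      · simpa [Mem.write_apply] using h40 41 (by omega) (by omega)
      · simpa [Mem.write_apply] using h40 42 (by omega) (by omega)
      · intro x i
        simpa [Mem.write_apply, Expr.eval] using h7
      refine Sem.seq_pure (t := 1) (t' := 3) (Sem.assign _ _ _ _)
        (Sem.seq_pure (t := 1) (t' := 1) (Sem.assign _ _ _ _) (Sem.assign_eq ?_))
      funext a j
      have := h40 40 (by omega) (by omega)
      simp only [Mem.write_apply, Expr.eval, Function.comp]
      grind
    · funext a j
      simp only [Mem.write_apply]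
      grind

/-- Sample the radii (array `8`) and the selection of boundary vertices (array `9`). -/
def randomProg (K B : ℕ) : Prog :=
  .seq (forLoop 43 (.var 0) (radiusProg K))
    (forLoop 43 (.var 0) (.seq (trialProg (.mulLit B (.var 4)))
      (.seq (.assign 9 (.var 43) (.var 40)) (.assign 40 (.lit 0) (.lit 0)))))

/-- The running time of the random phase. -/
def randomTime (n M s b : ℕ) : ℕ := n * (M * (s * 8 + 16) + 16) + n * (b * 8 + 14) + 7

/-- The memory after the random phase. -/
def randomMem (m : Mem) (n : ℕ) (r κ : ℕ → ℕ) : Mem :=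
  ((m.setArray 8 r).setArray 9 κ).write 43 0 n

theorem sem_randomProg {n : ℕ} {G : SimpleGraph (Fin n)} {k d s : ℕ} {m : Mem} (K B : ℕ)
    (hm : Prepared G k d s m) :
    Sem (randomProg K B) m (randomTime n (K * d) s (B * Nat.size k))
      ((iid (radius s (K * d)) n).bind fun r =>
        (iid (trial (B * Nat.size k)) n).map fun κ => randomMem m n r κ) := by
  have h0 : m 0 0 = n := hm.graph.1
  have h40 : ∀ a, 40 ≤ a → m a 0 = 0 := fun a ha => by rw [hm.zero a (by omega)]
  have h8 : ∀ j, m 8 j = 0 := fun j => by rw [hm.zero 8 (by omega)]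
  have h9 : ∀ j, m 9 j = 0 := fun j => by rw [hm.zero 9 (by omega)]
  rw [randomTime, show n * (K * d * (s * 8 + 16) + 16) + n * (B * Nat.size k * 8 + 14) + 7 =
    (n * (B * Nat.size k * 8 + 11 + 3) + 3) + (n * (K * d * (s * 8 + 16) + 13 + 3) + 3) + 1 by ring]
  refine Sem.seq_bind (f := fun r => (m.setArray 8 r).write 43 0 n) ?_ fun r => ?_
  · refine Sem.forLoop (fun v f => (radius s (K * d)).map fun x => Function.update f v x)
      (fun v f => (m.setArray 8 f).write 43 0 v) (fun _ => 0) ?_ ?_ ?_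
    · funext a j
      simp only [Mem.write_apply, Mem.setArray_apply]
      by_cases h : a = 8
      · subst h; simp [h8]
      · simp [h]
    · intro i f
      exact ⟨by simp [Mem.write_apply],
        by simpa [Mem.write_apply, Mem.setArray_apply, Expr.eval] using h0⟩
    · intro i hi f
      refine ⟨fun f => (m.setArray 8 f).write 43 0 i, ?_,
        fun f => ⟨by simp [Mem.write_apply], ?_⟩⟩
      · rw [PMF.map_comp]
        have := sem_radiusProg (K := K) (s := s) (d := d)
          (m := (m.setArray 8 f).write 43 0 i) ?_ ?_ ?_
        · convert this using 2
          funext x a j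
          simp only [Mem.write_apply, Mem.setArray_apply, Function.update_apply, Function.comp]
          by_cases h : a = 8
          · subst h; by_cases h' : j = i <;> simp [h']
          · simp [h]
        · intro a ha ha'
          have h1 : a ≠ 8 := by omega
          simp [Mem.write_apply, Mem.setArray_apply, ha', h1, h40 a ha]
        · simpa [Mem.write_apply, Mem.setArray_apply] using hm.growth_eq
        · simpa [Mem.write_apply, Mem.setArray_apply] using hm.hazard_eq
      · funext a j
        simp only [Mem.write_apply, Mem.setArray_apply]
        grind
  · refine Sem.forLoop (fun v f => (trial (B * Nat.size k)).map fun x => Function.update f v x)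
      (fun v f => ((m.setArray 8 r).setArray 9 f).write 43 0 v) (fun _ => 0) ?_ ?_ ?_
    · funext a j
      simp only [Mem.write_apply, Mem.setArray_apply]
      by_cases h : a = 9
      · subst h; simp [h9]
      · simp only [h]
        grind
    · intro i f
      exact ⟨by simp [Mem.write_apply],
        by simpa [Mem.write_apply, Mem.setArray_apply, Expr.eval] using h0⟩
    · intro i hi f
      refine ⟨fun f => ((m.setArray 8 r).setArray 9 f).write 43 0 i, ?_,
        fun f => ⟨by simp [Mem.write_apply], ?_⟩⟩
      · rw [PMF.map_comp]
        rw [show B * Nat.size k * 8 + 11 = 3 + (B * Nat.size k * 8 + 7) + 1 by ring]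
        refine Sem.seq_map (sem_trialProg ?_ ?_ ?_) fun b => ?_
        · simpa [Mem.write_apply, Mem.setArray_apply] using h40 41 (by omega)
        · simpa [Mem.write_apply, Mem.setArray_apply] using h40 42 (by omega)
        · intro x i
          simp [Mem.write_apply, Mem.setArray_apply, Expr.eval, Expr.eval_mulLit, hm.size_eq]
        · refine Sem.seq_pure (t := 1) (t' := 1) (Sem.assign _ _ _ _) (Sem.assign_eq ?_)
          have := h40 40 (by omega)
          funext a j
          simp only [Mem.write_apply, Mem.setArray_apply, Function.update_apply, Function.comp,
            Expr.eval]
          by_cases h : a = 9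
          · subst h; by_cases h' : j = i <;> simp [h']
          · simp only [h]
            grind
      · funext a j
        simp only [Mem.write_apply, Mem.setArray_apply]
        grind

/-! ### The whole algorithm -/

/-- The algorithm; `K`, `C` and `B` are constants that depend on the class of graphs. -/
def mainProg (K C B : ℕ) : Prog := .seq (prepProg K C) (.seq (randomProg K B) finishProg)

/-- A bound for the running time of the algorithm. -/
def mainTime (K B W : ℕ) : ℕ :=
  prepTime K W + randomTime W (K * W) (K * W) (B * W) + finishTime W + 2

theorem exists_polynomial_mainTime (K B : ℕ) :
    ∃ p : Polynomial ℕ, ∀ W, p.eval W = mainTime K B W := by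
  let X : Polynomial ℕ := Polynomial.X
  let b : Polynomial ℕ := X * (X * (X * 4 + 13) + 8) + X * 4 + 9
  refine ⟨(X * (X * (b + X * 8 + 18) + 8) + 5 + X * 8 + (K : Polynomial ℕ) * X * 9 + 16) +
    (X * ((K : Polynomial ℕ) * X * ((K : Polynomial ℕ) * X * 8 + 16) + 16) +
      X * ((B : Polynomial ℕ) * X * 8 + 14) + 7) +
    (X * (b + X * 8 + 12) + X * (b + X * 8 + 19) + X * 8 + 16) + 2, fun W => ?_⟩
  simp [X, b, mainTime, prepTime, randomTime, finishTime, growthTime, bfsTime]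

/-- Allows running times to be padded: one number of steps serves all outcomes. -/
theorem halted_run (s : ℕ) (m : Mem) : run s ([], m) = PMF.pure ([], m) := by
  induction s with
  | zero => rfl
  | succ s ih => simp [run, step, PMF.pure_bind, ih]

/-- What the algorithm outputs, with growth parameter `d` and hazard parameter `s`. -/
noncomputable def sample {n : ℕ} (G : SimpleGraph (Fin n)) (K B k d s : ℕ) :
    PMF (Finset (Fin n)) :=
  (iid (radius s (K * d)) n).bind fun r =>
    (iid (trial (B * Nat.size k)) n).map fun κ =>
      if d < n then pruned G (2 ^ s) k r κ else Finset.univ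

theorem mainProg_spec {n : ℕ} (G : SimpleGraph (Fin n)) (K C B k T : ℕ) (hk : 2 ≤ k)
    (hT : mainTime K B (inputSize n k) ≤ T) :
    ∃ d s, GrowthParam G K C k d ∧ HazardParam (Nat.size k) (K * d) s ∧
      HaltsWithin (mainProg K C B) G k T ∧
      outputDist (mainProg K C B) G k T = sample G K B k d s := by
  set W := inputSize n k with hWdef
  have hn : n ≤ W := Nat.le_add_right _ _
  have hkW : Nat.size k ≤ W := Nat.le_add_left _ _
  obtain ⟨t₁, ht₁, m₁, hs₁, d, s, hd, hs, hm⟩ := does_prepProg G K C k W hk hn hkW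
  refine ⟨d, s, hd, hs, ?_⟩
  have hKd : K * d ≤ K * W := Nat.mul_le_mul_left _ (hd.le.trans hn)
  have hfin : ∀ r κ : ℕ → ℕ, ∃ t m', t ≤ finishTime W ∧
      Sem finishProg (randomMem m₁ n r κ) t (PMF.pure m') ∧
      outputSet n m' = if d < n then pruned G (2 ^ s) k r κ else Finset.univ := by
    intro r κ
    obtain ⟨t, ht, m', h1, h2⟩ := does_finishProg (r := r) (κ := κ) hm hn (randomMem m₁ n r κ)
      (by
        intro a h8 h9 h40
        funext j
        have : a ≠ 43 := by omega
        simp [randomMem, Mem.write_apply, Mem.setArray_apply, h8, h9, this])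
      (by
        intro i _
        simp [randomMem, Mem.write_apply, Mem.setArray_apply])
      (by
        intro i _
        simp [randomMem, Mem.write_apply, Mem.setArray_apply])
    exact ⟨t, m', ht, h1, h2⟩
  choose t m' ht hsem hout using hfin
  have htr : randomTime n (K * d) s (B * Nat.size k) ≤ randomTime W (K * W) (K * W) (B * W) := by
    have : s ≤ K * W := hs.le.trans hKd
    unfold randomTime
    gcongr
  have hrun : run T ([mainProg K C B], inputMem G k) =
      (iid (radius s (K * d)) n).bind fun r => (iid (trial (B * Nat.size k)) n).map fun κ =>
        ([], m' r κ) := by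
    obtain ⟨T', rfl⟩ : ∃ T', T = T' + finishTime W + randomTime n (K * d) s (B * Nat.size k) + 1 +
        t₁ + 1 := by
      refine ⟨T - (finishTime W + randomTime n (K * d) s (B * Nat.size k) + 1 + t₁ + 1), ?_⟩
      unfold mainTime at hT
      omega
    unfold mainProg
    simp only [run, step, PMF.pure_bind]
    rw [hs₁, PMF.pure_bind]
    simp only [run, step, PMF.pure_bind]
    rw [sem_randomProg K B hm, PMF.bind_bind]
    refine congrArg _ (funext fun r => ?_)
    rw [PMF.bind_map, PMF.map]
    refine congrArg _ (funext fun κ => ?_)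
    simp only [Function.comp]
    -- The length `t r κ` of the final phase depends on the coins; the rest of its time budget is
    -- spent in the halted state.
    rw [show T' + finishTime W = (T' + (finishTime W - t r κ)) + t r κ by
      have := ht r κ
      omega, hsem, PMF.pure_bind, halted_run]
  constructor
  · intro x hx
    rw [hrun] at hx
    simp only [PMF.mem_support_bind_iff, PMF.mem_support_map_iff] at hx
    obtain ⟨r, -, κ, -, rfl⟩ := hx
    rfl
  · rw [outputDist, hrun, sample, PMF.map_bind]
    refine congrArg _ (funext fun r => ?_)
    rw [PMF.map_comp]
    refine congrArg (fun f => PMF.map f _) (funext fun κ => ?_)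
    exact hout r κ

/-! ### Treedepth bounds -/

section Treedepth

variable {V : Type} {G : SimpleGraph V}

theorem componentIn_subset (S : Finset V) (v : V) : componentIn G S v ⊆ S := by
  classical
  exact Finset.filter_subset _ _

theorem mem_componentIn_self {S : Finset V} {v : V} (hv : v ∈ S) : v ∈ componentIn G S v := by
  classical
  exact Finset.mem_filter.2 ⟨hv, hv, hv, SimpleGraph.Reachable.refl _⟩

/-- All vertices on a path from `v` in `G[S]` are reachable from `v`, so the path stays in the
component and is a path of its induced graph. -/
theorem connected_componentIn {S : Finset V} {v : V} (hv : v ∈ S) :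
    (G.induce (componentIn G S v : Set V)).Connected := by
  classical
  have key : ∀ w : (S : Set V), (G.induce (S : Set V)).Reachable ⟨v, hv⟩ w →
      ∃ hw : w.1 ∈ componentIn G S v, (G.induce (componentIn G S v : Set V)).Reachable
        ⟨v, mem_componentIn_self hv⟩ ⟨w.1, hw⟩ := by
    intro w hw
    rw [SimpleGraph.reachable_iff_reflTransGen] at hw
    induction hw with
    | refl => exact ⟨mem_componentIn_self hv, SimpleGraph.Reachable.refl _⟩
    | @tail a b h hab ih =>
      obtain ⟨ha, hr⟩ := ih
      have hb : b.1 ∈ componentIn G S v := Finset.mem_filter.2 ⟨b.2, hv, b.2,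
        (SimpleGraph.reachable_iff_reflTransGen _ _).2 (h.tail hab)⟩
      refine ⟨hb, hr.trans (SimpleGraph.Adj.reachable ?_)⟩
      exact hab
  have : Nonempty (componentIn G S v : Set V) := ⟨⟨v, mem_componentIn_self hv⟩⟩
  have key' : ∀ w : (componentIn G S v : Set V), (G.induce (componentIn G S v : Set V)).Reachable
      ⟨v, mem_componentIn_self hv⟩ w := by
    rintro ⟨w, hw⟩
    obtain ⟨_, _, hw', hr⟩ := Finset.mem_filter.1 hw
    obtain ⟨_, h⟩ := key ⟨w, hw'⟩ hr
    exact h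
  exact ⟨fun a b => (key' a).symm.trans (key' b)⟩

theorem treedepth_le_succ [DecidableEq V] {S : Finset V} (hc : (G.induce (S : Set V)).Connected)
    {v : V} (hv : v ∈ S) : treedepth G S ≤ 1 + treedepth G (S.erase v) := by
  rw [treedepth, dif_pos ⟨v, hv⟩, dif_pos hc]
  refine Nat.add_le_add_left ?_ _
  refine (Finset.inf'_le _ (Finset.mem_attach S ⟨v, hv⟩)).trans (le_of_eq ?_)
  congr!

theorem treedepth_le_of_components {S : Finset V} {b : ℕ}
    (hc : ¬(G.induce (S : Set V)).Connected)
    (h : ∀ v ∈ S, treedepth G (componentIn G S v) ≤ b) : treedepth G S ≤ b := by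
  rw [treedepth]
  split_ifs with h1
  · exact Finset.sup_le fun v _ => h v.1 v.2
  · exact Nat.zero_le _

/-- Induction on the size of `S`. A connected `S` that meets `D` loses a vertex of `D` at the cost
of one level; a connected `S` that avoids `D` has at most `f` vertices, which bounds its treedepth.
Passing to components does not enlarge `S ∩ D`. -/
theorem treedepth_le_card_inter_add [DecidableEq V] (D : Finset V) (f : ℕ) (S : Finset V)
    (h : ∀ Y ⊆ S, Disjoint Y D → (G.induce (Y : Set V)).Connected → Y.card ≤ f) :
    treedepth G S ≤ (S ∩ D).card + f := by
  induction hn : S.card using Nat.strong_induction_on generalizing S f D with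
  | _ n ih =>
    by_cases hc : (G.induce (S : Set V)).Connected
    · obtain ⟨⟨v, hv⟩⟩ := hc.nonempty
      have hlt : ∀ v ∈ S, (S.erase v).card < n := fun v hv => hn ▸ Finset.card_erase_lt_of_mem hv
      rcases (S ∩ D).eq_empty_or_nonempty with he | ⟨w, hw⟩
      · have hdis : Disjoint S D := Finset.disjoint_iff_inter_eq_empty.2 he
        have h1 := h S subset_rfl hdis hc
        -- The induction hypothesis with `D := S` and `f := 0` says that the treedepth of `S.erase
        -- v` is at most its number of vertices.
        have h2 := ih _ (hlt v hv) S (f := 0) (S.erase v) (fun Y hY hd _ => by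
          have : Y = ∅ := Finset.disjoint_self_iff_empty Y |>.1
            (hd.mono_right (hY.trans (Finset.erase_subset _ _)))
          simp [this]) rfl
        have h3 := treedepth_le_succ hc hv
        rw [Finset.inter_eq_left.2 (Finset.erase_subset _ _), Finset.card_erase_of_mem hv] at h2
        have : 0 < S.card := Finset.card_pos.2 ⟨v, hv⟩
        omega
      · rw [Finset.mem_inter] at hw
        have h2 := ih _ (hlt w hw.1) D f (S.erase w)
          (fun Y hY => h Y (hY.trans (Finset.erase_subset _ _))) rfl
        have h3 := treedepth_le_succ hc hw.1
        have h4 : (S.erase w ∩ D).card < (S ∩ D).card := by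
          rw [Finset.erase_inter]
          exact Finset.card_erase_lt_of_mem (Finset.mem_inter.2 hw)
        omega
    · refine treedepth_le_of_components hc fun v hv => ?_
      refine (ih _ (hn ▸ card_componentIn_lt G S hc v hv) D f _
        (fun Y hY => h Y (hY.trans (componentIn_subset S v))) rfl).trans ?_
      exact Nat.add_le_add_right (Finset.card_le_card
        (Finset.inter_subset_inter_right (componentIn_subset S v))) _

/-- If the connected subgraphs have at most `b` vertices in `D`, and those that avoid `D` have at
most `f` vertices, then the treedepth is at most `b + f`. -/
theorem treedepth_le_add [DecidableEq V] (D : Finset V) (b f : ℕ) (S : Finset V)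
    (hb : ∀ Y ⊆ S, (G.induce (Y : Set V)).Connected → (Y ∩ D).card ≤ b)
    (hf : ∀ Y ⊆ S, Disjoint Y D → (G.induce (Y : Set V)).Connected → Y.card ≤ f) :
    treedepth G S ≤ b + f := by
  by_cases hc : (G.induce (S : Set V)).Connected
  · exact (treedepth_le_card_inter_add D f S hf).trans
      (Nat.add_le_add_right (hb S subset_rfl hc) _)
  · refine treedepth_le_of_components hc fun v hv => ?_
    exact (treedepth_le_card_inter_add D f _
      fun Y hY => hf Y (hY.trans (componentIn_subset S v))).trans
      (Nat.add_le_add_right (hb _ (componentIn_subset S v) (connected_componentIn hv)) _)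

theorem connected_induction {Y : Finset V} (hY : (G.induce (Y : Set V)).Connected) {P : V → Prop}
    {u : V} (hu : u ∈ Y) (h0 : P u)
    (hstep : ∀ a ∈ Y, ∀ b ∈ Y, G.Adj a b → P a → P b) : ∀ w ∈ Y, P w := by
  intro w hw
  have hr := hY.preconnected ⟨u, hu⟩ ⟨w, hw⟩
  rw [SimpleGraph.reachable_iff_reflTransGen] at hr
  have : ∀ x : (Y : Set V), Relation.ReflTransGen (G.induce (Y : Set V)).Adj ⟨u, hu⟩ x → P x.1 := by
    intro x hx
    induction hx with
    | refl => exact h0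
    | @tail a b _ hab ih => exact hstep a.1 a.2 b.1 b.2 hab ih
  exact this _ hr

theorem subset_reach_of_connected [Fintype V] {Y S : Finset V}
    (hY : (G.induce (Y : Set V)).Connected) (hYS : Y ⊆ S) {u : V} (hu : u ∈ Y) :
    Y ⊆ reach G S u (Fintype.card V) := by
  refine connected_induction hY hu self_mem_reach fun a ha b hb hab h => ?_
  -- The search is stationary, so one more round may be used to take the edge from `a` to `b`.
  rw [← reach_card (Nat.le_succ _)]
  exact mem_reach_succ.2 (Or.inr ⟨hYS hb, a, h, hab⟩)

end Treedepth

/-! ### Balls -/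

section Balls

variable {V : Type} [Fintype V] {G : SimpleGraph V} {u v w : V} {i j : ℕ}

/-- `reach` grows at the far end, whereas the induction on a walk adds an edge at the start. -/
theorem reach_cons (h : G.Adj u v) (hw : w ∈ reach G Finset.univ v i) :
    w ∈ reach G Finset.univ u (i + 1) := by
  induction i generalizing w with
  | zero =>
    rw [reach, Finset.mem_singleton] at hw
    exact mem_reach_succ.2 (Or.inr ⟨Finset.mem_univ _, u, self_mem_reach, hw ▸ h⟩)
  | succ i ih =>
    rcases mem_reach_succ.1 hw with h1 | ⟨-, x, h1, h2⟩
    · exact mem_reach_succ.2 (Or.inl (ih h1))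
    · exact mem_reach_succ.2 (Or.inr ⟨Finset.mem_univ _, x, ih h1, h2⟩)

theorem mem_reach_univ : w ∈ reach G Finset.univ v i ↔ G.edist v w ≤ i := by
  constructor
  · intro h
    induction i generalizing w with
    | zero =>
      rw [reach, Finset.mem_singleton] at h
      simp [h]
    | succ i ih =>
      rcases mem_reach_succ.1 h with h1 | ⟨-, x, h1, h2⟩
      · exact (ih h1).trans (by exact_mod_cast Nat.le_succ i)
      · refine (SimpleGraph.edist_triangle (v := x)).trans ?_
        push_cast
        exact add_le_add (ih h1) (by simpa using (h2.toWalk).edist_le)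
  · intro h
    have hne : G.edist v w ≠ ⊤ := ne_top_of_le_ne_top (ENat.natCast_ne_top i) h
    obtain ⟨p, hp⟩ := SimpleGraph.exists_walk_of_edist_ne_top hne
    rw [← hp, Nat.cast_le] at h
    refine reach_mono h ?_
    clear hp hne h
    induction p with
    | nil => exact self_mem_reach
    | cons hadj p ih => exact reach_cons hadj ih

theorem reach_trans (h₁ : v ∈ reach G Finset.univ u i) (h₂ : w ∈ reach G Finset.univ v j) :
    w ∈ reach G Finset.univ u (i + j) := by
  rw [mem_reach_univ] at *
  push_cast
  exact (SimpleGraph.edist_triangle (v := v)).trans (add_le_add h₁ h₂)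

theorem reach_symm (h : v ∈ reach G Finset.univ u i) : u ∈ reach G Finset.univ v i := by
  rw [mem_reach_univ] at *
  rwa [SimpleGraph.edist_comm]

/-- `graphBall` is an open ball, so distance at most `i` corresponds to radius `i + 1`. -/
theorem card_reach_univ : (reach G Finset.univ v i).card = (graphBall G v (i + 1)).ncard := by
  rw [← Set.ncard_coe_finset]
  congr 1
  ext w
  rw [Finset.mem_coe, mem_reach_univ, graphBall, Set.mem_ofPred_eq]
  push_cast
  exact (ENat.lt_natCast_add_one_iff).symm

theorem adj_mem_reach (h : G.Adj u v) : v ∈ reach G Finset.univ u 1 :=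
  mem_reach_succ.2 (Or.inr ⟨Finset.mem_univ _, u, self_mem_reach, h⟩)

end Balls

/-! ### Structure of the carving -/

section Carve

variable {n : ℕ} {G : SimpleGraph (Fin n)} {r r' : ℕ → ℕ}

/-- The first `j` turns use only the first `j` radii; the radius of the next center can therefore be
drawn independently of the current state. -/
theorem carve_congr {j : ℕ} (h : ∀ i < j, r i = r' i) : carve G r j = carve G r' j := by
  induction j with
  | zero => rfl
  | succ j ih => simp only [carve, ih fun i hi => h i (by omega), h j (by omega)]

theorem carve_succ_of_mem {j : ℕ} (hj : j < n) (h : (⟨j, hj⟩ : Fin n) ∈ (carve G r j).1) :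
    carve G r (j + 1) = ((carve G r j).1 \ reach G (carve G r j).1 ⟨j, hj⟩ (r j),
      (carve G r j).2 ∪ sphere G (carve G r j).1 ⟨j, hj⟩ (r j)) := by
  rw [carve, dif_pos ⟨hj, h⟩]

theorem carve_succ_of_not_mem {j : ℕ} (h : ∀ hj : j < n, (⟨j, hj⟩ : Fin n) ∉ (carve G r j).1) :
    carve G r (j + 1) = carve G r j := by
  rw [carve, dif_neg]
  rintro ⟨hj, h'⟩
  exact h hj h'

/-- A vertex that is still present at its turn becomes a center and lies in its own ball, so it is
removed then at the latest. -/
theorem not_mem_carve {j : ℕ} {u : Fin n} (hu : (u : ℕ) < j) : u ∉ (carve G r j).1 := by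
  induction j with
  | zero => omega
  | succ j ih =>
    by_cases h : ∃ hj : j < n, (⟨j, hj⟩ : Fin n) ∈ (carve G r j).1
    · obtain ⟨hj, h⟩ := h
      rw [carve_succ_of_mem hj h, Finset.mem_sdiff]
      rintro ⟨h1, h2⟩
      rcases Nat.lt_succ_iff_lt_or_eq.1 hu with h3 | h3
      · exact ih h3 h1
      · exact h2 (by rw [show u = ⟨j, hj⟩ from Fin.ext h3]; exact self_mem_reach)
    · rw [carve_succ_of_not_mem fun hj h' => h ⟨hj, h'⟩]
      rcases Nat.lt_succ_iff_lt_or_eq.1 hu with h3 | h3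
      · exact ih h3
      · exact fun h' => h ⟨h3 ▸ u.2, by
          rwa [show (⟨j, h3 ▸ u.2⟩ : Fin n) = u from Fin.ext h3.symm]⟩

theorem carve_fst_eq_empty : (carve G r n).1 = ∅ :=
  Finset.eq_empty_of_forall_notMem fun u => not_mem_carve u.2

/-- The center of a vertex is that of the ball which removed it. Neighbours of an inner vertex of a
ball that are still present at that time belong to the ball. So no edge leads from a removed vertex
off the boundary to a remaining vertex; this third property is the invariant that prevents later
balls from creating edges between different centers. -/
theorem exists_center_aux {M : ℕ} (hr : ∀ i < n, r i ≤ M) (j : ℕ) : ∃ c : Fin n → Fin n,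
    (∀ u, u ∉ (carve G r j).1 → u ∉ (carve G r j).2 → u ∈ reach G Finset.univ (c u) M) ∧
    (∀ u w, u ∉ (carve G r j).1 → u ∉ (carve G r j).2 → w ∉ (carve G r j).1 →
      w ∉ (carve G r j).2 → G.Adj u w → c u = c w) ∧
    (∀ u w, u ∉ (carve G r j).1 → u ∉ (carve G r j).2 → w ∈ (carve G r j).1 → ¬G.Adj u w) := by
  classical
  induction j with
  | zero => exact ⟨id, by simp [carve], by simp [carve], by simp [carve]⟩
  | succ j ih =>
    obtain ⟨c, h1, h2, h3⟩ := ih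
    by_cases h : ∃ hj : j < n, (⟨j, hj⟩ : Fin n) ∈ (carve G r j).1
    · obtain ⟨hj, h⟩ := h
      rw [carve_succ_of_mem hj h]
      set U := (carve G r j).1
      set D := (carve G r j).2
      simp only [Finset.mem_sdiff, Finset.mem_union, not_and, not_not, not_or]
      have hinner : ∀ u, u ∈ reach G U ⟨j, hj⟩ (r j) → u ∉ sphere G U ⟨j, hj⟩ (r j) →
          ∃ i, r j = i + 1 ∧ u ∈ reach G U ⟨j, hj⟩ i := by
        intro u hu hs
        -- A ball of radius `0` is its own sphere and has no inner vertices.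
        cases hrj : r j with
        | zero =>
          rw [hrj] at hu hs
          exact absurd hu hs
        | succ i =>
          rw [hrj] at hu hs
          simp only [sphere, Finset.mem_sdiff, not_and, not_not] at hs
          exact ⟨i, rfl, hs hu⟩
      have hnear : ∀ u w, u ∈ reach G U ⟨j, hj⟩ (r j) → u ∉ sphere G U ⟨j, hj⟩ (r j) → w ∈ U →
          G.Adj u w → w ∈ reach G U ⟨j, hj⟩ (r j) := by
        intro u w hu hs hw hadj
        obtain ⟨i, hi, hu'⟩ := hinner u hu hs
        rw [hi]
        exact mem_reach_succ.2 (Or.inr ⟨hw, u, hu', hadj⟩)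
      refine ⟨fun u => if u ∈ U then ⟨j, hj⟩ else c u, ?_, ?_, ?_⟩
      · intro u hu hd
        by_cases huU : u ∈ U
        · simp only [huU, if_true]
          exact reach_mono (hr j hj) (reach_subset_of_subset (Finset.subset_univ _) (hu huU))
        · simp only [huU, if_false]
          exact h1 u huU hd.1
      · intro u w hu hd hw hd' hadj
        by_cases huU : u ∈ U <;> by_cases hwU : w ∈ U
        · simp [huU, hwU]
        · exact absurd hadj.symm (h3 w u hwU hd'.1 huU)
        · exact absurd hadj (h3 u w huU hd.1 hwU)
        · simp only [huU, hwU, if_false]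
          exact h2 u w huU hd.1 hwU hd'.1 hadj
      · intro u w hu hd hw hadj
        by_cases huU : u ∈ U
        · exact hw.2 (hnear u w (hu huU) hd.2 hw.1 hadj)
        · exact h3 u w huU hd.1 hw.1 hadj
    · rw [carve_succ_of_not_mem fun hj h' => h ⟨hj, h'⟩]
      exact ⟨c, h1, h2, h3⟩

/-- Every vertex outside of the boundary has a center, and adjacent ones have the same center. -/
theorem exists_center {M : ℕ} (hr : ∀ i < n, r i ≤ M) : ∃ c : Fin n → Fin n,
    (∀ u, u ∉ boundary G r → u ∈ reach G Finset.univ (c u) M) ∧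
    ∀ u w, u ∉ boundary G r → w ∉ boundary G r → G.Adj u w → c u = c w := by
  obtain ⟨c, h1, h2, -⟩ := exists_center_aux (G := G) hr n
  simp only [carve_fst_eq_empty, Finset.notMem_empty, not_false_eq_true, true_imp_iff] at h1 h2
  exact ⟨c, h1, h2⟩

/-- A connected part of the pruned graph lies in one component of the kept graph, whose boundary
vertices were counted by the pruning. If it avoids the boundary, all its vertices have the same
center and lie in one ball of radius `M`. -/
theorem treedepth_pruned_le {M N k F : ℕ} {κ : ℕ → ℕ} (hr : ∀ i < n, r i ≤ M) (hN : 0 < N)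
    (hF : ∀ v : Fin n, (reach G Finset.univ v M).card ≤ F) :
    treedepth G (pruned G N k r κ) ≤ k / N + F := by
  classical
  obtain ⟨c, h1, h2⟩ := exists_center (G := G) hr
  refine treedepth_le_add (boundary G r) _ _ _ (fun Y hY hc => ?_) fun Y hY hd hc => ?_
  · obtain ⟨⟨u, hu⟩⟩ := hc.nonempty
    have hsub := subset_reach_of_connected hc (hY.trans (Finset.filter_subset _ _)) hu
    rw [Fintype.card_fin] at hsub
    have := (Finset.mem_filter.1 (hY hu)).2
    rw [Nat.le_div_iff_mul_le hN]
    refine le_trans (Nat.mul_le_mul_right _ (Finset.card_le_card ?_)) this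
    intro z hz
    rw [Finset.mem_inter] at hz ⊢
    exact ⟨hz.2, hsub hz.1⟩
  · obtain ⟨⟨u, hu⟩⟩ := hc.nonempty
    have hnot : ∀ w ∈ Y, w ∉ boundary G r := fun w hw => Finset.disjoint_left.1 hd hw
    refine (Finset.card_le_card (t := reach G Finset.univ (c u) M) fun w hw => ?_).trans (hF _)
    have := connected_induction hc (P := fun w => c w = c u) hu rfl
      (fun a ha b hb hab h => (h2 a b (hnot a ha) (hnot b hb) hab).symm.trans h) w hw
    exact this ▸ h1 w (hnot w hw)

open Classical in
/-- The vertices near `X`. -/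
noncomputable def nearby (G : SimpleGraph (Fin n)) (X : Finset (Fin n)) (ρ : ℕ) : Finset (Fin n) :=
  X.biUnion fun x => reach G Finset.univ x ρ

/-- In the kept graph, the component of a vertex of `X` contains no boundary vertices outside `X`:
on leaving `X` it enters vertices with a common center, and the first boundary vertex after these is
either in `X` or so close to `X` that it was not selected. Hence `X ∩ boundary` bounds the count
that the pruning tests. -/
theorem subset_pruned {M N k : ℕ} {κ : ℕ → ℕ} {X : Finset (Fin n)} (hr : ∀ i < n, r i ≤ M)
    (hX : (X ∩ boundary G r).card * N ≤ k)
    (h₁ : ∀ u ∈ X ∩ boundary G r, κ u ≠ 0)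
    (h₂ : ∀ u ∈ nearby G X (2 * M + 2) \ X, κ u = 0) : X ⊆ pruned G N k r κ := by
  classical
  obtain ⟨c, hc1, hc2⟩ := exists_center (G := G) hr
  have hnear : ∀ {x u i}, x ∈ X → i ≤ 2 * M + 2 → u ∈ reach G Finset.univ x i → u ∉ X → κ u = 0 :=
    fun hx hi hu huX => h₂ _ (Finset.mem_sdiff.2
      ⟨Finset.mem_biUnion.2 ⟨_, hx, reach_mono hi hu⟩, huX⟩)
  have hXk : X ⊆ kept G r κ := fun x hx => Finset.mem_filter.2
    ⟨Finset.mem_univ _, fun hb => h₁ x (Finset.mem_inter.2 ⟨hx, hb⟩)⟩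
  intro x hx
  -- Outside `X` the search remembers a vertex `y` within distance `1` of `X` that has the same
  -- center as the current vertex; the distance to `X` thus stays bounded however long the path is.
  have key : ∀ i, ∀ z ∈ reach G (kept G r κ) x i, z ∈ X ∨ (z ∉ boundary G r ∧
      ∃ x' ∈ X, ∃ y, y ∉ boundary G r ∧ c y = c z ∧ y ∈ reach G Finset.univ x' 1) := by
    intro i
    induction i with
    | zero =>
      intro z hz
      rw [reach, Finset.mem_singleton] at hz
      exact Or.inl (hz ▸ hx)
    | succ i ih =>
      intro w hw
      rcases mem_reach_succ.1 hw with hw | ⟨hwk, u, hu, hadj⟩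
      · exact ih w hw
      · by_cases hwX : w ∈ X
        · exact Or.inl hwX
        right
        rcases ih u hu with huX | ⟨hub, x', hx', y, hy, hcy, hyr⟩
        · have hwr := adj_mem_reach hadj
          have hwb : w ∉ boundary G r := fun hb =>
            (Finset.mem_filter.1 hwk).2 hb (hnear huX (by omega) hwr hwX)
          exact ⟨hwb, u, huX, w, hwb, rfl, hwr⟩
        · have hwb : w ∉ boundary G r := by
            intro hb
            -- The way from `X` to `w`: one step to `y`, at most `M` to the common center, at most
            -- `M` to `u`, one step to `w`. This is the radius `2 * M + 2`.
            refine (Finset.mem_filter.1 hwk).2 hb (hnear hx' (i := 1 + M + M + 1) (by omega) ?_ hwX)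
            have h3 := reach_symm (hc1 y hy)
            rw [hcy] at h3
            exact reach_trans (reach_trans (reach_trans hyr h3) (hc1 u hub)) (adj_mem_reach hadj)
          exact ⟨hwb, x', hx', y, hy, hcy.trans (hc2 u w hub hwb hadj), hyr⟩
  refine Finset.mem_filter.2 ⟨hXk hx, le_trans (Nat.mul_le_mul_right _ (Finset.card_le_card ?_)) hX⟩
  intro z hz
  rw [Finset.mem_inter] at hz ⊢
  exact ⟨(key _ z hz.2).resolve_right fun h => h.1 hz.1, hz.1⟩

end Carve

/-! ### Expectations -/

open scoped ENNReal

/-- The expectation of a nonnegative function. -/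
noncomputable def expect {α : Type} (μ : PMF α) (F : α → ℝ≥0∞) : ℝ≥0∞ := ∑' x, μ x * F x

section Expect

variable {α β : Type}

theorem expect_pure (x : α) (F : α → ℝ≥0∞) : expect (PMF.pure x) F = F x := by
  classical
  rw [expect, tsum_eq_single x]
  · simp
  · intro y hy
    simp [hy]

theorem expect_bind (μ : PMF α) (f : α → PMF β) (F : β → ℝ≥0∞) :
    expect (μ.bind f) F = expect μ fun x => expect (f x) F := by
  simp only [expect, PMF.bind_apply, ← ENNReal.tsum_mul_right, ← ENNReal.tsum_mul_left]
  rw [ENNReal.tsum_comm]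
  simp only [mul_assoc]

theorem expect_map (μ : PMF α) (f : α → β) (F : β → ℝ≥0∞) :
    expect (μ.map f) F = expect μ fun x => F (f x) := by
  rw [PMF.map, expect_bind]
  simp only [Function.comp, expect_pure]

theorem expect_mono {μ : PMF α} {F F' : α → ℝ≥0∞} (h : ∀ x ∈ μ.support, F x ≤ F' x) :
    expect μ F ≤ expect μ F' := by
  refine ENNReal.tsum_le_tsum fun x => ?_
  by_cases hx : μ x = 0
  · simp [hx]
  · exact mul_le_mul_right (h x ((PMF.mem_support_iff _ _).2 hx)) _

theorem expect_const (μ : PMF α) (c : ℝ≥0∞) : expect μ (fun _ => c) = c := by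
  rw [expect, ENNReal.tsum_mul_right, PMF.tsum_coe, one_mul]

theorem le_expect {μ : PMF α} {F : α → ℝ≥0∞} {c : ℝ≥0∞} (h : ∀ x ∈ μ.support, c ≤ F x) :
    c ≤ expect μ F :=
  (expect_const μ c).symm.trans_le (expect_mono h)

theorem expect_mul_const (μ : PMF α) (F : α → ℝ≥0∞) (c : ℝ≥0∞) :
    expect μ (fun x => F x * c) = expect μ F * c := by
  simp only [expect, ← mul_assoc, ENNReal.tsum_mul_right]

theorem toOuterMeasure_eq_expect (μ : PMF α) (s : Set α) :
    μ.toOuterMeasure s = expect μ (s.indicator fun _ => 1) := by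
  rw [PMF.toOuterMeasure_apply, expect]
  refine tsum_congr fun x => ?_
  by_cases h : x ∈ s <;> simp [h]

theorem expect_coin (F : Bool → ℝ≥0∞) : expect (PMF.uniformOfFintype Bool) F =
    ENNReal.ofReal (1 / 2) * F true + ENNReal.ofReal (1 / 2) * F false := by
  have : (2 : ℝ≥0∞)⁻¹ = ENNReal.ofReal (1 / 2) := by
    rw [one_div, ENNReal.ofReal_inv_of_pos (by norm_num)]
    norm_num
  rw [expect, tsum_fintype, Fintype.sum_bool, ← this]
  simp only [PMF.uniformOfFintype_apply, Fintype.card_bool, Nat.cast_ofNat]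

/-- If the potential does not decrease in expectation in any step, then the expected final potential
is at least the initial potential. -/
theorem le_expect_chain {κ : ℕ → α → PMF α} (Φ : ℕ → α → ℝ≥0∞) {N : ℕ} {i : ℕ}
    (h : ∀ j < i + N, ∀ x, Φ j x ≤ expect (κ j x) (Φ (j + 1))) (x : α) :
    Φ i x ≤ expect (chain κ i N x) (Φ (i + N)) := by
  induction N generalizing i x with
  | zero => simp [chain, expect_pure]
  | succ N ih =>
    rw [chain, expect_bind]
    refine (h i (by omega) x).trans (expect_mono fun y _ => ?_)
    have := ih (i := i + 1) (fun j hj => h j (by omega)) y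
    rwa [add_assoc, add_comm 1 N] at this

theorem chain_support {κ : ℕ → α → PMF α} (P : ℕ → α → Prop) {N i : ℕ}
    (h : ∀ j x, P j x → ∀ y ∈ (κ j x).support, P (j + 1) y) {x : α} (hx : P i x) :
    ∀ y ∈ (chain κ i N x).support, P (i + N) y := by
  induction N generalizing i x with
  | zero =>
    intro y hy
    rw [chain, PMF.support_pure, Set.mem_singleton_iff] at hy
    exact hy ▸ hx
  | succ N ih =>
    intro y hy
    rw [chain, PMF.mem_support_bind_iff] at hy
    obtain ⟨z, hz, hy⟩ := hy
    have := ih (h i x hx z hz) y hy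
    rwa [add_assoc, add_comm 1 N] at this

end Expect

/-! ### Laws of the random choices -/

/-- The success probability of a trial. -/
noncomputable def trialProb (s : ℕ) : ℝ := (1 / 2) ^ s

theorem trialProb_nonneg (s : ℕ) : 0 ≤ trialProb s := by unfold trialProb; positivity

theorem trialProb_le_one (s : ℕ) : trialProb s ≤ 1 :=
  pow_le_one₀ (by norm_num) (by norm_num)

theorem one_sub_trialProb_nonneg (s : ℕ) : 0 ≤ 1 - trialProb s := sub_nonneg.2 (trialProb_le_one s)

theorem expect_trial (s : ℕ) (F : ℕ → ℝ≥0∞) : expect (trial s) F =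
    ENNReal.ofReal (trialProb s) * F 1 + ENNReal.ofReal (1 - trialProb s) * F 0 := by
  have h0 : ∀ s i, expect (chain (fun _ x => (PMF.uniformOfFintype Bool).map
      fun c => x - (1 - c.toNat)) i s 0) F = F 0 := by
    intro s
    induction s with
    | zero => intro i; simp [chain, expect_pure]
    | succ s ih =>
      intro i
      rw [chain, expect_bind, expect_map, expect_coin]
      simp only [Bool.toNat_true, Bool.toNat_false, Nat.zero_sub, ih, ← add_mul]
      rw [← ENNReal.ofReal_add (by norm_num) (by norm_num)]
      norm_num
  have h1 : ∀ s i, expect (chain (fun _ x => (PMF.uniformOfFintype Bool).map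
      fun c => x - (1 - c.toNat)) i s 1) F =
      ENNReal.ofReal (trialProb s) * F 1 + ENNReal.ofReal (1 - trialProb s) * F 0 := by
    intro s
    induction s with
    | zero => intro i; simp [chain, expect_pure, trialProb]
    | succ s ih =>
      intro i
      rw [chain, expect_bind, expect_map, expect_coin]
      simp only [Bool.toNat_true, Bool.toNat_false, Nat.sub_self, Nat.sub_zero, ih, h0]
      rw [mul_add, ← mul_assoc, ← mul_assoc, ← ENNReal.ofReal_mul (by norm_num),
        ← ENNReal.ofReal_mul (by norm_num), add_assoc, ← add_mul,
        ← ENNReal.ofReal_add (mul_nonneg (by norm_num) (one_sub_trialProb_nonneg s))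
          (by norm_num)]
      congr 3
      · rw [trialProb, trialProb, pow_succ]; ring
      · rw [trialProb, trialProb, pow_succ]; ring_nf
  exact h1 s 0

/-- A truncated geometric law: `i` failures before the first success, and the remaining mass at `M`
when all trials fail. -/
theorem expect_radius (s M : ℕ) (F : ℕ → ℝ≥0∞) : expect (radius s M) F =
    ∑ i ∈ Finset.range M, ENNReal.ofReal (trialProb s * (1 - trialProb s) ^ i) * F i +
      ENNReal.ofReal ((1 - trialProb s) ^ M) * F M := by
  have hp := trialProb_nonneg s
  have hp' := one_sub_trialProb_nonneg s
  -- After the first success the flag is `0` and the counter no longer moves.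
  have h0 : ∀ M i a, expect (chain (fun _ (x : ℕ × ℕ) => (trial s).map
      fun t => (x.1 - t, x.2 + (x.1 - t))) i M (0, a)) (fun x => F x.2) = F a := by
    intro M
    induction M with
    | zero => intro i a; simp [chain, expect_pure]
    | succ M ih =>
      intro i a
      rw [chain, expect_bind, expect_map, expect_trial]
      simp only [Nat.zero_sub, add_zero, ih, ← add_mul]
      rw [← ENNReal.ofReal_add hp hp']
      norm_num
  have h1 : ∀ M i a, expect (chain (fun _ (x : ℕ × ℕ) => (trial s).map
      fun t => (x.1 - t, x.2 + (x.1 - t))) i M (1, a)) (fun x => F x.2) =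
      ∑ i ∈ Finset.range M, ENNReal.ofReal (trialProb s * (1 - trialProb s) ^ i) * F (a + i) +
      ENNReal.ofReal ((1 - trialProb s) ^ M) * F (a + M) := by
    intro M
    induction M with
    | zero => intro i a; simp [chain, expect_pure]
    | succ M ih =>
      intro i a
      rw [chain, expect_bind, expect_map, expect_trial]
      simp only [Nat.sub_self, Nat.sub_zero, ih, h0, add_zero]
      rw [Finset.sum_range_succ', mul_add, Finset.mul_sum, ← mul_assoc, ← ENNReal.ofReal_mul hp']
      have e1 : ∀ i, ENNReal.ofReal (1 - trialProb s) *
          (ENNReal.ofReal (trialProb s * (1 - trialProb s) ^ i) * F (a + 1 + i)) =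
          ENNReal.ofReal (trialProb s * (1 - trialProb s) ^ (i + 1)) * F (a + (i + 1)) := by
        intro i
        rw [← mul_assoc, ← ENNReal.ofReal_mul hp', add_assoc, add_comm 1 i]
        congr 2
        ring
      simp only [e1]
      rw [← pow_succ', add_assoc a 1 M, add_comm 1 M]
      simp only [pow_zero, mul_one, add_zero]
      rw [← add_assoc, add_comm (ENNReal.ofReal (trialProb s) * F a)]
  rw [radius, expect_map, h1]
  simp

theorem radius_support {s M x : ℕ} (hx : x ∈ (radius s M).support) : x ≤ M := by
  rw [radius, PMF.mem_support_map_iff] at hx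
  obtain ⟨y, hy, rfl⟩ := hx
  have := chain_support (fun i (x : ℕ × ℕ) => x.1 ≤ 1 ∧ x.2 ≤ i) (i := 0) ?_ ⟨le_rfl, le_rfl⟩ y hy
  · simpa using this.2
  · rintro j x ⟨h1, h2⟩ z hz
    rw [PMF.mem_support_map_iff] at hz
    obtain ⟨t, -, rfl⟩ := hz
    refine ⟨?_, ?_⟩ <;> simp only <;> omega

theorem iid_support {ν : PMF ℕ} {M n : ℕ} (hν : ∀ x ∈ ν.support, x ≤ M) {f : ℕ → ℕ}
    (hf : f ∈ (iid ν n).support) (i : ℕ) : f i ≤ M := by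
  refine chain_support (fun _ f => ∀ i, f i ≤ M) (i := 0) ?_ (fun _ => Nat.zero_le _) f hf i
  intro j g hg y hy i
  rw [PMF.mem_support_map_iff] at hy
  obtain ⟨x, hx, rfl⟩ := hy
  rw [Function.update_apply]
  split_ifs
  · exact hν x hx
  · exact hg i

/-- A lower bound for the probability that all members of an independent sequence satisfy a
condition. -/
theorem prod_le_expect_iid {ν : PMF ℕ} {n : ℕ} (P : ℕ → ℕ → Prop) (w : ℕ → ℝ≥0∞)
    (hw : ∀ u < n, w u ≤ expect ν ({x | P u x}.indicator fun _ => 1)) :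
    ∏ u ∈ Finset.range n, w u ≤
      expect (iid ν n) ({f | ∀ u < n, P u (f u)}.indicator fun _ => 1) := by
  classical
  have := le_expect_chain (κ := fun v f => ν.map fun x => Function.update f v x)
    -- The potential: the product of the outstanding weights while all conditions have held, and `0`
    -- after a violation.
    (fun v f => if ∀ u < v, P u (f u) then ∏ u ∈ Finset.Ico v n, w u else 0) (i := 0) (N := n)
    ?_ (fun _ => 0)
  · simp only [zero_add, Finset.Ico_self, Finset.prod_empty, not_lt_zero, false_imp_iff,
      implies_true, if_true, ← Finset.range_eq_Ico] at this
    refine this.trans (le_of_eq (congrArg _ (funext fun f => ?_)))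
    by_cases h : ∀ u < n, P u (f u) <;> simp [h, Set.indicator]
  · intro v hv f
    rw [zero_add] at hv
    split_ifs with hf
    · rw [expect_map, Finset.prod_eq_prod_Ico_succ_bot hv]
      refine (mul_le_mul_left (hw v hv) _).trans ?_
      rw [← expect_mul_const]
      refine expect_mono fun x _ => ?_
      by_cases hx : P v x
      · rw [if_pos, Set.indicator_of_mem (by exact hx), one_mul]
        intro u hu
        rcases Nat.lt_succ_iff_lt_or_eq.1 hu with h | rfl
        · rw [Function.update_of_ne h.ne]
          exact hf u h
        · simpa using hx
      · rw [Set.indicator_of_notMem (by exact hx), zero_mul]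
        exact zero_le
    · exact zero_le

/-! ### Region growing -/

section Growing

variable (x : ℕ → ℕ) (N : ℕ)

/-- The `i`-th term is at most the `N`-th part of the sum of the previous ones. -/
def LightAt (i : ℕ) : Prop := x i * N ≤ ∑ j ∈ Finset.range i, x j

instance : DecidablePred (LightAt x N) := fun _ => inferInstanceAs (Decidable (_ ≤ _))

/-- A heavy index has `x i ≠ 0`, so every index is either light or paid for by its own term. -/
theorem le_count_light_add_sum (i : ℕ) :
    i ≤ Nat.count (LightAt x N) i + ∑ j ∈ Finset.range i, x j := by
  induction i with
  | zero => simp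
  | succ i ih =>
    rw [Nat.count_succ, Finset.sum_range_succ]
    split_ifs with h
    · omega
    · have : x i ≠ 0 := by
        intro h0
        apply h
        unfold LightAt
        rw [h0, zero_mul]
        exact Nat.zero_le _
      omega

/-- A telescoping sum: each light index turns one power of `1 - p` into the next. It is the
probability of stopping when hazard is present at light indices only. -/
theorem sum_light (p : ℝ) (M : ℕ) :
    ∑ i ∈ Finset.range M, (if LightAt x N i then p * (1 - p) ^ Nat.count (LightAt x N) i else 0) =
      1 - (1 - p) ^ Nat.count (LightAt x N) M := by
  induction M with
  | zero => simp
  | succ M ih =>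
    rw [Finset.sum_range_succ, ih, Nat.count_succ]
    split_ifs with h
    · rw [pow_succ]; ring
    · simp

/-- Region growing: each heavy index multiplies one plus the partial sum by at least `1 + 1 / N`.
Because the terms are integers, `x i * N` exceeds the partial sum by at least `1`, and this also
covers the start from `0`. -/
theorem pow_heavy_le (hN : 0 < N) (M : ℕ) :
    (1 + 1 / (N : ℝ)) ^ (M - Nat.count (LightAt x N) M) ≤
      1 + ((∑ j ∈ Finset.range M, x j : ℕ) : ℝ) := by
  have hN' : (0 : ℝ) < N := by exact_mod_cast hN
  induction M with
  | zero => simp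
  | succ M ih =>
    have hle := Nat.count_le (p := LightAt x N) (n := M)
    rw [Nat.count_succ, Finset.sum_range_succ]
    split_ifs with h
    · rw [Nat.add_sub_add_right]
      push_cast at ih ⊢
      have : (0 : ℝ) ≤ x M := Nat.cast_nonneg _
      linarith
    · rw [add_zero, Nat.sub_add_comm hle, pow_succ]
      have h1 : ((∑ j ∈ Finset.range M, x j : ℕ) : ℝ) + 1 ≤ x M * N := by
        unfold LightAt at h
        exact_mod_cast Nat.succ_le_of_lt (not_le.1 h)
      have h2 : (((∑ j ∈ Finset.range M, x j : ℕ) : ℝ) + 1) / N ≤ x M := by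
        rw [div_le_iff₀ hN']
        exact h1
      have h3 : (0 : ℝ) ≤ 1 + 1 / (N : ℝ) := by positivity
      refine (mul_le_mul_of_nonneg_right ih h3).trans ?_
      push_cast at h2 ⊢
      have : (1 + ∑ j ∈ Finset.range M, (x j : ℝ)) * (1 + 1 / (N : ℝ)) =
        1 + ∑ j ∈ Finset.range M, (x j : ℝ) + (∑ j ∈ Finset.range M, (x j : ℝ) + 1) / N := by ring
      linarith

/-- By Bernoulli's inequality `N` heavy indices double one plus the sum, so a sum below `2 ^ L`
leaves room for at most `N * L` heavy indices. -/
theorem heavy_le {L M : ℕ} (hN : 0 < N) (hx : ∑ j ∈ Finset.range M, x j < 2 ^ L) :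
    M ≤ N * L + Nat.count (LightAt x N) M := by
  by_contra hlt
  have hN' : (0 : ℝ) < N := by exact_mod_cast hN
  have h1 := pow_heavy_le x N hN M
  have h2 : (2 : ℝ) ≤ (1 + 1 / (N : ℝ)) ^ N := by
    have := one_add_mul_le_pow (a := 1 / (N : ℝ)) (by
      have : 0 ≤ 1 / (N : ℝ) := by positivity
      linarith) N
    have h3 : (N : ℝ) * (1 / N) = 1 := by field_simp
    linarith
  have h3 : 1 < 1 + 1 / (N : ℝ) := by
    have : 0 < 1 / (N : ℝ) := by positivity
    linarith
  have h4 : (1 + 1 / (N : ℝ)) ^ (N * L) < (1 + 1 / (N : ℝ)) ^ (M - Nat.count (LightAt x N) M) :=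
    pow_lt_pow_right₀ h3 (by omega)
  have h5 : (2 : ℝ) ^ L ≤ (1 + 1 / (N : ℝ)) ^ (N * L) := by
    rw [pow_mul]
    exact pow_le_pow_left₀ (by norm_num) h2 L
  have h6 : 1 + ((∑ j ∈ Finset.range M, x j : ℕ) : ℝ) ≤ 2 ^ L := by
    have : 1 + ∑ j ∈ Finset.range M, x j ≤ 2 ^ L := by omega
    exact_mod_cast this
  linarith

theorem one_sub_inv_pow_le (hN : 0 < N) : (1 - 1 / (N : ℝ)) ^ N ≤ 1 / 2 := by
  have hN' : (1 : ℝ) ≤ N := by exact_mod_cast hN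
  have h1 : 0 ≤ 1 - 1 / (N : ℝ) := by
    rw [sub_nonneg, div_le_one (by linarith)]
    exact hN'
  have h2 : (1 - 1 / (N : ℝ)) ^ N ≤ (Real.exp (-(1 / (N : ℝ)))) ^ N :=
    pow_le_pow_left₀ h1 (Real.one_sub_le_exp_neg _) N
  rw [← Real.exp_nat_mul] at h2
  have h3 : (N : ℝ) * -(1 / (N : ℝ)) = -1 := by field_simp
  rw [h3] at h2
  refine h2.trans ?_
  rw [Real.exp_neg, one_div]
  exact inv_anti₀ (by norm_num) (by have := Real.add_one_le_exp 1; linarith)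

/-- Stopping at a light `i` has probability `p * (1 - p) ^ i`, where the exponent also counts the
heavy indices below `i`. Their number is at most the sum of the earlier terms, and the factor for
the remaining `a` minus the removed elements repays exactly that. What is left is the telescoping
sum over light indices, of which there are at least `2 * L * N`. -/
theorem light_expectation {L M a : ℕ} (hN : 0 < N) (hM : 3 * L * N ≤ M)
    (ha : ∑ j ∈ Finset.range M, x j ≤ a) (haL : a < 2 ^ L) :
    (1 - (1 / 2) ^ (2 * L)) * (1 - 1 / (N : ℝ)) ^ a ≤
      ∑ i ∈ Finset.range M, 1 / (N : ℝ) * (1 - 1 / (N : ℝ)) ^ i *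
        (if LightAt x N i then (1 - 1 / (N : ℝ)) ^ (a - ∑ j ∈ Finset.range (i + 1), x j) else 0) := by
  have hN' : (1 : ℝ) ≤ N := by exact_mod_cast hN
  set p := 1 / (N : ℝ) with hp
  have hp0 : 0 ≤ p := by positivity
  have hp1 : 0 ≤ 1 - p := by
    rw [sub_nonneg, hp, div_le_one (by linarith)]
    exact hN'
  have hp2 : 1 - p ≤ 1 := by linarith
  have h1 := sum_light x N p M
  have h2 : (1 - p) ^ Nat.count (LightAt x N) M ≤ (1 / 2) ^ (2 * L) := by
    have h3 := heavy_le x N hN (ha.trans_lt haL)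
    have h4 : N * (2 * L) ≤ Nat.count (LightAt x N) M := by nlinarith
    calc (1 - p) ^ Nat.count (LightAt x N) M ≤ (1 - p) ^ (N * (2 * L)) :=
          pow_le_pow_of_le_one hp1 hp2 h4
      _ = ((1 - p) ^ N) ^ (2 * L) := by rw [pow_mul]
      _ ≤ (1 / 2) ^ (2 * L) := pow_le_pow_left₀ (by positivity) (one_sub_inv_pow_le N hN) _
  calc (1 - (1 / 2) ^ (2 * L)) * (1 - p) ^ a
      ≤ (1 - (1 - p) ^ Nat.count (LightAt x N) M) * (1 - p) ^ a := by gcongr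
    _ = _ := by rw [← h1, Finset.sum_mul]
    _ ≤ _ := Finset.sum_le_sum fun i hi => ?_
  split_ifs with h
  · rw [mul_assoc, mul_assoc, ← pow_add, ← pow_add]
    -- It remains to compare exponents: `i` plus what remains of `a` is at most the number of light
    -- indices below `i` plus `a`.
    refine mul_le_mul_of_nonneg_left (pow_le_pow_of_le_one hp1 hp2 ?_) hp0
    have h5 := le_count_light_add_sum x N i
    have h6 : ∑ j ∈ Finset.range (i + 1), x j ≤ ∑ j ∈ Finset.range M, x j :=
      Finset.sum_le_sum_of_subset (Finset.range_subset_range.2 (by simpa using hi))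
    rw [Finset.sum_range_succ] at h6 ⊢
    omega
  · simp

end Growing

/-! ### The success probability -/

section Success

variable {n : ℕ} {G : SimpleGraph (Fin n)} {X : Finset (Fin n)}

theorem card_inter_reach {S : Finset (Fin n)} {v : Fin n} (i : ℕ) :
    (X ∩ reach G S v i).card = ∑ j ∈ Finset.range (i + 1), (X ∩ sphere G S v j).card := by
  induction i with
  | zero => simp [reach, sphere]
  | succ i ih =>
    rw [Finset.sum_range_succ, ← ih, ← Finset.card_union_of_disjoint]
    · congr 1
      ext u
      have := reach_mono (G := G) (S := S) (v := v) (Nat.le_succ i) (x := u)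
      simp only [Finset.mem_inter, Finset.mem_union, sphere, Finset.mem_sdiff]
      tauto
    · rw [Finset.disjoint_left]
      intro u hu hu'
      simp only [Finset.mem_inter, sphere, Finset.mem_sdiff] at hu hu'
      exact hu'.2.2 hu.2

open Classical in
/-- The centers from `v` on whose balls of radius `M` meet `X`. -/
noncomputable def relevantFrom (G : SimpleGraph (Fin n)) (X : Finset (Fin n)) (M v : ℕ) :
    Finset (Fin n) :=
  Finset.univ.filter fun u => v ≤ u ∧ (X ∩ reach G Finset.univ u M).Nonempty

/-- The potential of the carving after `v` centers. -/
noncomputable def carvePotential (G : SimpleGraph (Fin n)) (X : Finset (Fin n)) (L M s v : ℕ)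
    (f : ℕ → ℕ) : ℝ≥0∞ :=
  if (X ∩ (carve G f v).2).card * 2 ^ s ≤ (X \ (carve G f v).1).card then
    ENNReal.ofReal ((1 - (1 / 2) ^ (2 * L)) ^ (relevantFrom G X M v).card *
      (1 - trialProb s) ^ (X ∩ (carve G f v).1).card)
  else 0

theorem one_sub_half_pow_nonneg (j : ℕ) : (0 : ℝ) ≤ 1 - (1 / 2) ^ j :=
  sub_nonneg.2 (pow_le_one₀ (by norm_num) (by norm_num))

theorem one_sub_half_pow_le_one (j : ℕ) : (1 : ℝ) - (1 / 2) ^ j ≤ 1 :=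
  sub_le_self _ (by positivity)

/-- For turns that remove nothing from `X`, because the center is gone or its ball misses `X`: fewer
relevant centers remain, so the potential does not drop. -/
theorem carvePotential_le_of_le {L M s v w : ℕ} {f g : ℕ → ℕ} (hvw : v ≤ w)
    (h1 : X ∩ (carve G g w).1 = X ∩ (carve G f v).1)
    (h2 : (X ∩ (carve G g w).2).card ≤ (X ∩ (carve G f v).2).card) :
    carvePotential G X L M s v f ≤ carvePotential G X L M s w g := by
  unfold carvePotential
  have h3 : X \ (carve G g w).1 = X \ (carve G f v).1 := by
    rw [← Finset.sdiff_inter_self_left, h1, Finset.sdiff_inter_self_left]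
  split_ifs with h4 h5
  · refine ENNReal.ofReal_le_ofReal ?_
    rw [h1]
    refine mul_le_mul_of_nonneg_right (pow_le_pow_of_le_one (one_sub_half_pow_nonneg _)
      (one_sub_half_pow_le_one _) (Finset.card_le_card fun u hu => ?_))
      (pow_nonneg (one_sub_trialProb_nonneg s) _)
    simp only [relevantFrom, Finset.mem_filter, Finset.mem_univ, true_and] at hu ⊢
    exact ⟨hvw.trans hu.1, hu.2⟩
  · refine absurd ?_ h5
    rw [h3]
    exact (Nat.mul_le_mul_right _ h2).trans h4
  · exact zero_le
  · exact zero_le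

theorem trialProb_eq (s : ℕ) : trialProb s = 1 / ((2 ^ s : ℕ) : ℝ) := by
  rw [trialProb, one_div_pow]
  push_cast
  rfl

/-- Only light radii are counted; they preserve the condition on the boundary. The loss from having
no light stop is one factor `1 - (1 / 2) ^ (2 * L)`, which the departure of `v` from the relevant
centers provides. The loss from skipping heavy radii is compensated by the vertices of `X` that the
ball removes. -/
theorem carvePotential_step {L M s : ℕ} (hM : 3 * L * 2 ^ s ≤ M) (hX : X.card < 2 ^ L) {v : ℕ}
    (hv : v < n) (f : ℕ → ℕ) :
    carvePotential G X L M s v f ≤ expect ((radius s M).map fun x => Function.update f v x)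
      (carvePotential G X L M s (v + 1)) := by
  classical
  rw [expect_map]
  have hcv : ∀ x, carve G (Function.update f v x) v = carve G f v := fun x =>
    carve_congr fun i hi => Function.update_of_ne hi.ne _ _
  by_cases hvU : (⟨v, hv⟩ : Fin n) ∈ (carve G f v).1
  swap
  · refine le_expect fun x _ => ?_
    have : carve G (Function.update f v x) (v + 1) = carve G f v := by
      rw [carve_succ_of_not_mem fun hj => by rw [hcv]; exact hvU, hcv]
    exact carvePotential_le_of_le (Nat.le_succ v) (by rw [this]) (by rw [this])
  have hcs : ∀ x, carve G (Function.update f v x) (v + 1) =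
      ((carve G f v).1 \ reach G (carve G f v).1 ⟨v, hv⟩ x,
        (carve G f v).2 ∪ sphere G (carve G f v).1 ⟨v, hv⟩ x) := by
    intro x
    rw [carve_succ_of_mem hv (by rw [hcv]; exact hvU), hcv, Function.update_self]
  by_cases hrel : (X ∩ reach G Finset.univ (⟨v, hv⟩ : Fin n) M).Nonempty
  swap
  · refine le_expect fun x hx => ?_
    have hd : ∀ u ∈ X, u ∉ reach G (carve G f v).1 ⟨v, hv⟩ x := fun u hu hr =>
      hrel ⟨u, Finset.mem_inter.2 ⟨hu, reach_mono (radius_support hx)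
        (reach_subset_of_subset (Finset.subset_univ _) hr)⟩⟩
    refine carvePotential_le_of_le (Nat.le_succ v) ?_ (Finset.card_le_card ?_)
    · rw [hcs]
      ext u
      have := hd u
      simp only [Finset.mem_inter, Finset.mem_sdiff]
      tauto
    · rw [hcs]
      intro u
      have := hd u
      have h2 := sphere_subset_reach (G := G) (S := (carve G f v).1) (v := ⟨v, hv⟩) (i := x) (x := u)
      simp only [Finset.mem_inter, Finset.mem_union]
      tauto
  rw [expect_radius]
  -- The outcome in which all trials fail is given up.
  refine le_trans ?_ le_self_add
  by_cases hgood : (X ∩ (carve G f v).2).card * 2 ^ s ≤ (X \ (carve G f v).1).card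
  swap
  · rw [carvePotential, if_neg hgood]
    exact zero_le
  set U := (carve G f v).1 with hU
  set D := (carve G f v).2 with hD
  set ε : ℝ := (1 / 2) ^ (2 * L) with hε
  set x : ℕ → ℕ := fun i => (X ∩ sphere G U ⟨v, hv⟩ i).card with hx
  set a := (X ∩ U).card with ha
  set ρ := (relevantFrom G X M (v + 1)).card with hρ
  have hrelv : (relevantFrom G X M v).card = ρ + 1 := by
    have : relevantFrom G X M v = insert (⟨v, hv⟩ : Fin n) (relevantFrom G X M (v + 1)) := by
      ext u
      simp only [relevantFrom, Finset.mem_filter, Finset.mem_univ, true_and, Finset.mem_insert]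
      constructor
      · rintro ⟨h1, h2⟩
        rcases Nat.eq_or_lt_of_le h1 with h | h
        · exact Or.inl (Fin.ext h.symm)
        · exact Or.inr ⟨h, h2⟩
      · rintro (rfl | ⟨h1, h2⟩)
        · exact ⟨le_rfl, hrel⟩
        · exact ⟨by omega, h2⟩
    rw [this, Finset.card_insert_of_notMem]
    simp [relevantFrom]
  have hsub : ∀ i, X ∩ reach G U ⟨v, hv⟩ i ⊆ X ∩ U := fun i =>
    Finset.inter_subset_inter_left (reach_subset hvU)
  have hsum : ∀ i, ∑ j ∈ Finset.range i, x j ≤ a := by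
    intro i
    refine le_trans ?_ (Finset.card_le_card (hsub i))
    rw [card_inter_reach]
    exact Finset.sum_le_sum_of_subset (Finset.range_subset_range.2 (Nat.le_succ i))
  have hlight := light_expectation x (2 ^ s) (by positivity) hM (hsum M)
    ((Finset.card_le_card Finset.inter_subset_left).trans_lt hX)
  rw [← trialProb_eq] at hlight
  -- At a light radius the new boundary vertices in `X`, times `2 ^ s`, are at most the vertices of
  -- `X` in the earlier spheres, and the whole ball is added to `X \ U`; so the condition survives.
  have hterm : ∀ i, ENNReal.ofReal ((1 - ε) ^ ρ * (if LightAt x (2 ^ s) i then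
      (1 - trialProb s) ^ (a - ∑ j ∈ Finset.range (i + 1), x j) else 0)) ≤
      carvePotential G X L M s (v + 1) (Function.update f v i) := by
    intro i
    split_ifs with hl
    · have hR : (X ∩ reach G U ⟨v, hv⟩ i).card = ∑ j ∈ Finset.range (i + 1), x j :=
        card_inter_reach i
      have e1 : (X ∩ (U \ reach G U ⟨v, hv⟩ i)).card = a - ∑ j ∈ Finset.range (i + 1), x j := by
        rw [← hR, ha, ← Finset.card_sdiff_of_subset (hsub i)]
        congr 1
        ext u
        simp only [Finset.mem_inter, Finset.mem_sdiff]
        tauto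
      have e2 : (X \ U).card + (X ∩ reach G U ⟨v, hv⟩ i).card =
          (X \ (U \ reach G U ⟨v, hv⟩ i)).card := by
        rw [← Finset.card_union_of_disjoint]
        · congr 1
          ext u
          have := reach_subset hvU (G := G) (i := i) (x := u)
          simp only [Finset.mem_inter, Finset.mem_sdiff, Finset.mem_union]
          tauto
        · rw [Finset.disjoint_left]
          intro u hu hu'
          simp only [Finset.mem_inter, Finset.mem_sdiff] at hu hu'
          exact hu.2 (reach_subset hvU hu'.2)
      have e3 : (X ∩ (D ∪ sphere G U ⟨v, hv⟩ i)).card ≤ (X ∩ D).card + x i := by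
        rw [Finset.inter_union_distrib_left]
        exact Finset.card_union_le _ _
      rw [carvePotential, hcs, if_pos]
      · rw [e1]
      · rw [← e2, hR]
        unfold LightAt at hl
        have := Nat.mul_le_mul_right (2 ^ s) e3
        rw [Finset.sum_range_succ]
        rw [add_mul] at this
        simp only
        omega
    · simp
  rw [carvePotential, if_pos hgood, hrelv]
  calc ENNReal.ofReal ((1 - ε) ^ (ρ + 1) * (1 - trialProb s) ^ a)
      = ENNReal.ofReal ((1 - ε) ^ ρ * ((1 - ε) * (1 - trialProb s) ^ a)) := by
        congr 1
        ring
    _ ≤ ENNReal.ofReal ((1 - ε) ^ ρ * ∑ i ∈ Finset.range M, trialProb s * (1 - trialProb s) ^ i *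
        (if LightAt x (2 ^ s) i then
          (1 - trialProb s) ^ (a - ∑ j ∈ Finset.range (i + 1), x j) else 0)) := by
        refine ENNReal.ofReal_le_ofReal (mul_le_mul_of_nonneg_left hlight
          (pow_nonneg (one_sub_half_pow_nonneg _) _))
    _ = ∑ i ∈ Finset.range M, ENNReal.ofReal (trialProb s * (1 - trialProb s) ^ i) *
        ENNReal.ofReal ((1 - ε) ^ ρ * (if LightAt x (2 ^ s) i then
          (1 - trialProb s) ^ (a - ∑ j ∈ Finset.range (i + 1), x j) else 0)) := by
        rw [Finset.mul_sum, ENNReal.ofReal_sum_of_nonneg]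
        · refine Finset.sum_congr rfl fun i _ => ?_
          rw [← ENNReal.ofReal_mul (mul_nonneg (trialProb_nonneg s)
            (pow_nonneg (one_sub_trialProb_nonneg s) _))]
          congr 1
          ring
        · intro i _
          refine mul_nonneg (pow_nonneg (one_sub_half_pow_nonneg _) _) (mul_nonneg
            (mul_nonneg (trialProb_nonneg s) (pow_nonneg (one_sub_trialProb_nonneg s) _)) ?_)
          split_ifs
          · exact pow_nonneg (one_sub_trialProb_nonneg s) _
          · exact le_rfl
    _ ≤ _ := Finset.sum_le_sum fun i _ => mul_le_mul_right (hterm i) _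

/-- At the start the boundary is empty and the condition is trivial. At the end no vertex remains,
so the condition is the desired event, and the potential is at most its indicator. -/
theorem le_expect_carve {L M s : ℕ} (hM : 3 * L * 2 ^ s ≤ M) (hX : X.card < 2 ^ L) :
    ENNReal.ofReal ((1 - (1 / 2) ^ (2 * L)) ^ (relevantFrom G X M 0).card *
      (1 - trialProb s) ^ X.card) ≤
    expect (iid (radius s M) n)
      ({r | (X ∩ boundary G r).card * 2 ^ s ≤ X.card}.indicator fun _ => 1) := by
  have := le_expect_chain (κ := fun v f => (radius s M).map fun x => Function.update f v x)
    (carvePotential G X L M s) (i := 0) (N := n)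
    (fun v hv f => carvePotential_step hM hX (by omega) f) (fun _ => 0)
  refine le_trans (le_of_eq ?_) (this.trans (expect_mono fun r _ => ?_))
  · simp [carvePotential, carve]
  · rw [zero_add, carvePotential, carve_fst_eq_empty]
    split_ifs with h
    · rw [Set.indicator_of_mem (by simpa [boundary] using h)]
      refine (ENNReal.ofReal_le_ofReal ?_).trans_eq ENNReal.ofReal_one
      refine mul_le_one₀ (pow_le_one₀ (one_sub_half_pow_nonneg _) (one_sub_half_pow_le_one _))
        (pow_nonneg (one_sub_trialProb_nonneg s) _) ?_
      simp
    · exact zero_le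

theorem le_expect_select {Z : Finset (Fin n)} {Y : Finset (Fin n)} (hYZ : Disjoint Y Z) (b : ℕ) :
    ENNReal.ofReal (trialProb b ^ Y.card * (1 - trialProb b) ^ Z.card) ≤
      expect (iid (trial b) n) ({κ | (∀ u ∈ Y, κ (u : ℕ) ≠ 0) ∧ ∀ u ∈ Z, κ (u : ℕ) = 0}.indicator
        fun _ => 1) := by
  classical
  have hq := trialProb_nonneg b
  have hq' := one_sub_trialProb_nonneg b
  have h := prod_le_expect_iid (ν := trial b) (n := n)
    (fun u x => ∀ hu : u < n, ((⟨u, hu⟩ : Fin n) ∈ Y → x ≠ 0) ∧ ((⟨u, hu⟩ : Fin n) ∈ Z → x = 0))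
    -- Vertices outside `Y` and `Z` are unconstrained and get weight `1`, so the bound does not
    -- depend on `n`.
    (fun u => if hu : u < n then (if (⟨u, hu⟩ : Fin n) ∈ Y then ENNReal.ofReal (trialProb b) else 1) *
      (if (⟨u, hu⟩ : Fin n) ∈ Z then ENNReal.ofReal (1 - trialProb b) else 1) else 1) ?_
  · rw [Finset.prod_range] at h
    simp only [Fin.is_lt, dif_pos, Fin.eta, Finset.prod_mul_distrib, Finset.prod_ite_mem,
      Finset.univ_inter, Finset.prod_const] at h
    rw [ENNReal.ofReal_mul (pow_nonneg hq _), ENNReal.ofReal_pow hq, ENNReal.ofReal_pow hq']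
    refine h.trans (expect_mono fun κ _ => Set.indicator_le_indicator_of_subset ?_ (by simp) κ)
    intro κ hκ
    exact ⟨fun u hu => (hκ u u.2 u.2).1 hu, fun u hu => (hκ u u.2 u.2).2 hu⟩
  · intro u hu
    rw [dif_pos hu, expect_trial]
    have hone : ENNReal.ofReal (trialProb b) + ENNReal.ofReal (1 - trialProb b) = 1 := by
      rw [← ENNReal.ofReal_add hq hq']
      simp
    by_cases h1 : (⟨u, hu⟩ : Fin n) ∈ Y
    · have h2 : (⟨u, hu⟩ : Fin n) ∉ Z := Finset.disjoint_left.1 hYZ h1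
      simp [h1, h2, hu, Set.indicator]
    · by_cases h2 : (⟨u, hu⟩ : Fin n) ∈ Z
      · simp [h1, h2, hu, Set.indicator]
      · simp [h1, h2, hu, Set.indicator, hone]

/-- The probability that the output contains a given set. -/
theorem le_sample {K B k d s : ℕ} (hM : 3 * Nat.size k * 2 ^ s ≤ K * d) (hX : X.card ≤ k) :
    ENNReal.ofReal (((1 - (1 / 2) ^ (2 * Nat.size k)) ^ (nearby G X (K * d)).card *
      (1 - trialProb s) ^ k) * (trialProb (B * Nat.size k) ^ (k / 2 ^ s) *
        (1 - trialProb (B * Nat.size k)) ^ (nearby G X (2 * (K * d) + 2)).card)) ≤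
      (sample G K B k d s).toOuterMeasure {A | X ⊆ A} := by
  classical
  set M := K * d with hMdef
  set L := Nat.size k with hL
  set b := B * L with hb
  have hp' := one_sub_trialProb_nonneg s
  have hq := trialProb_nonneg b
  have hq' := one_sub_trialProb_nonneg b
  have hrel : relevantFrom G X M 0 ⊆ nearby G X M := by
    intro u hu
    simp only [relevantFrom, Finset.mem_filter] at hu
    obtain ⟨x, hx⟩ := hu.2.2
    rw [Finset.mem_inter] at hx
    exact Finset.mem_biUnion.2 ⟨x, hx.1, reach_symm hx.2⟩
  have h1 := le_expect_carve (G := G) (X := X) hM (hX.trans_lt (Nat.lt_size_self k))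
  rw [toOuterMeasure_eq_expect, sample, expect_bind]
  rw [ENNReal.ofReal_mul (mul_nonneg (pow_nonneg (one_sub_half_pow_nonneg _) _)
    (pow_nonneg hp' _))]
  have h2 : ENNReal.ofReal ((1 - (1 / 2) ^ (2 * L)) ^ (nearby G X M).card *
      (1 - trialProb s) ^ k) ≤ expect (iid (radius s M) n)
      ({r | (X ∩ boundary G r).card * 2 ^ s ≤ X.card}.indicator fun _ => 1) := by
    refine le_trans (ENNReal.ofReal_le_ofReal ?_) h1
    refine mul_le_mul (pow_le_pow_of_le_one (one_sub_half_pow_nonneg _)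
      (one_sub_half_pow_le_one _) (Finset.card_le_card hrel)) (pow_le_pow_of_le_one hp'
      (sub_le_self _ (trialProb_nonneg s)) hX) (pow_nonneg hp' _)
      (pow_nonneg (one_sub_half_pow_nonneg _) _)
  refine (mul_le_mul_left h2 _).trans ?_
  rw [← expect_mul_const]
  refine expect_mono fun r hr => ?_
  by_cases hgood : (X ∩ boundary G r).card * 2 ^ s ≤ X.card
  swap
  · rw [Set.indicator_of_notMem (by exact hgood), zero_mul]
    exact zero_le
  rw [Set.indicator_of_mem (by exact hgood), one_mul, expect_map]
  have h3 := le_expect_select (Y := X ∩ boundary G r) (Z := nearby G X (2 * M + 2) \ X)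
    (Finset.disjoint_left.2 fun u hu hu' =>
      (Finset.mem_sdiff.1 hu').2 (Finset.mem_inter.1 hu).1) b
  refine le_trans (ENNReal.ofReal_le_ofReal ?_) (h3.trans (expect_mono fun κ _ => ?_))
  · refine mul_le_mul (pow_le_pow_of_le_one hq (trialProb_le_one b) ?_)
      (pow_le_pow_of_le_one hq' (sub_le_self _ hq) (Finset.card_le_card Finset.sdiff_subset))
      (pow_nonneg hq' _) (pow_nonneg hq _)
    rw [Nat.le_div_iff_mul_le (by positivity)]
    exact hgood.trans hX
  · by_cases hκ : (∀ u ∈ X ∩ boundary G r, κ (u : ℕ) ≠ 0) ∧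
        ∀ u ∈ nearby G X (2 * M + 2) \ X, κ (u : ℕ) = 0
    · rw [Set.indicator_of_mem (by exact hκ), Set.indicator_of_mem]
      show X ⊆ _
      split_ifs
      · exact subset_pruned (fun i _ => iid_support (fun x hx => radius_support hx) hr i)
          (hgood.trans hX) hκ.1 hκ.2
      · exact Finset.subset_univ X
    · rw [Set.indicator_of_notMem (by exact hκ)]
      exact zero_le

end Success

/-! ### The choice of the constants -/

section Numerics

theorem size_le_logb {k : ℕ} (hk : 2 ≤ k) : (Nat.size k : ℝ) ≤ 2 * Real.logb 2 k ∧
    1 ≤ Real.logb 2 k := by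
  have hk' : (2 : ℝ) ≤ k := by exact_mod_cast hk
  have h1 : 1 ≤ Real.logb 2 k := by
    rw [Real.le_logb_iff_rpow_le (by norm_num) (by linarith)]
    simpa using hk'
  refine ⟨?_, h1⟩
  have hpos : 0 < Nat.size k := Nat.size_pos.2 (by omega)
  have h2 : 2 ^ (Nat.size k - 1) ≤ k := Nat.lt_size.1 (by omega)
  have h3 : ((Nat.size k - 1 : ℕ) : ℝ) ≤ Real.logb 2 k := by
    rw [Real.le_logb_iff_rpow_le (by norm_num) (by linarith), Real.rpow_natCast]
    exact_mod_cast h2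
  rw [Nat.cast_sub hpos] at h3
  push_cast at h3
  linarith

/-- For `t ≤ 1 / 2` one has `1 - t ≥ exp (-2 t)`, because `(1 + 2 t) (1 - t) ≥ 1`, and `exp (-2 t) ≥
2 ^ (-4 t)`, because `log 2 ≥ 1 / 2`. -/
theorem two_rpow_le_one_sub_pow {t : ℝ} (h0 : 0 ≤ t) (h1 : t ≤ 1 / 2) (m : ℕ) :
    (2 : ℝ) ^ (-(4 * (t * m))) ≤ (1 - t) ^ m := by
  have h2 : Real.exp (-(2 * t)) ≤ 1 - t := by
    rw [Real.exp_neg]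
    refine inv_le_of_inv_le₀ (by linarith) ?_
    refine le_trans ?_ (Real.add_one_le_exp (2 * t))
    rw [inv_le_iff_one_le_mul₀ (by linarith)]
    nlinarith
  have h3 : (2 : ℝ) ^ (-(4 * t)) ≤ 1 - t := by
    refine le_trans ?_ h2
    rw [Real.rpow_def_of_pos (by norm_num)]
    refine Real.exp_le_exp.2 ?_
    have := Real.log_two_gt_d9
    nlinarith
  calc (2 : ℝ) ^ (-(4 * (t * m))) = ((2 : ℝ) ^ (-(4 * t))) ^ m := by
        rw [← Real.rpow_natCast, ← Real.rpow_mul (by norm_num)]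
        ring_nf
    _ ≤ (1 - t) ^ m := pow_le_pow_left₀ (by positivity) h3 m

theorem trialProb_eq_rpow (s : ℕ) : trialProb s = (2 : ℝ) ^ (-(s : ℝ)) := by
  rw [trialProb, Real.rpow_neg (by norm_num), Real.rpow_natCast, one_div, inv_pow]

/-- Logarithms are dominated by powers. The factor `12` is chosen so that a radius bound `K * d`
with `d` at least half the scale is at least `6 * Nat.size k`, which leaves room for a positive
hazard parameter. -/
theorem exists_size_constant {α : ℝ} (hα : 0 < α) :
    ∃ K : ℕ, 1 ≤ K ∧ ∀ k : ℕ, 2 ≤ k → 12 * (Nat.size k : ℝ) ≤ K * (k : ℝ) ^ α := by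
  obtain ⟨K, hK⟩ := exists_nat_ge (48 / α)
  refine ⟨K + 1, by omega, fun k hk => ?_⟩
  have h1 := (size_le_logb hk).1
  have h2 := Real.log_le_rpow_div (x := k) (Nat.cast_nonneg k) hα
  have h3 : Real.logb 2 k ≤ 2 * ((k : ℝ) ^ α / α) := by
    rw [Real.logb, div_le_iff₀ (Real.log_pos (by norm_num))]
    have h4 := Real.log_two_gt_d9
    have h5 : 0 ≤ (k : ℝ) ^ α / α := by positivity
    nlinarith
  have h6 : 0 ≤ (k : ℝ) ^ α := by positivity
  push_cast
  calc 12 * (Nat.size k : ℝ) ≤ 48 / α * (k : ℝ) ^ α := by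
        have : 48 / α * (k : ℝ) ^ α = 48 * ((k : ℝ) ^ α / α) := by ring
        linarith
    _ ≤ (K + 1) * (k : ℝ) ^ α := mul_le_mul_of_nonneg_right (by linarith) h6

end Numerics

/-- The constants that the algorithm uses for a class of graphs with growth rate `δ`. -/
structure Constants (δ C₀ : ℝ) (K C B : ℕ) : Prop where
  δ_nonneg : 0 ≤ δ
  one_le_C₀ : 1 ≤ C₀
  one_le_K : 1 ≤ K
  size_le : ∀ k : ℕ, 2 ≤ k → 12 * (Nat.size k : ℝ) ≤ K * (k : ℝ) ^ (1 / (1 + δ))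
  le_C : C₀ * ((K : ℝ) + 1) ^ δ ≤ C
  le_B : 1 + δ ≤ B

theorem exists_constants {δ C₀ : ℝ} (hδ : 0 ≤ δ) (hC₀ : 1 ≤ C₀) :
    ∃ K C B, Constants δ C₀ K C B := by
  obtain ⟨K, hK1, hK⟩ := exists_size_constant (α := 1 / (1 + δ)) (by positivity)
  obtain ⟨C, hC⟩ := exists_nat_ge (C₀ * ((K : ℝ) + 1) ^ δ)
  obtain ⟨B, hB⟩ := exists_nat_ge (1 + δ)
  exact ⟨K, C, B, hδ, hC₀, hK1, hK, hC, hB⟩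

/-! ### Bounds for the output -/

/-- The growth bound for a single graph. -/
def GrowthBound {n : ℕ} (G : SimpleGraph (Fin n)) (δ C₀ : ℝ) : Prop :=
  ∀ (v : Fin n) (i : ℕ), ((reach G Finset.univ v i).card : ℝ) ≤ C₀ * ((i : ℝ) + 1) ^ δ

section Analysis

variable {δ C₀ : ℝ} {K C B : ℕ} {n : ℕ} {G : SimpleGraph (Fin n)} {k d s : ℕ}

theorem Constants.one_le_C (hc : Constants δ C₀ K C B) : (1 : ℝ) ≤ C := by
  refine le_trans ?_ hc.le_C
  have h1 : (1 : ℝ) ≤ ((K : ℝ) + 1) ^ δ :=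
    Real.one_le_rpow (by have : (0 : ℝ) ≤ K := Nat.cast_nonneg K; linarith) hc.δ_nonneg
  nlinarith [hc.one_le_C₀]

/-- `k ^ (1 / (1 + δ))`, the typical radius of a ball. -/
noncomputable abbrev scale (δ : ℝ) (k : ℕ) : ℝ := (k : ℝ) ^ (1 / (1 + δ))

theorem one_le_scale (hδ : 0 ≤ δ) (hk : 2 ≤ k) : 1 ≤ scale δ k :=
  Real.one_le_rpow (by exact_mod_cast (by omega : 1 ≤ k)) (by positivity)

theorem scale_rpow (hδ : 0 ≤ δ) : scale δ k ^ (1 + δ) = k := by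
  rw [scale, ← Real.rpow_mul (Nat.cast_nonneg k), one_div_mul_cancel (by linarith), Real.rpow_one]

theorem rpow_eq_div_scale (hk : 2 ≤ k) : (k : ℝ) ^ (1 - 1 / (1 + δ)) = k / scale δ k := by
  rw [Real.rpow_sub (by exact_mod_cast (by omega : 0 < k)), Real.rpow_one]

theorem one_le_div_scale (hδ : 0 ≤ δ) (hk : 2 ≤ k) : 1 ≤ k / scale δ k := by
  rw [← rpow_eq_div_scale hk]
  refine Real.one_le_rpow (by exact_mod_cast (by omega : 1 ≤ k)) ?_
  rw [sub_nonneg, div_le_one (by linarith)]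
  linarith

/-- The balance that defines the scale `σ`: the ball size `σ ^ δ` equals `k / σ`. -/
theorem scale_rpow_eq_div (hδ : 0 ≤ δ) (hk : 2 ≤ k) : scale δ k ^ δ = k / scale δ k := by
  have h1 := one_le_scale hδ hk
  rw [eq_div_iff (by linarith), ← Real.rpow_add_one (by linarith), add_comm δ 1, scale_rpow hδ]

theorem card_reach_le (hc : Constants δ C₀ K C B) (hG : GrowthBound G δ C₀) {q : ℕ} (hq : 1 ≤ q)
    (v : Fin n) : ((reach G Finset.univ v (K * q)).card : ℝ) ≤ C * (q : ℝ) ^ δ := by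
  have hq' : (1 : ℝ) ≤ q := by exact_mod_cast hq
  have hK : (0 : ℝ) ≤ K := Nat.cast_nonneg K
  calc ((reach G Finset.univ v (K * q)).card : ℝ) ≤ C₀ * (((K * q : ℕ) : ℝ) + 1) ^ δ := hG v _
    _ ≤ C₀ * (((K : ℝ) + 1) * q) ^ δ := by
        refine mul_le_mul_of_nonneg_left (Real.rpow_le_rpow (by positivity) ?_ hc.δ_nonneg)
          (by linarith [hc.one_le_C₀])
        push_cast
        nlinarith
    _ = C₀ * ((K : ℝ) + 1) ^ δ * (q : ℝ) ^ δ := by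
        rw [Real.mul_rpow (by positivity) (by positivity)]
        ring
    _ ≤ C * (q : ℝ) ^ δ := mul_le_mul_of_nonneg_right hc.le_C (by positivity)

/-- The failed test gives a ball with `(d + 1) * |ball| > C * k`, while growth bounds the left side
by `C * (d + 1) ^ (1 + δ)`. -/
theorem scale_lt (hc : Constants δ C₀ K C B) (hG : GrowthBound G δ C₀)
    (hd : GrowthParam G K C k d) (hdn : d < n) : scale δ k < d + 1 := by
  have hδ := hc.δ_nonneg
  have hfail := hd.fail hdn
  unfold GrowthTest at hfail
  push Not at hfail
  obtain ⟨v, hv⟩ := hfail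
  have h1 := card_reach_le hc hG (q := d + 1) (by omega) v
  have h2 : (C : ℝ) * k < ((d : ℝ) + 1) * (reach G Finset.univ v (K * (d + 1))).card := by
    exact_mod_cast hv
  have hd0 : (0 : ℝ) < (d : ℝ) + 1 := by positivity
  have hC := hc.one_le_C
  have h3 : (k : ℝ) < ((d : ℝ) + 1) ^ (1 + δ) := by
    rw [Real.rpow_add hd0, Real.rpow_one]
    push_cast at h1
    have h4 := mul_le_mul_of_nonneg_left h1 hd0.le
    by_contra hle
    have h5 := mul_le_mul_of_nonneg_left (not_lt.1 hle) (by linarith : (0 : ℝ) ≤ C)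
    nlinarith
  rw [← scale_rpow (k := k) hδ] at h3
  exact (Real.rpow_lt_rpow_iff (by positivity) hd0.le (by linarith)).1 h3

theorem one_le_growthParam (hc : Constants δ C₀ K C B) (hG : GrowthBound G δ C₀) (hk : 2 ≤ k)
    (hd : GrowthParam G K C k d) (hdn : d < n) : 1 ≤ d := by
  have h1 := scale_lt hc hG hd hdn
  have h2 := one_le_scale hc.δ_nonneg hk
  have : (0 : ℝ) < d := by linarith
  exact_mod_cast this

theorem mul_card_reach_le (hd : GrowthParam G K C k d) (hd1 : 1 ≤ d) (v : Fin n) :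
    d * (reach G Finset.univ v (K * d)).card ≤ C * k := by
  -- Round `q` tests radius `K * (q + 1)`, so radius `K * d` belongs to round `d - 1`.
  have := hd.pass (d - 1) (by omega) v
  rwa [Nat.sub_add_cancel hd1] at this

theorem card_reach_le_of_scale_le (hk : 2 ≤ k) (hδ : 0 ≤ δ) (hd : GrowthParam G K C k d) (hd1 : 1 ≤ d)
    (hs : scale δ k ≤ 2 * d) (v : Fin n) :
    ((reach G Finset.univ v (K * d)).card : ℝ) ≤ 2 * C * (k / scale δ k) := by
  have h1 : (d : ℝ) * (reach G Finset.univ v (K * d)).card ≤ C * k := by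
    exact_mod_cast mul_card_reach_le hd hd1 v
  have h2 := one_le_scale hδ hk
  rw [mul_div_assoc', le_div_iff₀ (by linarith)]
  have h3 : (0 : ℝ) ≤ (reach G Finset.univ v (K * d)).card := Nat.cast_nonneg _
  nlinarith

/-- Here `d = n`, so each component lies in a ball of radius `K * d`, and its size bounds the
treedepth. If `2 * d` reaches the scale, the passed test bounds the ball; otherwise `d` is below the
scale and the growth bound does. -/
theorem treedepth_univ_le (hc : Constants δ C₀ K C B) (hG : GrowthBound G δ C₀) (hk : 2 ≤ k)
    (hd : GrowthParam G K C k d) (hdn : ¬d < n) :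
    (treedepth G Finset.univ : ℝ) ≤ 2 * C * (k / scale δ k) := by
  obtain rfl : d = n := le_antisymm hd.le (not_lt.1 hdn)
  have hδ := hc.δ_nonneg
  have h0 := one_le_div_scale hδ hk
  have hpos : 0 ≤ 2 * C * (k / scale δ k) := by positivity
  have key : ∀ v : Fin d, ((reach G Finset.univ v (K * d)).card : ℝ) ≤ 2 * C * (k / scale δ k) := by
    intro v
    have hd1 : 1 ≤ d := v.pos
    rcases le_total (scale δ k) (2 * d) with h | h
    · exact card_reach_le_of_scale_le hk hδ hd hd1 h v
    · refine (card_reach_le hc hG hd1 v).trans ?_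
      have h1 : (d : ℝ) ^ δ ≤ scale δ k ^ δ := by
        refine Real.rpow_le_rpow (Nat.cast_nonneg d) ?_ hδ
        have : (0 : ℝ) ≤ d := Nat.cast_nonneg d
        linarith
      rw [scale_rpow_eq_div hδ hk] at h1
      have hC := hc.one_le_C
      nlinarith
  have := treedepth_le_add (G := G) ∅ 0 ⌊2 * C * (k / scale δ k)⌋₊ Finset.univ (by simp) ?_
  · rw [zero_add] at this
    exact (Nat.cast_le.2 this).trans (Nat.floor_le hpos)
  · intro Y _ _ hY
    obtain ⟨⟨u, hu⟩⟩ := hY.nonempty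
    refine (Finset.card_le_card (subset_reach_of_connected hY (Finset.subset_univ Y) hu)).trans ?_
    rw [Nat.le_floor_iff hpos, Fintype.card_fin]
    refine le_trans (Nat.cast_le.2 (Finset.card_le_card (reach_mono ?_))) (key u)
    exact Nat.le_mul_of_pos_left d hc.one_le_K

/-- The choice of `K` gives `6 * Nat.size k ≤ K * d`, which rules out `s = 0` and its degenerate
hazard `1`. Maximality of `s` gives `d ≤ 6 * Nat.size k * 2 ^ s`; with `scale δ k ≤ 2 * d` and
`Nat.size k ≤ 2 * Real.logb 2 k` the constant is `24`. -/
theorem hazard_bounds (hc : Constants δ C₀ K C B) (hk : 2 ≤ k)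
    (hs : HazardParam (Nat.size k) (K * d) s) (hsc : scale δ k ≤ 2 * d) :
    1 ≤ s ∧ 3 * Nat.size k * 2 ^ s ≤ K * d ∧
      (k : ℝ) / 2 ^ s ≤ 24 * (k / scale δ k * Real.logb 2 k) := by
  have h1 := hc.size_le k hk
  have hK : (1 : ℝ) ≤ K := by exact_mod_cast hc.one_le_K
  have h2 : 6 * Nat.size k ≤ K * d := by
    have : (6 : ℝ) * Nat.size k ≤ K * d := by nlinarith
    exact_mod_cast this
  have hs1 : 1 ≤ s := by
    by_contra h
    have h3 := hs.upper
    rw [show s = 0 by omega] at h3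
    omega
  refine ⟨hs1, hs.lower.resolve_right (by omega), ?_⟩
  have h4 : (K : ℝ) * d ≤ 6 * Nat.size k * 2 ^ s := by
    have := hs.upper.le
    rw [pow_succ] at this
    have h5 : ((K * d : ℕ) : ℝ) ≤ ((3 * Nat.size k * (2 ^ s * 2) : ℕ) : ℝ) := Nat.cast_le.2 this
    push_cast at h5
    linarith
  have h5 := (size_le_logb hk).1
  have h6 := one_le_scale hc.δ_nonneg hk
  have h7 : (0 : ℝ) < 2 ^ s := by positivity
  have h8 : (0 : ℝ) ≤ d := Nat.cast_nonneg d
  have h9 : scale δ k ≤ 24 * Real.logb 2 k * 2 ^ s := by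
    have : (d : ℝ) ≤ 6 * Nat.size k * 2 ^ s := by nlinarith
    have : (Nat.size k : ℝ) * 2 ^ s ≤ 2 * Real.logb 2 k * 2 ^ s :=
      mul_le_mul_of_nonneg_right h5 h7.le
    nlinarith
  rw [div_mul_eq_mul_div, mul_div_assoc', div_le_div_iff₀ h7 (by linarith)]
  have := mul_le_mul_of_nonneg_left h9 (Nat.cast_nonneg (α := ℝ) k)
  linarith

theorem treedepth_sample_le (hc : Constants δ C₀ K C B) (hG : GrowthBound G δ C₀) (hk : 2 ≤ k)
    (hd : GrowthParam G K C k d) (hs : HazardParam (Nat.size k) (K * d) s) {A : Finset (Fin n)}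
    (hA : A ∈ (sample G K B k d s).support) :
    (treedepth G A : ℝ) ≤ (24 + 2 * C) * (k / scale δ k * Real.logb 2 k) := by
  have hδ := hc.δ_nonneg
  have hlog := (size_le_logb hk).2
  have h0 := one_le_div_scale hδ hk
  have hC := hc.one_le_C
  have hmain : 2 * C * (k / scale δ k) ≤ 2 * C * (k / scale δ k * Real.logb 2 k) :=
    mul_le_mul_of_nonneg_left (le_mul_of_one_le_right (by linarith) hlog) (by linarith)
  have hpos : 0 ≤ k / scale δ k * Real.logb 2 k := by positivity
  rw [sample, PMF.mem_support_bind_iff] at hA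
  obtain ⟨r, hr, hA⟩ := hA
  rw [PMF.mem_support_map_iff] at hA
  obtain ⟨κ, -, rfl⟩ := hA
  split_ifs with hdn
  · have hd1 := one_le_growthParam hc hG hk hd hdn
    have hsc : scale δ k ≤ 2 * d := by
      have := scale_lt hc hG hd hdn
      have : (1 : ℝ) ≤ d := by exact_mod_cast hd1
      linarith
    have hpos' : 0 ≤ 2 * C * (k / scale δ k) := by positivity
    have h1 := treedepth_pruned_le (G := G) (M := K * d) (N := 2 ^ s) (k := k) (κ := κ)
      (F := ⌊2 * C * (k / scale δ k)⌋₊)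
      (fun i _ => iid_support (fun x hx => radius_support hx) hr i) (by positivity)
      (fun v => (Nat.le_floor_iff hpos').2 (card_reach_le_of_scale_le hk hδ hd hd1 hsc v))
    have h2 : ((k / 2 ^ s : ℕ) : ℝ) ≤ (k : ℝ) / 2 ^ s := by
      have := Nat.cast_div_le (α := ℝ) (m := k) (n := 2 ^ s)
      push_cast at this
      exact this
    have h3 := (hazard_bounds hc hk hs hsc).2.2
    have h4 := Nat.floor_le hpos'
    have h5 : (treedepth G (pruned G (2 ^ s) k r κ) : ℝ) ≤ ((k / 2 ^ s : ℕ) : ℝ) +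
        (⌊2 * C * (k / scale δ k)⌋₊ : ℝ) := by exact_mod_cast h1
    linarith
  · have := treedepth_univ_le hc hG hk hd hdn
    linarith

theorem card_nearby_le {X : Finset (Fin n)} (hX : X.card ≤ k) {ρ : ℕ} {b : ℝ} (hb0 : 0 ≤ b)
    (hb : ∀ v : Fin n, ((reach G Finset.univ v ρ).card : ℝ) ≤ b) :
    ((nearby G X ρ).card : ℝ) ≤ k * b := by
  classical
  have h1 : ((nearby G X ρ).card : ℝ) ≤ ∑ x ∈ X, ((reach G Finset.univ x ρ).card : ℝ) := by
    have := Finset.card_biUnion_le (s := X) (t := fun x => reach G Finset.univ x ρ)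
    exact_mod_cast this
  refine (h1.trans (Finset.sum_le_sum fun x _ => hb x)).trans ?_
  rw [Finset.sum_const, nsmul_eq_mul]
  exact mul_le_mul_of_nonneg_right (by exact_mod_cast hX) hb0

/-- The constant in the bound for the success probability. -/
noncomputable def probConstant (δ C₀ : ℝ) (K C B : ℕ) : ℝ :=
  4 * C + 96 + 48 * B + 4 * (C₀ * (2 * K * C + 3) ^ δ)

/-- Each of the four factors of `le_sample` becomes a power of `2`. Those for missed light radii and
for unwanted selections near `X` are bounded below by constants, since the failure probabilities are
tuned to the number of vertices near `X`; the hazard costs `O(E)` and the selection of boundary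
vertices `O(E * Real.logb 2 k)` in the exponent. -/
theorem sample_prob_ge (hc : Constants δ C₀ K C B) (hG : GrowthBound G δ C₀) (hk : 2 ≤ k)
    (hd : GrowthParam G K C k d) (hs : HazardParam (Nat.size k) (K * d) s) {X : Finset (Fin n)}
    (hX : X.card ≤ k) :
    (2 : ℝ) ^ (-(probConstant δ C₀ K C B * (k / scale δ k * Real.logb 2 k ^ 2))) ≤
      ((sample G K B k d s).toOuterMeasure {A | X ⊆ A}).toReal := by
  have hδ := hc.δ_nonneg
  obtain ⟨hsize, hlog⟩ := size_le_logb hk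
  have h0 := one_le_div_scale hδ hk
  have hC := hc.one_le_C
  have hC₀ := hc.one_le_C₀
  have hk1 : (1 : ℝ) ≤ k := by exact_mod_cast (by omega : 1 ≤ k)
  set E := k / scale δ k * Real.logb 2 k with hE
  have hE' : k / scale δ k * Real.logb 2 k ^ 2 = E * Real.logb 2 k := by rw [hE]; ring
  have hE1 : 1 ≤ E := one_le_mul_of_one_le_of_one_le h0 hlog
  have hT1 : 1 ≤ E * Real.logb 2 k := one_le_mul_of_one_le_of_one_le hE1 hlog
  have hET : E ≤ E * Real.logb 2 k := le_mul_of_one_le_right (by linarith) hlog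
  rw [hE']
  -- `toReal` sends `⊤` to `0`, so finiteness is needed to pass to `ℝ≥0∞`.
  have hle1 : (sample G K B k d s).toOuterMeasure {A | X ⊆ A} ≠ ⊤ := by
    rw [toOuterMeasure_eq_expect]
    refine ne_top_of_le_ne_top ENNReal.one_ne_top ?_
    refine le_trans (expect_mono fun A _ => Set.indicator_le_self _ _ A) (expect_const _ 1).le
  have hc2 : 0 ≤ probConstant δ C₀ K C B := by unfold probConstant; positivity
  rw [← ENNReal.ofReal_le_iff_le_toReal hle1]
  by_cases hdn : d < n
  swap
  · have h1 : (sample G K B k d s).toOuterMeasure {A | X ⊆ A} = 1 := by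
      rw [toOuterMeasure_eq_expect, sample, expect_bind]
      simp only [hdn, if_false, expect_map]
      simp [Set.indicator, expect_const]
    rw [h1, ← ENNReal.ofReal_one]
    refine ENNReal.ofReal_le_ofReal (Real.rpow_le_one_of_one_le_of_nonpos (by norm_num) ?_)
    rw [neg_nonpos]
    positivity
  have hd1 := one_le_growthParam hc hG hk hd hdn
  have hd1' : (1 : ℝ) ≤ d := by exact_mod_cast hd1
  have hsc : scale δ k ≤ 2 * d := by
    have := scale_lt hc hG hd hdn
    linarith
  obtain ⟨hs1, hM, hks⟩ := hazard_bounds hc hk hs hsc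
  refine le_trans (ENNReal.ofReal_le_ofReal ?_) (le_sample hM hX)
  set L := Nat.size k with hL
  have hkL : (k : ℝ) ≤ 2 ^ L := by exact_mod_cast (Nat.lt_size_self k).le
  have hLpos : 1 ≤ L := Nat.size_pos.2 (by omega)
  have hn1 : ((nearby G X (K * d)).card : ℝ) ≤ k * (C * k) := by
    refine card_nearby_le hX (by positivity) fun v => ?_
    have : (d : ℝ) * (reach G Finset.univ v (K * d)).card ≤ C * k := by
      exact_mod_cast mul_card_reach_le hd hd1 v
    have h3 : (0 : ℝ) ≤ (reach G Finset.univ v (K * d)).card := Nat.cast_nonneg _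
    nlinarith
  -- The test passed for a ball with at least one vertex. So `d`, hence the radius of the
  -- neighbourhood of `X`, is linear in `k`.
  have hdk : (d : ℝ) ≤ C * k := by
    have hn : 0 < n := by omega
    have h2 := mul_card_reach_le hd hd1 ⟨0, hn⟩
    have h3 : 0 < (reach G Finset.univ (⟨0, hn⟩ : Fin n) (K * d)).card :=
      Finset.card_pos.2 ⟨_, self_mem_reach⟩
    have h4 : d ≤ C * k := (Nat.le_mul_of_pos_right d h3).trans h2
    exact_mod_cast h4
  have hn2 : ((nearby G X (2 * (K * d) + 2)).card : ℝ) ≤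
      k * (C₀ * ((2 * K * C + 3) ^ δ * (k : ℝ) ^ δ)) := by
    refine card_nearby_le hX (by positivity) fun v => (hG v _).trans ?_
    refine mul_le_mul_of_nonneg_left ?_ (by linarith)
    rw [← Real.mul_rpow (by positivity) (by positivity)]
    refine Real.rpow_le_rpow (by positivity) ?_ hδ
    push_cast
    have : (K : ℝ) * d ≤ K * (C * k) := mul_le_mul_of_nonneg_left hdk (Nat.cast_nonneg K)
    nlinarith
  have hhalf : ∀ j : ℕ, 1 ≤ j → ((1 : ℝ) / 2) ^ j ≤ 1 / 2 := fun j hj =>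
    pow_le_of_le_one (by norm_num) (by norm_num) (by omega)
  have hB1 : 1 ≤ B := by
    have : (1 : ℝ) ≤ B := by linarith [hc.le_B]
    exact_mod_cast this
  have t1 := two_rpow_le_one_sub_pow (t := (1 / 2) ^ (2 * L)) (by positivity)
    (hhalf _ (by omega)) (nearby G X (K * d)).card
  have t2 := two_rpow_le_one_sub_pow (t := trialProb s) (trialProb_nonneg s) (hhalf s hs1) k
  have t3 : (2 : ℝ) ^ (-((B : ℝ) * L * (k / 2 ^ s))) ≤ trialProb (B * L) ^ (k / 2 ^ s) := by
    rw [trialProb_eq_rpow, ← Real.rpow_natCast _ (k / 2 ^ s), ← Real.rpow_mul (by norm_num)]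
    refine Real.rpow_le_rpow_of_exponent_le (by norm_num) ?_
    push_cast
    rw [neg_mul, neg_le_neg_iff]
    refine mul_le_mul_of_nonneg_left ?_ (by positivity)
    have := Nat.cast_div_le (α := ℝ) (m := k) (n := 2 ^ s)
    push_cast at this
    exact this
  have t4 := two_rpow_le_one_sub_pow (t := trialProb (B * L)) (trialProb_nonneg _)
    (hhalf _ (Nat.mul_pos hB1 hLpos)) (nearby G X (2 * (K * d) + 2)).card
  -- At most `C * k ^ 2` centers are relevant, and `k ≤ 2 ^ L`; this is why the missing probability
  -- had to be `4 ^ (-L)`.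
  have b1 : 4 * ((1 / 2) ^ (2 * L) * ((nearby G X (K * d)).card : ℝ)) ≤ 4 * C := by
    have e1 : ((1 : ℝ) / 2) ^ (2 * L) * ((k : ℝ) * k) ≤ 1 := by
      have : (k : ℝ) * k ≤ 2 ^ (2 * L) := by
        rw [two_mul, pow_add]
        exact mul_le_mul hkL hkL (by positivity) (by positivity)
      rw [one_div_pow, one_div, inv_mul_le_iff₀ (by positivity)]
      linarith
    have e2 := mul_le_mul_of_nonneg_left hn1 (by positivity : (0 : ℝ) ≤ (1 / 2) ^ (2 * L))
    nlinarith
  have b2 : 4 * (trialProb s * (k : ℝ)) ≤ 96 * E := by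
    have : trialProb s * (k : ℝ) = k / 2 ^ s := by
      rw [trialProb_eq]
      push_cast
      ring
    rw [this]
    linarith
  have b3 : (B : ℝ) * L * (k / 2 ^ s) ≤ 48 * B * (E * Real.logb 2 k) := by
    calc (B : ℝ) * L * (k / 2 ^ s) ≤ (B : ℝ) * (2 * Real.logb 2 k) * (24 * E) := by
          refine mul_le_mul (mul_le_mul_of_nonneg_left hsize (Nat.cast_nonneg B)) hks
            (by positivity) (by positivity)
      _ = _ := by ring
  -- The vertices near `X` number `O(k ^ (1 + δ))`, and `1 + δ ≤ B` makes this `O(2 ^ (B * L))`.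
  have b4 : 4 * (trialProb (B * L) * ((nearby G X (2 * (K * d) + 2)).card : ℝ)) ≤
      4 * (C₀ * (2 * K * C + 3) ^ δ) := by
    have e1 : trialProb (B * L) * ((k : ℝ) * (k : ℝ) ^ δ) ≤ 1 := by
      have h5 : (k : ℝ) * (k : ℝ) ^ δ ≤ 2 ^ (B * L) := by
        calc (k : ℝ) * (k : ℝ) ^ δ = (k : ℝ) ^ (1 + δ) := by
              rw [Real.rpow_add (by linarith), Real.rpow_one]
          _ ≤ (k : ℝ) ^ (B : ℝ) := Real.rpow_le_rpow_of_exponent_le hk1 hc.le_B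
          _ = (k : ℝ) ^ B := Real.rpow_natCast _ _
          _ ≤ (2 ^ L) ^ B := pow_le_pow_left₀ (by linarith) hkL B
          _ = 2 ^ (B * L) := by rw [← pow_mul, mul_comm]
      rw [trialProb, one_div_pow, one_div, inv_mul_le_iff₀ (by positivity)]
      linarith
    have e2 := mul_le_mul_of_nonneg_left hn2 (trialProb_nonneg (B * L))
    have e3 : 0 ≤ C₀ * (2 * (K : ℝ) * C + 3) ^ δ := by positivity
    have e4 := mul_le_mul_of_nonneg_left e1 e3
    have e5 : trialProb (B * L) * (k * (C₀ * ((2 * (K : ℝ) * C + 3) ^ δ * (k : ℝ) ^ δ))) =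
        C₀ * (2 * (K : ℝ) * C + 3) ^ δ * (trialProb (B * L) * ((k : ℝ) * (k : ℝ) ^ δ)) := by ring
    linarith
  calc (2 : ℝ) ^ (-(probConstant δ C₀ K C B * (E * Real.logb 2 k)))
      ≤ (2 : ℝ) ^ ((-(4 * ((1 / 2) ^ (2 * L) * ((nearby G X (K * d)).card : ℝ))) +
          -(4 * (trialProb s * (k : ℝ)))) + (-((B : ℝ) * L * (k / 2 ^ s)) +
          -(4 * (trialProb (B * L) * ((nearby G X (2 * (K * d) + 2)).card : ℝ))))) := by
        refine Real.rpow_le_rpow_of_exponent_le (by norm_num) ?_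
        have f1 : (4 : ℝ) * C ≤ 4 * C * (E * Real.logb 2 k) :=
          le_mul_of_one_le_right (by positivity) hT1
        have f2 : 4 * (C₀ * (2 * K * C + 3) ^ δ) ≤
            4 * (C₀ * (2 * K * C + 3) ^ δ) * (E * Real.logb 2 k) :=
          le_mul_of_one_le_right (by positivity) hT1
        unfold probConstant
        linarith
    _ ≤ _ := by
        rw [Real.rpow_add (by norm_num), Real.rpow_add (by norm_num), Real.rpow_add (by norm_num)]
        refine mul_le_mul (mul_le_mul t1 t2 (by positivity) ?_) (mul_le_mul t3 t4 (by positivity) ?_)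
          (by positivity) (mul_nonneg ?_ ?_)
        · exact pow_nonneg (one_sub_half_pow_nonneg _) _
        · exact pow_nonneg (trialProb_nonneg _) _
        · exact pow_nonneg (one_sub_half_pow_nonneg _) _
        · exact pow_nonneg (one_sub_trialProb_nonneg _) _

end Analysis

/-! ### The theorem -/

theorem theorem1 (𝒢 : (n : ℕ) → Set (SimpleGraph (Fin n))) (δ : ℝ) (hδ : 0 ≤ δ)
    (h𝒢 : HasPolynomialGrowth 𝒢 δ) :
    ∃ (P : Prog) (p : Polynomial ℕ) (c₁ c₂ : ℝ),
      ∀ (n : ℕ), ∀ G ∈ 𝒢 n, ∀ k : ℕ, 2 ≤ k →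
        HaltsWithin P G k (p.eval (inputSize n k)) ∧
        (∀ A ∈ (outputDist P G k (p.eval (inputSize n k))).support,
          (treedepth G A : ℝ) ≤ c₁ * ((k : ℝ) ^ (1 - 1 / (1 + δ)) * Real.logb 2 k)) ∧
        (∀ X : Finset (Fin n), X.card ≤ k →
          (2 : ℝ) ^ (-(c₂ * ((k : ℝ) ^ (1 - 1 / (1 + δ)) * Real.logb 2 k ^ 2))) ≤
            ((outputDist P G k (p.eval (inputSize n k))).toOuterMeasure {A | X ⊆ A}).toReal) := by
  obtain ⟨C', hC'⟩ := h𝒢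
  -- The growth constant may be smaller than `1`; the maximum with `1` only weakens the growth
  -- bound.
  obtain ⟨K, C, B, hc⟩ := exists_constants hδ (le_max_right C' 1)
  obtain ⟨p, hp⟩ := exists_polynomial_mainTime K B
  refine ⟨mainProg K C B, p, 24 + 2 * C, probConstant δ (max C' 1) K C B, fun n G hG k hk => ?_⟩
  have hgrowth : GrowthBound G δ (max C' 1) := by
    intro v i
    rw [card_reach_univ]
    refine (hC' n G hG v (i + 1)).trans ?_
    push_cast
    exact mul_le_mul_of_nonneg_right (le_max_left _ _) (by positivity)
  obtain ⟨d, s, hd, hs, hhalt, hdist⟩ :=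
    mainProg_spec G K C B k (p.eval (inputSize n k)) hk (hp _).ge
  rw [hdist, rpow_eq_div_scale hk]
  exact ⟨hhalt, fun A hA => treedepth_sample_le hc hgrowth hk hd hs hA,
    fun X hX => sample_prob_ge hc hgrowth hk hd hs hX⟩
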